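/- Let $n\ge 2$ and let $(z,w)=(z_1,\dots,z_n,w)$ be the coordinates of $\mathbb C^{n+1}$. For a smooth real submanifold $S\subset\mathbb C^{n+1}$ and $x\in S$, let $T^{(1,0)}_xS$ be its tangent space of type $(1,0)$ at $x$; $x$ is a CR point of $S$ if $\dim_{\mathbb C}T^{(1,0)}_yS$ is constant for $y\in S$ near $x$, and $S$ is a CR submanifold if all its points are CR points. A CR point $x$ of $M$ is non-minimal if $M$ contains a CR submanifold $S$ through $x$ of smaller dimension than $M$ with $T^{(1,0)}_xS=T^{(1,0)}_xM$. For real numbers $0\le\lambda_1,\dots,\lambda_n<\infty$ put $q(z,\bar z)=\sum_{i=1}^n\big(|z_i|^2+\lambda_i(z_i^2+\bar z_i^2)\big)$. (a) Let $M\subset\mathbb C^{n+1}$ be a smooth real submanifold of dimension $2n$ which near $0$ is defined by $$w=q(z,\bar z)+p(z,\bar z)+iE(z,\bar z),$$ where $p,E$ are real-valued smooth functions near $0$ with $p,E=O(|z|^3)$. Suppose that $\lambda_i\ne\frac12$ for some $i$, and that all CR points of $M$ sufficiently close to $0$ are non-minimal. Then for every positive integer $N$ there is a holomorphic change of coordinates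 near $0$ of the form $z'=z,\ w'=w+B(z,w)$ with $B(z,w)=o(|z|^2+|w|)$ as $(z,w)\to0$, such that in the new coordinates $M$ is defined near $0$ by an equation $w'=\rho(z',\bar z')$ with $\rho$ smooth and $\operatorname{Im}\rho=O(|z'|^N)$. (b) Let $M\subset\mathbb C^{n+1}$ be a smooth real submanifold of dimension $2n$ and $a\in M$ a non-degenerate CR singular point with Bishop invariants $\lambda_1,\dots,\lambda_n\ge0$; that is, there is a holomorphic change of coordinates near $a$, taking $a$ to $0$, after which $M$ is defined near $0$ by a smooth equation $w=q(z,\bar z)+o(|z|^2)$. Suppose that $\lambda_i\neq\frac12$ for some $i$, and that all CR points of $M$ sufficiently close to $a$ are non-minimal. Then for every positive integer $N$ there is a holomorphic change of coordinates near $a$, taking $a$ to $0$, after which $M$ is defined near $0$ by an equation $w=\rho(z,\bar z)$ with $\rho$ smooth and $\operatorname{Im}\rho=O(|z|^N)$. -/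

import Mathlib

open scoped Topology ContDiff ComplexConjugate
open Filter Asymptotics

namespace CRFlat

/-- The space `ℂⁿ⁺¹` with coordinates `(z, w)`, `z ∈ ℂⁿ`, `w ∈ ℂ`. The (sup) norm is equivalent to
the Euclidean one; it is used only for neighbourhoods and orders of vanishing. -/
abbrev Cn1 (n : ℕ) : Type := (Fin n → ℂ) × ℂ

/-- `f` is a `C^∞` function on some neighbourhood of `a`. -/
def SmoothNear {X Y : Type*} [NormedAddCommGroup X] [NormedSpace ℝ X]
    [NormedAddCommGroup Y] [NormedSpace ℝ Y] (f : X → Y) (a : X) : Prop :=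
  ∀ᶠ x in 𝓝 a, ContDiffAt ℝ ∞ f x

/-- `S` is a smooth (`C^∞`, embedded, without boundary) real submanifold of `ℂⁿ⁺¹` of real
codimension `k`, i.e. of real dimension `2n + 2 - k`: near each of its points it is the zero set of
a smooth `ℝᵏ`-valued submersion. -/
def IsSmoothSubmanifold {n : ℕ} (k : ℕ) (S : Set (Cn1 n)) : Prop :=
  ∀ x ∈ S, ∃ (U : Set (Cn1 n)) (r : Cn1 n → (Fin k → ℝ)),
    IsOpen U ∧ x ∈ U ∧ ContDiffOn ℝ ∞ r U ∧ S ∩ U = {y ∈ U | r y = 0} ∧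
      Function.Surjective (fderiv ℝ r x)

/-- The real tangent space `T_x S`, spanned by the velocities at `x` of curves that lie in `S`
(for a submanifold these velocities already form a linear space). -/
noncomputable def tangentSpace {n : ℕ} (S : Set (Cn1 n)) (x : Cn1 n) : Submodule ℝ (Cn1 n) :=
  Submodule.span ℝ {v | ∃ γ : ℝ → Cn1 n,
    γ 0 = x ∧ HasDerivAt γ v 0 ∧ ∀ᶠ t in 𝓝 (0 : ℝ), γ t ∈ S}

/-- The tangent space `T_x^{(1,0)} S` of type `(1,0)`. A vector `∑ vⱼ ∂/∂zⱼ + v₀ ∂/∂w` of type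
`(1,0)` is identified with its coefficient vector `v ∈ ℂⁿ⁺¹`; it lies in `ℂ ⊗ T_x S` exactly when
the real vectors `v` and `i v` are both tangent to `S`. -/
noncomputable def holTangentSpace {n : ℕ} (S : Set (Cn1 n)) (x : Cn1 n) : Submodule ℂ (Cn1 n) where
  carrier := {v | v ∈ tangentSpace S x ∧ Complex.I • v ∈ tangentSpace S x}
  zero_mem' := by simp
  add_mem' := by
    rintro a b ⟨ha, ha'⟩ ⟨hb, hb'⟩
    exact ⟨add_mem ha hb, by rw [smul_add]; exact add_mem ha' hb'⟩
  smul_mem' := by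
    rintro c v ⟨hv, hv'⟩
    have key : ∀ d : ℂ, d • v = d.re • v + d.im • (Complex.I • v) := by
      intro d
      rw [← Complex.coe_smul d.re, ← Complex.coe_smul d.im, smul_smul, ← add_smul,
        Complex.re_add_im]
    have mem : ∀ d : ℂ, d • v ∈ tangentSpace S x := by
      intro d
      rw [key d]
      exact add_mem (Submodule.smul_mem _ _ hv) (Submodule.smul_mem _ _ hv')
    exact ⟨mem c, by rw [smul_smul]; exact mem _⟩

/-- The CR dimension `CR_S(x) = dim_ℂ T_x^{(1,0)} S`. -/
noncomputable def crDim {n : ℕ} (S : Set (Cn1 n)) (x : Cn1 n) : ℕ :=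
  Module.finrank ℂ (holTangentSpace S x)

/-- `x` is a CR point of `S`: the CR dimension is constant on `S` near `x`. -/
def IsCRPoint {n : ℕ} (S : Set (Cn1 n)) (x : Cn1 n) : Prop :=
  x ∈ S ∧ ∀ᶠ y in 𝓝[S] x, crDim S y = crDim S x

/-- `x` is a non-minimal point of the manifold `M` of codimension `k`: there is a CR submanifold
`S ⊆ M` through `x`, of smaller dimension than `M`, with `T_x^{(1,0)} S = T_x^{(1,0)} M`. -/
def IsNonMinimalPoint {n : ℕ} (k : ℕ) (M : Set (Cn1 n)) (x : Cn1 n) : Prop :=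
  ∃ (l : ℕ) (S : Set (Cn1 n)), k < l ∧ S ⊆ M ∧ x ∈ S ∧ IsSmoothSubmanifold l S ∧
    (∀ y ∈ S, IsCRPoint S y) ∧ holTangentSpace S x = holTangentSpace M x

/-- Every CR point of the codimension two manifold `M` sufficiently close to `a` is non-minimal. -/
def NonMinimalNear {n : ℕ} (M : Set (Cn1 n)) (a : Cn1 n) : Prop :=
  ∀ᶠ x in 𝓝 a, IsCRPoint M x → IsNonMinimalPoint 2 M x

/-- Near the origin the set `A` is defined by the equation `w = f(z)`. -/
def DefinedNearZeroBy {n : ℕ} (A : Set (Cn1 n)) (f : (Fin n → ℂ) → ℂ) : Prop :=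
  ∀ᶠ x in 𝓝 (0 : Cn1 n), (x ∈ A ↔ x.2 = f x.1)

/-- The quadric `q(z, z̄) = ∑ᵢ (|zᵢ|² + λᵢ (zᵢ² + z̄ᵢ²))`. -/
noncomputable def quadric {n : ℕ} (lam : Fin n → ℝ) (z : Fin n → ℂ) : ℂ :=
  ∑ i, (z i * conj (z i) + (lam i : ℂ) * (z i ^ 2 + conj (z i) ^ 2))

/-- `Φ` is a holomorphic change of coordinates (a biholomorphic map between open sets) defined
near `a`, with `Φ a = 0`. -/
def IsHolChange {n : ℕ} (Φ : OpenPartialHomeomorph (Cn1 n) (Cn1 n)) (a : Cn1 n) : Prop :=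
  a ∈ Φ.source ∧ Φ a = 0 ∧
    DifferentiableOn ℂ Φ Φ.source ∧ DifferentiableOn ℂ Φ.symm Φ.target

/-- `a` is a non-degenerate CR singular point of `M` with Bishop invariants `lam`: in suitable
holomorphic coordinates centred at `a`, `M` is defined by `w = q(z, z̄) + o(|z|²)`. -/
def HasBishopInvariants {n : ℕ} (M : Set (Cn1 n)) (a : Cn1 n) (lam : Fin n → ℝ) : Prop :=
  (∀ i, 0 ≤ lam i) ∧
    ∃ (Φ : OpenPartialHomeomorph (Cn1 n) (Cn1 n)) (f : (Fin n → ℂ) → ℂ),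
      IsHolChange Φ a ∧ SmoothNear f 0 ∧
      (fun z => f z - quadric lam z) =o[𝓝 0] (fun z => ‖z‖ ^ 2) ∧
      DefinedNearZeroBy (Φ '' (M ∩ Φ.source)) f

end CRFlat

/-!
# Formal flattening of non-minimal submanifolds near a CR singularity

Write `M` near the singular point as a graph `w = F(z)` with `F = q + O(|z|³)` and remove the
imaginary part of `F` degree by degree by shears `w ↦ w + b(z, w)`. The leading part `e` of `Im F`
has to be of the form `b(z, q) + conj b(z, q)`, with `b` a holomorphic polynomial, and
non-minimality is what forces this.

*From non-minimality to equations.* Through a CR point passes a submanifold `S` of `M` of smaller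
dimension to which all complex tangential fields of `M` are tangent. In the `z`-space, `S` lies in
the zero set of a real function `φ` with `dφ ≠ 0`, and `dφ` annihilates these fields and their
iterated brackets along `S`. Since `∂φ` annihilates the kernel of `∂F̄`, we have `∂φ = c ∂F̄` and
`∂̄φ = c̄ ∂̄F` at the point, with `c ≠ 0`. For the fields `L = F̄_p ∂_q - F̄_q ∂_p` and their conjugates,
evaluating `dφ` on `[L, N̄]` and `[L', [L, N̄]]` shows that the second order operator `leviOp` and
the third order operator `thirdOp` take on `F̄` and on `F` proportional values
(`exists_proportional`). The resulting quadratic identities also hold at the other points near `0`,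
where the coefficients of `N̄` vanish, and their leading parts say that the polynomials `leviOp e`
and `thirdOp e`, formed with the fields tangent to `q = const`, are proportional to `leviOp q` and
`thirdOp q` (`NonMinimalGraph.linearized`).

*Solving the linearized equations.* If `λ_k ≠ 1/2`, then `s = a_k b_k + a_l b_l`, where `a = ∂q/∂z`
and `b = ∂q/∂z̄`, is a prime polynomial, and the equations show that it divides the corresponding
Levi form of `e` (`LinearizedNonMinimal.pairForm_dvd`). If `h` is the quotient, then the
polynomials `∂e/∂z_j - h a_j` are CR on the leaves `q = const`, hence are polynomials in `z` and `q`
(`IsCRPoly.exists_substQ`), and similarly for the conjugate variables. Such data integrate to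
`e = f(z, q) + g(z̄, q)` (`exists_substQ_add`), by induction on the degree: the polynomial `h`,
which plays the role of `∂e/∂w`, satisfies the same hypotheses. Since `e` is real, `g`
can be taken to be the conjugate of `f`.

*Geometry.* The remaining lemmas translate the hypotheses on `M` into the `z`-space, in an arbitrary
holomorphic chart (`nonMinimalGraph_of_nonMinimalNear`). There the smoothness of holomorphic maps of
several variables is needed; it follows from Cauchy's formula on discs. The composition of the
shears is inverted by the inverse function theorem.
-/

namespace CRFlat

open MvPolynomial

/-! ### Polynomials in `z` and `z̄` -/

/-- Polynomials in `z` (the variables `Sum.inl j`) and `z̄` (the variables `Sum.inr j`, treated as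
independent of the former). -/
abbrev Poly (n : ℕ) : Type := MvPolynomial (Fin n ⊕ Fin n) ℂ

/-- The quadric `q` as a polynomial in `z` and `z̄`. -/
noncomputable def quadPoly {n : ℕ} (lam : Fin n → ℝ) : Poly n :=
  ∑ i, (X (Sum.inl i) * X (Sum.inr i) +
    C (lam i : ℂ) * (X (Sum.inl i) ^ 2 + X (Sum.inr i) ^ 2))

/-- The linear form `∂q/∂z_j`. -/
noncomputable def linA {n : ℕ} (lam : Fin n → ℝ) (j : Fin n) : Poly n :=
  X (Sum.inr j) + C (2 * (lam j : ℂ)) * X (Sum.inl j)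

/-- The linear form `∂q/∂z̄_j`. -/
noncomputable def linB {n : ℕ} (lam : Fin n → ℝ) (j : Fin n) : Poly n :=
  X (Sum.inl j) + C (2 * (lam j : ℂ)) * X (Sum.inr j)

/-- Exchange of `z` and `z̄` without conjugating coefficients. -/
noncomputable def swapHom (n : ℕ) : Poly n →ₐ[ℂ] Poly n := rename Sum.swap

/-- Complex conjugation on polynomials in `z` and `z̄`. -/
noncomputable def conjHom (n : ℕ) : Poly n →+* Poly n :=
  ((swapHom n : Poly n →ₐ[ℂ] Poly n) : Poly n →+* Poly n).comp (map (starRingEnd ℂ))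

section derivatives

variable {n : ℕ} (lam : Fin n → ℝ)

@[simp] lemma pderiv_inl_quadPoly (j : Fin n) :
    pderiv (Sum.inl j) (quadPoly lam) = linA lam j := by
  rw [quadPoly, map_sum, Finset.sum_eq_single j]
  · simp only [map_add, pderiv_mul, pderiv_X_self, pderiv_pow, pderiv_C, linA, map_mul,
      pderiv_X_of_ne (show (Sum.inr j : Fin n ⊕ Fin n) ≠ Sum.inl j by simp)]
    simp only [map_ofNat]
    ring
  · intro i _ hi
    simp only [map_add, pderiv_mul, pderiv_pow, pderiv_C,
      pderiv_X_of_ne (show (Sum.inr i : Fin n ⊕ Fin n) ≠ Sum.inl j by simp),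
      pderiv_X_of_ne (show (Sum.inl i : Fin n ⊕ Fin n) ≠ Sum.inl j by simpa using hi)]
    ring
  · simp

@[simp] lemma pderiv_inr_quadPoly (j : Fin n) :
    pderiv (Sum.inr j) (quadPoly lam) = linB lam j := by
  rw [quadPoly, map_sum, Finset.sum_eq_single j]
  · simp only [map_add, pderiv_mul, pderiv_X_self, pderiv_pow, pderiv_C, linB, map_mul,
      pderiv_X_of_ne (show (Sum.inl j : Fin n ⊕ Fin n) ≠ Sum.inr j by simp)]
    simp only [map_ofNat]
    ring
  · intro i _ hi
    simp only [map_add, pderiv_mul, pderiv_pow, pderiv_C,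
      pderiv_X_of_ne (show (Sum.inl i : Fin n ⊕ Fin n) ≠ Sum.inr j by simp),
      pderiv_X_of_ne (show (Sum.inr i : Fin n ⊕ Fin n) ≠ Sum.inr j by simpa using hi)]
    ring
  · simp

lemma pderiv_inl_linA (i j : Fin n) :
    pderiv (Sum.inl i) (linA lam j) = if i = j then C (2 * (lam j : ℂ)) else 0 := by
  classical
  simp [linA, pderiv_X, Pi.single_apply, eq_comm]

lemma pderiv_inr_linA (i j : Fin n) :
    pderiv (Sum.inr i) (linA lam j) = if i = j then 1 else 0 := by
  classical
  simp [linA, pderiv_X, Pi.single_apply, eq_comm]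

lemma pderiv_inr_linB (i j : Fin n) :
    pderiv (Sum.inr i) (linB lam j) = if i = j then C (2 * (lam j : ℂ)) else 0 := by
  classical
  simp [linB, pderiv_X, Pi.single_apply, eq_comm]

lemma pderiv_inl_linB (i j : Fin n) :
    pderiv (Sum.inl i) (linB lam j) = if i = j then 1 else 0 := by
  classical
  simp [linB, pderiv_X, Pi.single_apply, eq_comm]

lemma pderiv_comm (i j : Fin n ⊕ Fin n) (p : Poly n) :
    pderiv i (pderiv j p) = pderiv j (pderiv i p) := by
  induction p using MvPolynomial.induction_on' with
  | monomial s a =>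
    rcases eq_or_ne i j with rfl | h
    · rfl
    · rw [pderiv_monomial, pderiv_monomial, pderiv_monomial, pderiv_monomial, tsub_right_comm]
      simp [h, h.symm, mul_right_comm]
  | add p q hp hq => simp only [map_add, hp, hq]

@[simp] lemma swapHom_swapHom (p : Poly n) : swapHom n (swapHom n p) = p := by
  rw [swapHom, rename_rename]
  simp

lemma pderiv_swapHom (i : Fin n ⊕ Fin n) (p : Poly n) :
    pderiv i (swapHom n p) = swapHom n (pderiv i.swap p) := by
  have h := pderiv_rename (R := ℂ) (f := (Sum.swap : Fin n ⊕ Fin n → Fin n ⊕ Fin n))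
    (Function.LeftInverse.injective Sum.swap_leftInverse) i.swap p
  simpa [swapHom] using h

@[simp] lemma swapHom_linA (j : Fin n) : swapHom n (linA lam j) = linB lam j := by
  simp [swapHom, linA, linB, rename_X]

@[simp] lemma swapHom_linB (j : Fin n) : swapHom n (linB lam j) = linA lam j := by
  simp [swapHom, linA, linB, rename_X]

lemma conjHom_apply (p : Poly n) : conjHom n p = swapHom n (map (starRingEnd ℂ) p) := rfl

@[simp] lemma conjHom_X (i : Fin n ⊕ Fin n) : conjHom n (X i) = X i.swap := by
  simp [conjHom_apply, swapHom]

@[simp] lemma conjHom_C (c : ℂ) : conjHom n (C c) = C (conj c) := by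
  simp [conjHom_apply, swapHom]

@[simp] lemma conjHom_conjHom (p : Poly n) : conjHom n (conjHom n p) = p := by
  induction p using MvPolynomial.induction_on with
  | C a => simp
  | add p q hp hq => simp only [map_add, hp, hq]
  | mul_X p i hp => simp only [map_mul, hp, conjHom_X, Sum.swap_swap]

lemma pderiv_conjHom (i : Fin n ⊕ Fin n) (p : Poly n) :
    pderiv i (conjHom n p) = conjHom n (pderiv i.swap p) := by
  rw [conjHom_apply, pderiv_swapHom, pderiv_map, conjHom_apply]

@[simp] lemma conjHom_linA (j : Fin n) : conjHom n (linA lam j) = linB lam j := by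
  simp [linA, linB, map_ofNat (starRingEnd ℂ) 2]

@[simp] lemma conjHom_linB (j : Fin n) : conjHom n (linB lam j) = linA lam j := by
  simp [linA, linB, map_ofNat (starRingEnd ℂ) 2]

lemma conjHom_isHomogeneous {p : Poly n} {k : ℕ} (hp : p.IsHomogeneous k) :
    (conjHom n p).IsHomogeneous k := by
  rw [conjHom_apply, swapHom]
  exact (hp.map _).rename_isHomogeneous

lemma quadPoly_isHomogeneous : (quadPoly lam).IsHomogeneous 2 := by
  refine IsHomogeneous.sum _ _ _ fun i _ => ?_
  refine IsHomogeneous.add ((isHomogeneous_X _ _).mul (isHomogeneous_X _ _)) ?_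
  exact ((((isHomogeneous_X _ _).pow 2).add ((isHomogeneous_X _ _).pow 2)).C_mul _)

lemma linA_isHomogeneous (j : Fin n) : (linA lam j).IsHomogeneous 1 :=
  (isHomogeneous_X _ _).add ((isHomogeneous_X _ _).C_mul _)

lemma linB_isHomogeneous (j : Fin n) : (linB lam j).IsHomogeneous 1 :=
  (isHomogeneous_X _ _).add ((isHomogeneous_X _ _).C_mul _)

end derivatives

/-! ### Divisibility by the linear forms `∂q/∂z_j`, `∂q/∂z̄_j` -/

section divisibility

variable {n : ℕ} (lam : Fin n → ℝ)

lemma prime_linB (j : Fin n) : Prime (linB lam j) := by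
  classical
  have hc : coeff (Finsupp.single (Sum.inl j) 1) (linB lam j) = 1 := by
    rw [linB, coeff_add, coeff_C_mul]
    simp [coeff_X, Finsupp.single_left_inj]
  have h0 : linB lam j ≠ 0 := by
    intro h
    simp [h] at hc
  refine UniqueFactorizationMonoid.irreducible_iff_prime.1
    (irreducible_of_totalDegree_eq_one ((linB_isHomogeneous lam j).totalDegree h0) fun x hx => ?_)
  exact isUnit_of_dvd_one (hc ▸ hx (Finsupp.single (Sum.inl j) 1))

lemma prime_linA (j : Fin n) : Prime (linA lam j) := by
  classical
  have hc : coeff (Finsupp.single (Sum.inr j) 1) (linA lam j) = 1 := by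
    rw [linA, coeff_add, coeff_C_mul]
    simp [coeff_X, Finsupp.single_left_inj]
  have h0 : linA lam j ≠ 0 := by
    intro h
    simp [h] at hc
  refine UniqueFactorizationMonoid.irreducible_iff_prime.1
    (irreducible_of_totalDegree_eq_one ((linA_isHomogeneous lam j).totalDegree h0) fun x hx => ?_)
  exact isUnit_of_dvd_one (hc ▸ hx (Finsupp.single (Sum.inr j) 1))

lemma not_dvd_of_eval {p q : Poly n} (x : Fin n ⊕ Fin n → ℂ) (hp : eval x p = 0)
    (hq : eval x q ≠ 0) : ¬ p ∣ q := by
  rintro ⟨r, rfl⟩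
  simp [hp] at hq

lemma not_linB_dvd_linB {j k : Fin n} (h : j ≠ k) : ¬ linB lam j ∣ linB lam k := by
  refine not_dvd_of_eval (Sum.elim (Pi.single k 1) 0) ?_ ?_ <;> simp [linB, h]

lemma not_linA_dvd_linB {j k : Fin n} (h : j ≠ k) : ¬ linA lam j ∣ linB lam k := by
  refine not_dvd_of_eval (Sum.elim (Pi.single k 1) 0) ?_ ?_ <;> simp [linA, linB, h]

/-- A vector proportional to `(∂q/∂z̄_k)` in the sense of vanishing minors is a polynomial multiple
of it, because the linear forms `∂q/∂z̄_k` are pairwise coprime. -/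
lemma exists_eq_mul_linB (hn : 2 ≤ n) (P : Fin n → Poly n)
    (hP : ∀ j k, P j * linB lam k = P k * linB lam j) : ∃ μ, ∀ k, P k = μ * linB lam k := by
  obtain ⟨j, k, hjk⟩ : ∃ j k : Fin n, j ≠ k := ⟨⟨0, by omega⟩, ⟨1, by omega⟩, by simp⟩
  have hd : linB lam j ∣ P j * linB lam k := ⟨P k, by rw [hP, mul_comm]⟩
  obtain ⟨μ, hμ⟩ := ((prime_linB lam j).dvd_or_dvd hd).resolve_right (not_linB_dvd_linB lam hjk)
  refine ⟨μ, fun l => mul_left_cancel₀ (prime_linB lam j).ne_zero ?_⟩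
  linear_combination hP l j + linB lam l * hμ

/-- If a rank one matrix `u_j b_k` is also of the form `v_k a_j`, then `u` is a multiple of `a` and
`v` the same multiple of `b`. -/
lemma exists_common_factor (hn : 2 ≤ n) (u v : Fin n → Poly n)
    (h : ∀ j k, u j * linB lam k = v k * linA lam j) :
    ∃ τ, (∀ j, u j = τ * linA lam j) ∧ ∀ k, v k = τ * linB lam k := by
  obtain ⟨j, k, hjk⟩ : ∃ j k : Fin n, j ≠ k := ⟨⟨0, by omega⟩, ⟨1, by omega⟩, by simp⟩
  have hd : linA lam j ∣ u j * linB lam k := ⟨v k, by rw [h, mul_comm]⟩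
  obtain ⟨τ, hτ⟩ := ((prime_linA lam j).dvd_or_dvd hd).resolve_right (not_linA_dvd_linB lam hjk)
  have hv : ∀ l, v l = τ * linB lam l := fun l =>
    mul_left_cancel₀ (prime_linA lam j).ne_zero (by linear_combination -h j l + linB lam l * hτ)
  refine ⟨τ, fun l => mul_left_cancel₀ (prime_linB lam j).ne_zero ?_, hv⟩
  linear_combination h l j + linA lam l * hv j

end divisibility

/-! ### CR functions on the quadric `w = q`: polynomials in `z` and `q` -/

section substitution

variable {n : ℕ} (lam : Fin n → ℝ)

/-- The polynomial `f(z, q(z, z̄))` attached to a polynomial `f(z, w)`; the variable `w` is `none`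
and `z_i` is `some i`. -/
noncomputable def substQ : MvPolynomial (Option (Fin n)) ℂ →ₐ[ℂ] Poly n :=
  aeval fun o => o.elim (quadPoly lam) fun i => X (Sum.inl i)

lemma pderiv_inr_substQ (k : Fin n) (f : MvPolynomial (Option (Fin n)) ℂ) :
    pderiv (Sum.inr k) (substQ lam f) = substQ lam (pderiv none f) * linB lam k := by
  induction f using MvPolynomial.induction_on with
  | C a => simp [substQ, MvPolynomial.algebraMap_eq]
  | add p q hp hq => simp only [map_add, hp, hq, add_mul]
  | mul_X p o hp =>
    rw [map_mul, pderiv_mul, hp, pderiv_mul, map_add, map_mul, map_mul]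
    rcases o with _ | i
    · simp [substQ]
      ring
    · simp [substQ]
      ring

lemma pderiv_inl_substQ (j : Fin n) (f : MvPolynomial (Option (Fin n)) ℂ) :
    pderiv (Sum.inl j) (substQ lam f) =
      substQ lam (pderiv (some j) f) + substQ lam (pderiv none f) * linA lam j := by
  classical
  induction f using MvPolynomial.induction_on with
  | C a => simp [substQ, MvPolynomial.algebraMap_eq]
  | add p q hp hq => simp only [map_add, hp, hq]; ring
  | mul_X p o hp =>
    simp only [map_mul, pderiv_mul, hp, map_add]
    rcases o with _ | i
    · simp [substQ]
      ring
    · simp only [substQ, aeval_X, Option.elim, pderiv_X, Pi.single_apply, Option.some.injEq,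
        Sum.inl.injEq, reduceCtorEq, if_false, map_zero]
      split_ifs <;> simp <;> ring

lemma exists_pderiv_eq {σ : Type*} (i : σ) (f : MvPolynomial σ ℂ) :
    ∃ F : MvPolynomial σ ℂ, pderiv i F = f := by
  induction f using MvPolynomial.induction_on' with
  | monomial s a =>
    refine ⟨monomial (s + Finsupp.single i 1) (a / (s i + 1)), ?_⟩
    have h : (s i : ℂ) + 1 ≠ 0 := by exact_mod_cast Nat.succ_ne_zero (s i)
    rw [pderiv_monomial]
    simp [h]
  | add p q hp hq =>
    obtain ⟨P, rfl⟩ := hp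
    obtain ⟨Q, rfl⟩ := hq
    exact ⟨P + Q, map_add _ _ _⟩

lemma notMem_vars_of_pderiv_eq_zero {σ : Type*} {i : σ} {f : MvPolynomial σ ℂ}
    (h : pderiv i f = 0) : i ∉ f.vars := by
  classical
  intro hi
  obtain ⟨m, hm, him⟩ := (mem_vars_iff_mem_support i).1 hi
  have hmi : m i ≠ 0 := by simpa using him
  have h1 := coeff_pderiv (i := i) f (m - Finsupp.single i 1)
  rw [h, coeff_zero, tsub_add_cancel_of_le (by
    rw [Finsupp.single_le_iff]; omega)] at h1
  have h2 : (((m i - 1 : ℕ) : ℂ)) + 1 ≠ 0 := Nat.cast_add_one_ne_zero _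
  exact (mem_support_iff.1 hm) (by simpa [h2] using h1.symm)

lemma aeval_X_comp {σ τ : Type*} (e : σ → τ) (f : MvPolynomial σ ℂ) :
    aeval (fun i => (X (e i) : MvPolynomial τ ℂ)) f = rename e f :=
  DFunLike.congr_fun (algHom_ext (f := aeval fun i => (X (e i) : MvPolynomial τ ℂ))
    (g := rename e) fun i => by simp) f

lemma exists_rename_inl {P : Poly n} (h : ∀ k, pderiv (Sum.inr k) P = 0) :
    ∃ f : MvPolynomial (Fin n) ℂ, rename Sum.inl f = P := by
  refine exists_rename_eq_of_vars_subset_range P Sum.inl Sum.inl_injective fun i hi => ?_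
  rcases i with i | i
  · exact ⟨i, rfl⟩
  · exact absurd hi (notMem_vars_of_pderiv_eq_zero (h i))

lemma exists_substQ_of_pderiv_inr_eq_zero {P : Poly n} (h : ∀ k, pderiv (Sum.inr k) P = 0) :
    ∃ f, substQ lam f = P := by
  obtain ⟨f, rfl⟩ := exists_rename_inl h
  refine ⟨rename some f, ?_⟩
  rw [substQ, aeval_rename]
  exact aeval_X_comp Sum.inl f

/-- A polynomial is *CR* on the leaves `q = const` when it is annihilated by the `(0,1)` fields
`b_l ∂/∂z̄_k - b_k ∂/∂z̄_l` tangent to them. -/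
def IsCRPoly (P : Poly n) : Prop :=
  ∀ k l, pderiv (Sum.inr k) P * linB lam l = pderiv (Sum.inr l) P * linB lam k

lemma isCRPoly_substQ (f : MvPolynomial (Option (Fin n)) ℂ) : IsCRPoly lam (substQ lam f) := by
  intro k l
  rw [pderiv_inr_substQ, pderiv_inr_substQ]
  ring

lemma totalDegree_pderiv_le {σ : Type*} (i : σ) (p : MvPolynomial σ ℂ) :
    (pderiv i p).totalDegree ≤ p.totalDegree - 1 := by
  classical
  refine Finset.sup_le fun m hm => ?_
  rw [mem_support_iff, coeff_pderiv] at hm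
  have h := le_totalDegree (mem_support_iff.2 (left_ne_zero_of_mul hm))
  have h2 : ((m + Finsupp.single i 1).sum fun _ e => e) = (m.sum fun _ e => e) + 1 := by
    rw [Finsupp.sum_add_index' (by simp) (by simp)]
    simp
  omega

lemma totalDegree_lt_of_pderiv_eq_mul {σ : Type*} {i : σ} {P μ L : MvPolynomial σ ℂ}
    (hL : L.totalDegree = 1) (hμ : μ ≠ 0) (h : pderiv i P = μ * L) :
    μ.totalDegree + 2 ≤ P.totalDegree := by
  have hL0 : L ≠ 0 := by
    rintro rfl
    simp at hL
  have h1 := totalDegree_pderiv_le i P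
  rw [h, totalDegree_mul_of_isDomain hμ hL0, hL] at h1
  omega

lemma totalDegree_linB (k : Fin n) : (linB lam k).totalDegree = 1 :=
  (linB_isHomogeneous lam k).totalDegree (prime_linB lam k).ne_zero

lemma totalDegree_linA (k : Fin n) : (linA lam k).totalDegree = 1 :=
  (linA_isHomogeneous lam k).totalDegree (prime_linA lam k).ne_zero

/-- The factor `∂_w P` of a CR polynomial is again CR: compare the mixed derivatives. -/
lemma isCRPoly_factor {P μ : Poly n} (h : ∀ k, pderiv (Sum.inr k) P = μ * linB lam k) :
    IsCRPoly lam μ := by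
  intro k l
  have h1 := pderiv_comm (Sum.inr k) (Sum.inr l) P
  rw [h, h, pderiv_mul, pderiv_mul, pderiv_inr_linB, pderiv_inr_linB] at h1
  rcases eq_or_ne k l with rfl | hkl
  · rfl
  · simpa [hkl, hkl.symm] using h1

/-- CR polynomials are polynomials in `z` and `q`. -/
lemma IsCRPoly.exists_substQ (hn : 2 ≤ n) {P : Poly n} (hP : IsCRPoly lam P) :
    ∃ f, substQ lam f = P := by
  induction hd : P.totalDegree using Nat.strong_induction_on generalizing P with
  | _ d ih =>
    obtain ⟨μ, hμ⟩ := exists_eq_mul_linB lam hn _ hP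
    rcases eq_or_ne μ 0 with rfl | h0
    · exact exists_substQ_of_pderiv_inr_eq_zero lam fun k => by rw [hμ k, zero_mul]
    · have hlt := totalDegree_lt_of_pderiv_eq_mul (totalDegree_linB lam ⟨0, by omega⟩) h0 (hμ _)
      obtain ⟨m, hm⟩ := ih μ.totalDegree (by omega) (isCRPoly_factor lam hμ) rfl
      obtain ⟨F, hF⟩ := exists_pderiv_eq none m
      obtain ⟨g, hg⟩ := exists_substQ_of_pderiv_inr_eq_zero lam (P := P - substQ lam F) fun k => by
        rw [map_sub, hμ, pderiv_inr_substQ, hF, hm, sub_self]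
      exact ⟨F + g, by rw [map_add, hg, add_sub_cancel]⟩

/-- A multiple `τ a` of the vector `a = ∂q/∂z` cannot consist of CR polynomials unless `τ = 0`. -/
lemma eq_zero_of_isCRPoly_mul_linA (hn : 2 ≤ n) {τ : Poly n}
    (h : ∀ j, IsCRPoly lam (τ * linA lam j)) : τ = 0 := by
  obtain ⟨j, k, hjk⟩ : ∃ j k : Fin n, j ≠ k := ⟨⟨0, by omega⟩, ⟨1, by omega⟩, by simp⟩
  have h1 := h j j k
  have h2 := h k j k
  simp only [pderiv_mul, pderiv_inr_linA, if_true, hjk, hjk.symm, if_false] at h1 h2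
  have hs : linA lam j * linB lam j + linA lam k * linB lam k ≠ 0 := by
    intro hs
    -- At `z = e_j` and `z̄ = 0`, resp. `z̄ = e_j`, the form is `2λ_j`, resp. `(1 + 2λ_j)²`.
    have e1 := congrArg (eval (Sum.elim (Pi.single j 1) 0)) hs
    have e2 := congrArg (eval (Sum.elim (Pi.single j 1) (Pi.single j 1))) hs
    simp only [linA, linB, map_add, map_mul, eval_X, eval_C, Sum.elim_inl, Sum.elim_inr,
      Pi.single_eq_same, Pi.single_eq_of_ne hjk.symm, Pi.zero_apply, map_zero] at e1 e2
    ring_nf at e1 e2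
    have e3 : (1 : ℂ) = 0 := by linear_combination e2 - (2 + 2 * (lam j : ℂ)) * e1
    exact one_ne_zero e3
  refine (mul_eq_zero.1 (?_ : τ * (linA lam j * linB lam j + linA lam k * linB lam k) = 0)
    ).resolve_right hs
  linear_combination linA lam k * h1 - linA lam j * h2

/-- The case `h = 0` of `exists_substQ_add`: the mixed derivatives `∂²E/∂z_j∂z̄_k` must vanish, so
that `E` is the sum of a polynomial in `z` and a polynomial in `z̄`. -/
lemma exists_substQ_add_of_isCRPoly_pderiv (hn : 2 ≤ n) {E : Poly n}
    (hP : ∀ j, IsCRPoly lam (pderiv (Sum.inl j) E))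
    (hQ : ∀ k, IsCRPoly lam (swapHom n (pderiv (Sum.inr k) E))) :
    ∃ f g, E = substQ lam f + swapHom n (substQ lam g) := by
  choose u hu using fun j => exists_eq_mul_linB lam hn _ (hP j)
  choose v hv using fun k => exists_eq_mul_linB lam hn _ (hQ k)
  have hv' : ∀ k j, pderiv (Sum.inl j) (pderiv (Sum.inr k) E) = swapHom n (v k) * linA lam j := by
    intro k j
    have h := congrArg (swapHom n) (hv k j)
    rwa [pderiv_swapHom, swapHom_swapHom, map_mul, swapHom_linB] at h
  obtain ⟨τ, hτ, -⟩ := exists_common_factor lam hn u (fun k => swapHom n (v k)) fun j k => by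
    rw [← hu, ← hv', pderiv_comm]
  have h0 : τ = 0 := eq_zero_of_isCRPoly_mul_linA lam hn fun j => by
    rw [← hτ]
    exact isCRPoly_factor lam (hu j)
  have hE : ∀ j k, pderiv (Sum.inr k) (pderiv (Sum.inl j) E) = 0 := fun j k => by
    rw [hu, hτ, h0, zero_mul, zero_mul]
  -- Setting `z = 0` isolates the part of `E` that depends on `z̄` only.
  let ψ : Poly n →ₐ[ℂ] Poly n := aeval (Sum.elim (fun _ => 0) fun k => X (Sum.inr k))
  have hψl : ∀ (p : Poly n) j, pderiv (Sum.inl j) (ψ p) = 0 := by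
    intro p j
    induction p using MvPolynomial.induction_on with
    | C a => simp [ψ, MvPolynomial.algebraMap_eq]
    | add p q hp hq => rw [map_add, map_add, hp, hq, add_zero]
    | mul_X p i hp =>
      rw [map_mul, pderiv_mul, hp]
      rcases i with i | i <;> simp [ψ]
  have hψr : ∀ (p : Poly n) k, pderiv (Sum.inr k) (ψ p) = ψ (pderiv (Sum.inr k) p) := by
    classical
    intro p k
    induction p using MvPolynomial.induction_on with
    | C a => simp [ψ, MvPolynomial.algebraMap_eq]
    | add p q hp hq => simp only [map_add, hp, hq]
    | mul_X p i hp =>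
      rw [map_mul, pderiv_mul, pderiv_mul, hp, map_add, map_mul, map_mul]
      rcases i with i | i
      · simp [ψ]
      · simp only [ψ, aeval_X, Sum.elim_inr, pderiv_X, Pi.single_apply, Sum.inr.injEq]
        split_ifs <;> simp
  have hψ0 : ∀ p : Poly n, (∀ j, pderiv (Sum.inl j) p = 0) → ψ p = p := by
    intro p hp
    obtain ⟨f, hf⟩ := exists_rename_inl (P := swapHom n p) fun k => by
      rw [pderiv_swapHom, Sum.swap_inr, hp, map_zero]
    have hf' : p = rename Sum.inr f := by
      rw [← swapHom_swapHom p, ← hf, swapHom, rename_rename]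
      rfl
    rw [hf', aeval_rename]
    exact aeval_X_comp Sum.inr f
  obtain ⟨f, hf⟩ := exists_substQ_of_pderiv_inr_eq_zero lam (P := E - ψ E) fun k => by
    rw [map_sub, hψr, hψ0 _ fun j => by rw [pderiv_comm, hE], sub_self]
  obtain ⟨g, hg⟩ := exists_substQ_of_pderiv_inr_eq_zero lam (P := swapHom n (ψ E)) fun k => by
    rw [pderiv_swapHom, Sum.swap_inr, hψl, map_zero]
  exact ⟨f, g, by rw [hf, hg, swapHom_swapHom, sub_add_cancel]⟩

/-- The integration step: if, for some polynomial `h` (which plays the role of `∂E/∂w`), all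
`∂E/∂z_j - h ∂q/∂z_j` are functions of `z` and `q` and all `∂E/∂z̄_k - h ∂q/∂z̄_k` are functions of
`z̄` and `q`, then `E` is the sum of a function of `z` and `q` and of a function of `z̄` and `q`.
The pair `(h, τ)`, where `τ` plays the role of `∂h/∂w`, has the same property in lower degree. -/
theorem exists_substQ_add (hn : 2 ≤ n) {E h : Poly n}
    (hP : ∀ j, IsCRPoly lam (pderiv (Sum.inl j) E - h * linA lam j))
    (hQ : ∀ k, IsCRPoly lam (swapHom n (pderiv (Sum.inr k) E - h * linB lam k))) :
    ∃ f g, E = substQ lam f + swapHom n (substQ lam g) := by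
  obtain ⟨d, hdE, hdh⟩ : ∃ d, E.totalDegree ≤ d + 1 ∧ h.totalDegree ≤ d :=
    ⟨max E.totalDegree h.totalDegree, by omega, by omega⟩
  induction d using Nat.strong_induction_on generalizing E h with | _ d ih
  choose p hp using fun j => (hP j).exists_substQ lam hn
  choose r hr using fun k => (hQ k).exists_substQ lam hn
  suffices hh : ∃ f g, h = substQ lam f + swapHom n (substQ lam g) by
    obtain ⟨f₁, g₁, hfg⟩ := hh
    obtain ⟨F, rfl⟩ := exists_pderiv_eq none f₁
    obtain ⟨G, rfl⟩ := exists_pderiv_eq none g₁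
    have hS : ∀ f k, pderiv (Sum.inr k) (swapHom n (substQ lam f)) =
        swapHom n (substQ lam (pderiv (some k) f)) +
          swapHom n (substQ lam (pderiv none f)) * linB lam k := fun f k => by
      rw [pderiv_swapHom, Sum.swap_inr, pderiv_inl_substQ, map_add, map_mul, swapHom_linA]
    have hS' : ∀ f j, pderiv (Sum.inl j) (swapHom n (substQ lam f)) =
        swapHom n (substQ lam (pderiv none f)) * linA lam j := fun f j => by
      rw [pderiv_swapHom, Sum.swap_inl, pderiv_inr_substQ, map_mul, swapHom_linB]
    obtain ⟨f, g, hE⟩ := exists_substQ_add_of_isCRPoly_pderiv lam hn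
      (E := E - substQ lam F - swapHom n (substQ lam G)) (fun j => by
        have h1 : pderiv (Sum.inl j) (E - substQ lam F - swapHom n (substQ lam G)) =
            substQ lam (p j - pderiv (some j) F) := by
          rw [map_sub, map_sub, hS', pderiv_inl_substQ, map_sub, hp, hfg]
          ring
        rw [h1]
        exact isCRPoly_substQ lam _) (fun k => by
        have h1 : pderiv (Sum.inr k) (E - substQ lam F - swapHom n (substQ lam G)) =
            swapHom n (substQ lam (r k - pderiv (some k) G)) := by
          rw [map_sub, map_sub, hS, pderiv_inr_substQ, map_sub (substQ lam), map_sub, hr,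
            swapHom_swapHom, hfg]
          ring
        rw [h1, swapHom_swapHom]
        exact isCRPoly_substQ lam _)
    exact ⟨f + F, g + G, by simp only [map_add]; linear_combination hE⟩
  -- The same statement for `h` in place of `E`; for `d = 0` the polynomial `h` is constant.
  rcases d with _ | d
  · exact ⟨C (coeff 0 h), 0, by
      rw [map_zero, map_zero, add_zero, substQ, aeval_C, algebraMap_eq]
      exact totalDegree_eq_zero_iff_eq_C.1 (by omega)⟩
  · have hpr : ∀ j k, (pderiv (Sum.inl j) h - substQ lam (pderiv none (p j))) * linB lam k =
        (pderiv (Sum.inr k) h - swapHom n (substQ lam (pderiv none (r k)))) * linA lam j := by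
      intro j k
      have h1 := congrArg (pderiv (Sum.inr k)) (hp j)
      have h2 := congrArg (fun x => pderiv (Sum.inl j) (swapHom n x)) (hr k)
      simp only [swapHom_swapHom] at h2
      rw [pderiv_swapHom, Sum.swap_inl, pderiv_inr_substQ, map_mul, swapHom_linB, map_sub,
        pderiv_mul, pderiv_inl_linB] at h2
      rw [pderiv_inr_substQ, map_sub, pderiv_mul, pderiv_inr_linA, pderiv_comm] at h1
      simp only [eq_comm (a := k)] at h1
      linear_combination h2 - h1
    obtain ⟨τ, hτA, hτB⟩ := exists_common_factor lam hn _ _ hpr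
    refine ih d (Nat.lt_succ_self d) (h := τ) (fun j => ?_) (fun k => ?_) hdh ?_
    · rw [← hτA, sub_sub_cancel]
      exact isCRPoly_substQ lam _
    · rw [← hτB, sub_sub_cancel, swapHom_swapHom]
      exact isCRPoly_substQ lam _
    -- The degree of `τ a_j = ∂h/∂z_j - ∂p_j/∂w` is at most `d`, hence that of `τ` is less.
    · rcases eq_or_ne τ 0 with rfl | hτ0
      · simp
      let j : Fin n := ⟨0, by omega⟩
      have e1 : (τ * linA lam j).totalDegree = τ.totalDegree + 1 := by
        rw [totalDegree_mul_of_isDomain hτ0 (prime_linA lam j).ne_zero, totalDegree_linA]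
      have e2 : (pderiv (Sum.inl j) E - h * linA lam j).totalDegree ≤ d + 2 := by
        refine (totalDegree_sub _ _).trans (max_le ?_ ((totalDegree_mul _ _).trans ?_))
        · exact (totalDegree_pderiv_le _ _).trans (by omega)
        · rw [totalDegree_linA]
          omega
      have e3 : (substQ lam (pderiv none (p j))).totalDegree ≤ d := by
        rcases eq_or_ne (substQ lam (pderiv none (p j))) 0 with h0 | h0
        · simp [h0]
        · have h5 : pderiv (Sum.inr j) (pderiv (Sum.inl j) E - h * linA lam j) =
              substQ lam (pderiv none (p j)) * linB lam j := by
            rw [← hp, pderiv_inr_substQ]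
          have h6 := totalDegree_lt_of_pderiv_eq_mul (totalDegree_linB lam j) h0 h5
          omega
      have e4 := totalDegree_pderiv_le (Sum.inl j) h
      have e5 := totalDegree_sub (pderiv (Sum.inl j) h) (substQ lam (pderiv none (p j)))
      rw [hτA, e1] at e5
      have e6 := le_max_iff.1 e5
      omega

end substitution

/-! ### The second and third order operators expressing non-minimality -/

section operators

variable {n : ℕ} {A : Type*} [CommRing A]

/-- The vector field `v_p ∂_q - v_q ∂_p`, given by its coefficients; it is annihilated by the
one-form `∑ v_j dx_j`. -/
def minorVec (v : Fin n → A) (p q j : Fin n) : A :=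
  (if j = q then v p else 0) - (if j = p then v q else 0)

/-- The action `M f = ∑ M_j ∂f/∂z_j` of a field of type `(1,0)`. Here and below `D` is a family of
derivations `∂/∂z_j` (indices `Sum.inl j`) and `∂/∂z̄_j` (indices `Sum.inr j`), acting either on
functions or on polynomials. -/
def fieldOp (D : Fin n ⊕ Fin n → A → A) (M : Fin n → A) (f : A) : A :=
  ∑ j, M j * D (Sum.inl j) f

/-- The Levi form `∂∂̄f (M, N)` of `f` on a field `M` of type `(1,0)` and a field `N` of type
`(0,1)`. -/
def leviOp (D : Fin n ⊕ Fin n → A → A) (M N : Fin n → A) (f : A) : A :=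
  ∑ j, ∑ k, D (Sum.inr k) (D (Sum.inl j) f) * M j * N k

/-- The third order operator `L (∂∂̄f (M, N)) + ∂∂̄f (L, M N)`; up to sign and for suitable `f`, it
is the value of `∂̄f` or of `∂f` on the iterated bracket `[L, [M, N]]`. -/
def thirdOp (D : Fin n ⊕ Fin n → A → A) (L M N : Fin n → A) (f : A) : A :=
  fieldOp D L (leviOp D M N f) +
    ∑ j, ∑ k, D (Sum.inr k) (D (Sum.inl j) f) * L j * fieldOp D M (N k)

lemma sum_mul_minorVec (u v : Fin n → A) (p q : Fin n) :
    ∑ j, u j * minorVec v p q j = u q * v p - u p * v q := by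
  simp [minorVec, mul_sub, Finset.sum_sub_distrib]

lemma sum_minorVec_mul (u v : Fin n → A) (p q : Fin n) :
    ∑ j, minorVec v p q j * u j = v p * u q - v q * u p := by
  simp [minorVec, sub_mul, Finset.sum_sub_distrib]

end operators

/-! ### A quadratic form of rank at least three is prime -/

section prime

variable {n : ℕ} (lam : Fin n → ℝ)

/-- The form `a_k b_k + a_l b_l`, where `a = ∂q/∂z` and `b = ∂q/∂z̄`: the Levi form of `q` on the
field `a_k ∂/∂z_l - a_l ∂/∂z_k` and its conjugate. -/
noncomputable def pairForm (k l : Fin n) : Poly n :=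
  linA lam k * linB lam k + linA lam l * linB lam l

lemma exists_coords {lam : ℝ} (h0 : 0 ≤ lam) (h : lam ≠ 1 / 2) (A B : ℂ) :
    ∃ z ξ : ℂ, ξ + 2 * lam * z = A ∧ z + 2 * lam * ξ = B := by
  have hne : (1 : ℂ) - 4 * (lam : ℂ) ^ 2 ≠ 0 := by
    norm_cast
    intro h'
    rcases mul_eq_zero.1 (show (1 - 2 * lam) * (1 + 2 * lam) = 0 by linear_combination h') with
      h'' | h'' <;> [exact h (by linarith); linarith]
  have hc := inv_mul_cancel₀ hne
  refine ⟨(1 - 4 * lam ^ 2 : ℂ)⁻¹ * (B - 2 * lam * A), (1 - 4 * lam ^ 2 : ℂ)⁻¹ * (A - 2 * lam * B),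
    by linear_combination A * hc, by linear_combination B * hc⟩

/-- If `λ_k ≠ 1/2`, then `a_k` and `b_k` are independent coordinates, in which the form is
`a_k b_k + c` with `c` not involving `a_k`, `b_k`. -/
lemma prime_pairForm (h0 : ∀ i, 0 ≤ lam i) {k l : Fin n} (hkl : k ≠ l) (hk : lam k ≠ 1 / 2) :
    Prime (pairForm lam k l) := by
  classical
  have hne : (1 : ℂ) - 4 * (lam k : ℂ) ^ 2 ≠ 0 := by
    norm_cast
    intro h'
    rcases mul_eq_zero.1 (show (1 - 2 * lam k) * (1 + 2 * lam k) = 0 by linear_combination h') with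
      h'' | h'' <;> [exact hk (by linarith); linarith [h0 k]]
  let S : Poly n →ₐ[ℂ] Poly n := aeval (Sum.elim
    (fun i => if i = k then linB lam k else X (Sum.inl i))
    (fun i => if i = k then linA lam k else X (Sum.inr i)))
  let c : ℂ := (1 - 4 * (lam k : ℂ) ^ 2)⁻¹
  have hc : c * (1 - 4 * (lam k : ℂ) ^ 2) = 1 := inv_mul_cancel₀ hne
  have hcC : (C c : Poly n) * (1 - 4 * C (lam k : ℂ) ^ 2) = 1 := by
    have := congrArg (C : ℂ → Poly n) hc
    simpa only [map_mul, map_sub, map_pow, map_one, map_ofNat] using this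
  let T : Poly n →ₐ[ℂ] Poly n := aeval (Sum.elim
    (fun i => if i = k then C c * (X (Sum.inl k) - C (2 * (lam k : ℂ)) * X (Sum.inr k))
      else X (Sum.inl i))
    (fun i => if i = k then C c * (X (Sum.inr k) - C (2 * (lam k : ℂ)) * X (Sum.inl k))
      else X (Sum.inr i)))
  have hTb : T (linB lam k) = X (Sum.inl k) := by
    simp only [T, linB, map_add, map_mul, aeval_X, aeval_C, algebraMap_eq, Sum.elim_inl,
      Sum.elim_inr, if_true]
    simp only [map_ofNat]
    linear_combination X (Sum.inl k) * hcC
  have hTa : T (linA lam k) = X (Sum.inr k) := by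
    simp only [T, linA, map_add, map_mul, aeval_X, aeval_C, algebraMap_eq, Sum.elim_inl,
      Sum.elim_inr, if_true]
    simp only [map_ofNat]
    linear_combination X (Sum.inr k) * hcC
  have hTS : T.comp S = AlgHom.id ℂ (Poly n) := by
    refine algHom_ext fun i => ?_
    rcases i with i | i <;> by_cases hi : i = k
    · subst hi
      simpa [S] using hTb
    · simp [S, T, hi]
    · subst hi
      simpa [S] using hTa
    · simp [S, T, hi]
  have hST : S.comp T = AlgHom.id ℂ (Poly n) := by
    refine algHom_ext fun i => ?_
    rcases i with i | i <;> by_cases hi : i = k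
    · subst hi
      simp only [S, T, AlgHom.comp_apply, aeval_X, Sum.elim_inl, Sum.elim_inr, if_true, map_mul,
        map_sub, aeval_C, algebraMap_eq, linA, linB, AlgHom.id_apply]
      simp only [map_ofNat]
      linear_combination X (Sum.inl i) * hcC
    · simp [S, T, hi]
    · subst hi
      simp only [S, T, AlgHom.comp_apply, aeval_X, Sum.elim_inl, Sum.elim_inr, if_true, map_mul,
        map_sub, aeval_C, algebraMap_eq, linA, linB, AlgHom.id_apply]
      simp only [map_ofNat]
      linear_combination X (Sum.inr i) * hcC
    · simp [S, T, hi]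
  have hTl : T (linA lam l) = linA lam l ∧ T (linB lam l) = linB lam l := by
    simp [T, linA, linB, hkl.symm]
  let e : Poly n ≃ₐ[ℂ] Poly n := AlgEquiv.ofAlgHom T S hTS hST
  refine (MulEquiv.prime_iff e).1 ?_
  have he : e (pairForm lam k l) =
      X (Sum.inr k) * X (Sum.inl k) + linA lam l * linB lam l := by
    change T _ = _
    rw [pairForm, map_add, map_mul, map_mul, hTa, hTb, hTl.1, hTl.2]
  rw [he]
  refine UniqueFactorizationMonoid.irreducible_iff_prime.1
    (irreducible_mul_X_add _ _ _ (X_ne_zero _) (by simp [vars_X]) ?_ ?_)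
  · exact notMem_vars_of_pderiv_eq_zero (by
      simp [pderiv_inl_linA, pderiv_inl_linB, hkl])
  · refine (X_prime (R := ℂ)).irreducible.isRelPrime_iff_not_dvd.2 ?_
    refine not_dvd_of_eval (Sum.elim (Pi.single l 1) (Pi.single l 1)) (by simp [hkl]) ?_
    have h1 : (1 : ℂ) + 2 * lam l ≠ 0 := by
      norm_cast
      linarith [h0 l]
    simp [linA, linB, h1]

/-- The coefficients of the (0,1) field `b_k ∂/∂z̄_l - b_l ∂/∂z̄_k`, differentiated along its
conjugate `a_k ∂/∂z_l - a_l ∂/∂z_k`. -/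
lemma fieldOp_minorVec_linB {k l : Fin n} (hkl : k ≠ l) (j : Fin n) :
    fieldOp (fun i => pderiv i) (minorVec (linA lam) k l) (minorVec (linB lam) k l j) =
      -((if j = l then linA lam l else 0) + if j = k then linA lam k else 0) := by
  have h : ∀ m : Fin n, fieldOp (fun i => pderiv i) (minorVec (linA lam) k l) (linB lam m) =
      minorVec (linA lam) k l m := by
    intro m
    simp [fieldOp, pderiv_inl_linB]
  have h2 : ∀ (c : Prop) [Decidable c] (m : Fin n),
      fieldOp (fun i => pderiv i) (minorVec (linA lam) k l) (if c then linB lam m else 0) =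
        if c then minorVec (linA lam) k l m else 0 := by
    intro c _ m
    split_ifs
    · exact h m
    · simp [fieldOp]
  have h3 : ∀ f g : Poly n, fieldOp (fun i => pderiv i) (minorVec (linA lam) k l) (f - g) =
      fieldOp (fun i => pderiv i) (minorVec (linA lam) k l) f -
        fieldOp (fun i => pderiv i) (minorVec (linA lam) k l) g := by
    intro f g
    simp [fieldOp, mul_sub, Finset.sum_sub_distrib]
  rw [minorVec, h3, h2, h2]
  by_cases hj : j = l <;> by_cases hj' : j = k <;> simp [hj, hj', minorVec, hkl, hkl.symm]

end prime

/-! ### The linearized equations and their solutions -/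

section linearized

variable {n : ℕ} (lam : Fin n → ℝ)

/-- The linearization at the quadric of the equations expressing non-minimality: the second and
third order operators of `e` along the fields tangent to `q = const` are proportional to those of
`q`. -/
def LinearizedNonMinimal (e : Poly n) : Prop :=
  (∀ p q r s p' q' r' s',
    leviOp (fun i => pderiv i) (minorVec (linA lam) p q) (minorVec (linB lam) r s) (quadPoly lam) *
      leviOp (fun i => pderiv i) (minorVec (linA lam) p' q') (minorVec (linB lam) r' s') e =
    leviOp (fun i => pderiv i) (minorVec (linA lam) p' q') (minorVec (linB lam) r' s')
        (quadPoly lam) *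
      leviOp (fun i => pderiv i) (minorVec (linA lam) p q) (minorVec (linB lam) r s) e) ∧
  ∀ p q r s i j p' q' r' s',
    leviOp (fun i => pderiv i) (minorVec (linA lam) p q) (minorVec (linB lam) r s) (quadPoly lam) *
      thirdOp (fun i => pderiv i) (minorVec (linA lam) i j) (minorVec (linA lam) p' q')
        (minorVec (linB lam) r' s') e =
    thirdOp (fun i => pderiv i) (minorVec (linA lam) i j) (minorVec (linA lam) p' q')
        (minorVec (linB lam) r' s') (quadPoly lam) *
      leviOp (fun i => pderiv i) (minorVec (linA lam) p q) (minorVec (linB lam) r s) e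

lemma leviOp_quadPoly (M N : Fin n → Poly n) :
    leviOp (fun i => pderiv i) M N (quadPoly lam) = ∑ j, M j * N j := by
  simp [leviOp, pderiv_inr_linA]

lemma leviOp_quadPoly_pair {k l : Fin n} (hkl : k ≠ l) :
    leviOp (fun i => pderiv i) (minorVec (linA lam) k l) (minorVec (linB lam) k l) (quadPoly lam) =
      pairForm lam k l := by
  rw [leviOp_quadPoly, sum_mul_minorVec]
  simp [minorVec, hkl, hkl.symm, pairForm]

variable {lam}

/-- Both equations together say that `(e_{z̄_k} - h b_k)` is annihilated by `L`, where `h` is the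
quotient of the Levi forms of `e` and `q`; here denominators have been cleared. -/
lemma LinearizedNonMinimal.cleared {e : Poly n} (he : LinearizedNonMinimal lam e) {k l : Fin n}
    (hkl : k ≠ l) {N : Poly n} (hN : N = leviOp (fun i => pderiv i) (minorVec (linA lam) k l)
      (minorVec (linB lam) k l) e) (p q m : Fin n) :
    pairForm lam k l * (pairForm lam k l * (∑ j, minorVec (linA lam) p q j *
        pderiv (Sum.inr m) (pderiv (Sum.inl j) e)) - N * minorVec (linA lam) p q m) =
      (pairForm lam k l * fieldOp (fun i => pderiv i) (minorVec (linA lam) p q) N -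
        N * fieldOp (fun i => pderiv i) (minorVec (linA lam) p q) (pairForm lam k l)) *
          linB lam m := by
  set s := pairForm lam k l with hsdef
  set L := minorVec (linA lam) p q with hL
  let row : Fin n → Poly n := fun m =>
    s * (∑ j, L j * pderiv (Sum.inr m) (pderiv (Sum.inl j) e)) - N * L m
  have hlevi : ∀ V : Fin n → Poly n, leviOp (fun i => pderiv i) L V e =
      ∑ m, (∑ j, L j * pderiv (Sum.inr m) (pderiv (Sum.inl j) e)) * V m := by
    intro V
    rw [leviOp, Finset.sum_comm]
    refine Finset.sum_congr rfl fun m _ => ?_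
    rw [Finset.sum_mul]
    exact Finset.sum_congr rfl fun j _ => by ring
  have hrowsum : ∀ V : Fin n → Poly n, ∑ m, row m * V m =
      s * leviOp (fun i => pderiv i) L V e - N * ∑ m, L m * V m := by
    intro V
    rw [hlevi, Finset.mul_sum, Finset.mul_sum, ← Finset.sum_sub_distrib]
    exact Finset.sum_congr rfl fun m _ => by simp only [row]; ring
  have hrow : ∀ r t, row t * linB lam r = row r * linB lam t := by
    intro r t
    have h1 := he.1 k l k l p q r t
    rw [leviOp_quadPoly_pair lam hkl, ← hN, leviOp_quadPoly] at h1
    have h2 := hrowsum (minorVec (linB lam) r t)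
    rw [sum_mul_minorVec] at h2
    linear_combination h2 + h1
  let T : Fin n → Poly n := fun m =>
    fieldOp (fun i => pderiv i) (minorVec (linA lam) k l) (minorVec (linB lam) k l m)
  have hbT : ∑ m, linB lam m * T m = -s := by
    simp only [T, fieldOp_minorVec_linB lam hkl, hsdef, pairForm]
    simp [mul_add, Finset.sum_add_distrib]
    ring
  have h3 := he.2 k l k l p q k l k l
  rw [leviOp_quadPoly_pair lam hkl, ← hN, thirdOp, thirdOp, ← hN,
    leviOp_quadPoly_pair lam hkl] at h3
  have h4 : ∑ m, row m * T m = N * fieldOp (fun i => pderiv i) L s -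
      s * fieldOp (fun i => pderiv i) L N := by
    rw [hrowsum, ← leviOp_quadPoly lam]
    simp only [leviOp, T]
    linear_combination h3
  have h5 : row m * ∑ i, linB lam i * T i = (∑ i, row i * T i) * linB lam m := by
    rw [Finset.mul_sum, Finset.sum_mul]
    refine Finset.sum_congr rfl fun i _ => ?_
    linear_combination T i * hrow i m
  rw [h4, hbT] at h5
  simp only [row] at h5
  linear_combination -h5

lemma fieldOp_pairForm {k l : Fin n} (hkl : k ≠ l) :
    fieldOp (fun i => pderiv i) (minorVec (linA lam) k l) (pairForm lam k l) =
      C (2 * (lam l : ℂ)) * linA lam k * linB lam l -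
        C (2 * (lam k : ℂ)) * linA lam l * linB lam k := by
  rw [fieldOp, sum_minorVec_mul]
  simp only [pairForm, map_add, pderiv_mul, pderiv_inl_linA, pderiv_inl_linB, hkl, hkl.symm,
    if_true, if_false]
  ring

lemma conjHom_pairForm (k l : Fin n) : conjHom n (pairForm lam k l) = pairForm lam k l := by
  simp only [pairForm, map_add, map_mul, conjHom_linA, conjHom_linB]
  ring

lemma conjHom_minorVec_linA (p q j : Fin n) :
    conjHom n (minorVec (linA lam) p q j) = minorVec (linB lam) p q j := by
  simp only [minorVec, map_sub, apply_ite (conjHom n), conjHom_linA, map_zero]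

lemma conjHom_minorVec_linB (p q j : Fin n) :
    conjHom n (minorVec (linB lam) p q j) = minorVec (linA lam) p q j := by
  simp only [minorVec, map_sub, apply_ite (conjHom n), conjHom_linB, map_zero]

lemma conjHom_leviOp {e : Poly n} (he : conjHom n e = e) (k l : Fin n) :
    conjHom n (leviOp (fun i => pderiv i) (minorVec (linA lam) k l) (minorVec (linB lam) k l) e) =
      leviOp (fun i => pderiv i) (minorVec (linA lam) k l) (minorVec (linB lam) k l) e := by
  have h : ∀ i j : Fin n ⊕ Fin n, conjHom n (pderiv i (pderiv j e)) =
      pderiv i.swap (pderiv j.swap e) := by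
    intro i j
    have h1 := pderiv_conjHom i.swap (pderiv j e)
    have h2 := pderiv_conjHom j.swap e
    rw [Sum.swap_swap] at h1 h2
    rw [← h1, ← h2, he]
  simp only [leviOp, map_sum, map_mul, h, conjHom_minorVec_linA, conjHom_minorVec_linB,
    Sum.swap_inl, Sum.swap_inr]
  rw [Finset.sum_comm]
  refine Finset.sum_congr rfl fun j _ => Finset.sum_congr rfl fun i _ => ?_
  rw [pderiv_comm]
  ring

/-- Except when `q` is `|z_k|² + |z_l|²` in the two variables, `L s` is not divisible by `s`, where
`s` is the form `pairForm` and `L = a_k ∂/∂z_l - a_l ∂/∂z_k`. -/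
lemma not_pairForm_dvd {k l : Fin n} (h0 : ∀ i, 0 ≤ lam i) (hkl : k ≠ l)
    (hk : lam k ≠ 1 / 2) (hnz : ¬ (lam k = 0 ∧ lam l = 0)) :
    ¬ pairForm lam k l ∣ fieldOp (fun i => pderiv i) (minorVec (linA lam) k l)
      (pairForm lam k l) * linB lam k := by
  -- A point where `s` vanishes, with prescribed values of `a_k`, `b_k`, `z_l` and `z̄_l`.
  have key : ∀ α β u v : ℂ, α * β + (v + 2 * lam l * u) * (u + 2 * lam l * v) = 0 →
      (lam l * α * (u + 2 * lam l * v) - lam k * (v + 2 * lam l * u) * β) * β ≠ 0 →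
      ¬ pairForm lam k l ∣ fieldOp (fun i => pderiv i) (minorVec (linA lam) k l)
        (pairForm lam k l) * linB lam k := by
    intro α β u v h1 h2
    obtain ⟨z, ξ, hA, hB⟩ := exists_coords (h0 k) hk α β
    rw [fieldOp_pairForm hkl]
    refine not_dvd_of_eval (Sum.elim (Pi.single k z + Pi.single l u)
      (Pi.single k ξ + Pi.single l v)) ?_ ?_
    · simp [pairForm, linA, linB, hkl, hkl.symm, hA, hB, h1]
    · simp only [map_mul, map_sub, map_add, eval_C, eval_X, linA, linB, Sum.elim_inl,
        Sum.elim_inr, Pi.add_apply, Pi.single_eq_same, Pi.single_eq_of_ne hkl,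
        Pi.single_eq_of_ne hkl.symm, add_zero, zero_add, hA, hB]
      intro h3
      exact h2 (by linear_combination h3 / 2)
  by_cases hl : lam l = 0
  · have hk0 : lam k ≠ 0 := fun h => hnz ⟨h, hl⟩
    exact key 0 1 0 1 (by simp [hl]) (by simp [hl, hk0])
  · refine key 1 (-2 * lam l) 1 0 (by ring) ?_
    have : (1 : ℂ) + 4 * lam k * lam l ≠ 0 := by
      norm_cast
      nlinarith [mul_nonneg (h0 k) (h0 l)]
    have h2 : (lam l : ℂ) ≠ 0 := by exact_mod_cast hl
    have h3 := mul_ne_zero (mul_ne_zero (mul_ne_zero two_ne_zero h2) h2) this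
    intro h4
    exact h3 (by linear_combination -h4)

lemma linA_eq_X {j : Fin n} (h : lam j = 0) : linA lam j = X (Sum.inr j) := by
  simp [linA, h]

lemma linB_eq_X {j : Fin n} (h : lam j = 0) : linB lam j = X (Sum.inl j) := by
  simp [linB, h]

lemma minorVec_isHomogeneous {v : Fin n → Poly n} (hv : ∀ j, (v j).IsHomogeneous 1)
    (p q j : Fin n) : (minorVec v p q j).IsHomogeneous 1 := by
  refine IsHomogeneous.sub ?_ ?_
  · split_ifs
    exacts [hv p, isHomogeneous_zero _ _ _]
  · split_ifs
    exacts [hv q, isHomogeneous_zero _ _ _]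

/-- The Levi form of `e` along `L` is divisible by that of `q`. This is where a Bishop invariant
different from `1/2` is needed: it makes the Levi form of `q` a prime polynomial. -/
lemma LinearizedNonMinimal.pairForm_dvd {e : Poly n} (he : LinearizedNonMinimal lam e)
    (h0 : ∀ i, 0 ≤ lam i) {m : ℕ} (hm : e.IsHomogeneous (m + 2)) (hconj : conjHom n e = e)
    {k l : Fin n} (hkl : k ≠ l) (hk : lam k ≠ 1 / 2) :
    pairForm lam k l ∣ leviOp (fun i => pderiv i) (minorVec (linA lam) k l)
      (minorVec (linB lam) k l) e := by
  have hs := prime_pairForm lam h0 hkl hk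
  set N := leviOp (fun i => pderiv i) (minorVec (linA lam) k l)
      (minorVec (linB lam) k l) e with hN
  have hcl := fun m => he.cleared hkl hN k l m
  -- Reduce the equation with `m = k` modulo the prime `s`.
  by_cases hnz : lam k = 0 ∧ lam l = 0
  swap
  · have h1 : pairForm lam k l ∣ N * (fieldOp (fun i => pderiv i) (minorVec (linA lam) k l)
        (pairForm lam k l) * linB lam k) := by
      have h2 := hcl k
      generalize (∑ j, minorVec (linA lam) k l j *
        pderiv (Sum.inr k) (pderiv (Sum.inl j) e)) = S at h2
      exact ⟨fieldOp (fun i => pderiv i) (minorVec (linA lam) k l) N * linB lam k -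
        (pairForm lam k l * S - N * minorVec (linA lam) k l k), by linear_combination h2⟩
    exact (hs.dvd_or_dvd h1).resolve_right (not_pairForm_dvd h0 hkl hk hnz)
  obtain ⟨hk0, hl0⟩ := hnz
  have hfs : fieldOp (fun i => pderiv i) (minorVec (linA lam) k l) (pairForm lam k l) = 0 := by
    simp [fieldOp_pairForm hkl, hk0, hl0]
  obtain ⟨S, hcl'⟩ : ∃ S : Fin n → Poly n, ∀ m,
      pairForm lam k l * S m - N * minorVec (linA lam) k l m =
        fieldOp (fun i => pderiv i) (minorVec (linA lam) k l) N * linB lam m := by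
    refine ⟨fun m => ∑ j, minorVec (linA lam) k l j *
      pderiv (Sum.inr m) (pderiv (Sum.inl j) e), fun m => ?_⟩
    have h := hcl m
    rw [hfs] at h
    exact mul_left_cancel₀ hs.ne_zero (by linear_combination h)
  have hpair : pairForm lam k l =
      X (Sum.inr k) * X (Sum.inl k) + X (Sum.inr l) * X (Sum.inl l) := by
    rw [pairForm, linA_eq_X hk0, linA_eq_X hl0, linB_eq_X hk0, linB_eq_X hl0]
  -- Now `L s = 0`, but a third index gives an equation without the term `N L_m`.
  by_cases hj : ∃ j, j ≠ k ∧ j ≠ l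
  · obtain ⟨j, hjk, hjl⟩ := hj
    have h1 : pairForm lam k l ∣
        fieldOp (fun i => pderiv i) (minorVec (linA lam) k l) N * linB lam j :=
      ⟨S j, by rw [← hcl' j]; simp only [minorVec, hjk, hjl, if_false, sub_zero, mul_zero]⟩
    have h2 : pairForm lam k l ∣ fieldOp (fun i => pderiv i) (minorVec (linA lam) k l) N := by
      refine (hs.dvd_or_dvd h1).resolve_right (not_dvd_of_eval (Sum.elim (Pi.single j 1) 0) ?_ ?_)
      · simp [hpair]
      · simp [linB]
    have h3 : pairForm lam k l ∣ N * linA lam k := by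
      have h4 := hcl' l
      simp only [minorVec, if_true, hkl.symm, if_false, sub_zero] at h4
      have h5 := (h2.mul_right (linB lam l))
      rw [← h4] at h5
      exact (dvd_sub_right (dvd_mul_right _ _)).1 h5
    refine (hs.dvd_or_dvd h3).resolve_right (not_dvd_of_eval (Sum.elim 0 (Pi.single k 1)) ?_ ?_)
    · simp [hpair]
    · simp [linA]
  · -- `n = 2` and `q = |z|²`: the equation says that `N + ∑ z_j ∂N/∂z_j` is divisible by `q`, and
    -- conjugation and Euler's identity give the divisibility of a multiple of `N`.
    push Not at hj
    have huniv : (Finset.univ : Finset (Fin n)) = {k, l} := by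
      ext i
      simp only [Finset.mem_univ, Finset.mem_insert, Finset.mem_singleton, true_iff]
      by_cases h : i = k
      · exact Or.inl h
      · exact Or.inr (hj i h)
    have hσN : conjHom n N = N := conjHom_leviOp hconj k l
    have h1 : pairForm lam k l ∣ N + (X (Sum.inl k) * pderiv (Sum.inl k) N +
        X (Sum.inl l) * pderiv (Sum.inl l) N) := by
      have h2 : pairForm lam k l ∣ (N + (X (Sum.inl k) * pderiv (Sum.inl k) N +
          X (Sum.inl l) * pderiv (Sum.inl l) N)) * X (Sum.inr l) := by
        have h4 := hcl' k
        rw [fieldOp, sum_minorVec_mul, linA_eq_X hk0, linA_eq_X hl0, linB_eq_X hk0] at h4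
        simp only [minorVec, if_true, hkl, if_false, zero_sub, linA_eq_X hl0] at h4
        refine ⟨pderiv (Sum.inl l) N - S k, ?_⟩
        rw [hpair] at h4 ⊢
        linear_combination h4
      refine (hs.dvd_or_dvd h2).resolve_right (not_dvd_of_eval (Sum.elim 0 (Pi.single l 1)) ?_ ?_)
      · simp [hpair]
      · simp
    have h2 : pairForm lam k l ∣ N + (X (Sum.inr k) * pderiv (Sum.inr k) N +
        X (Sum.inr l) * pderiv (Sum.inr l) N) := by
      have h3 := map_dvd (conjHom n) h1
      have h4 : ∀ j, conjHom n (pderiv (Sum.inl j) N) = pderiv (Sum.inr j) N := fun j => by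
        have h5 := pderiv_conjHom (Sum.inr j) N
        rw [hσN] at h5
        exact h5.symm
      simpa only [conjHom_pairForm, map_add, map_mul, conjHom_X, hσN, h4, Sum.swap_inl] using h3
    have hNm : N.IsHomogeneous (m + 2) := by
      refine IsHomogeneous.sum _ _ _ fun j _ => IsHomogeneous.sum _ _ _ fun i _ => ?_
      exact (hm.pderiv.pderiv.mul (minorVec_isHomogeneous (linA_isHomogeneous lam) k l j)).mul
        (minorVec_isHomogeneous (linB_isHomogeneous lam) k l i)
    have heuler := hNm.sum_X_mul_pderiv
    rw [Fintype.sum_sum_type, huniv, Finset.sum_pair hkl, Finset.sum_pair hkl] at heuler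
    have h3 : pairForm lam k l ∣ ((m + 4 : ℕ) : Poly n) * N := by
      have h4 := dvd_add h1 h2
      convert h4 using 1
      rw [nsmul_eq_mul] at heuler
      push_cast at heuler ⊢
      linear_combination -heuler
    have hunit : IsUnit ((m + 4 : ℕ) : Poly n) := by
      have : ((m + 4 : ℕ) : Poly n) = C ((m + 4 : ℕ) : ℂ) := (map_natCast C _).symm
      rw [this]
      exact (isUnit_iff_ne_zero.2 (by exact_mod_cast (by omega : m + 4 ≠ 0))).map C
    exact (hunit.dvd_mul_left).1 h3

/-- With `h` the quotient of the Levi forms of `e` and `q`, all `∂e/∂z_j - h ∂q/∂z_j` are CR, and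
so are the conjugates of all `∂e/∂z̄_k - h ∂q/∂z̄_k`; this is what can be integrated. -/
lemma LinearizedNonMinimal.exists_substQ {e : Poly n} (he : LinearizedNonMinimal lam e)
    (hn : 2 ≤ n) (h0 : ∀ i, 0 ≤ lam i) {m : ℕ} (hm : e.IsHomogeneous (m + 2))
    (hconj : conjHom n e = e) (hlam : ∃ i, lam i ≠ 1 / 2) :
    ∃ f g, e = substQ lam f + swapHom n (substQ lam g) := by
  obtain ⟨k, hk⟩ := hlam
  obtain ⟨l, hkl⟩ : ∃ l : Fin n, k ≠ l := by
    have : Nontrivial (Fin n) := Fin.nontrivial_iff_two_le.2 hn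
    exact (exists_ne k).imp fun _ h => h.symm
  have hs := (prime_pairForm lam h0 hkl hk).ne_zero
  obtain ⟨h, hh⟩ := he.pairForm_dvd h0 hm hconj hkl hk
  have hσ : conjHom n h = h := by
    have h1 := conjHom_leviOp (lam := lam) hconj k l
    rw [hh, map_mul, conjHom_pairForm] at h1
    exact mul_left_cancel₀ hs h1
  have hQ : ∀ p q m, fieldOp (fun i => pderiv i) (minorVec (linA lam) p q)
      (pderiv (Sum.inr m) e - h * linB lam m) = 0 := by
    intro p q m
    have h1 := he.cleared hkl rfl p q m
    rw [hh] at h1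
    have h3 : linA lam p * pderiv (Sum.inl q) (linB lam m) -
        linA lam q * pderiv (Sum.inl p) (linB lam m) = minorVec (linA lam) p q m := by
      simp [pderiv_inl_linB, minorVec, eq_comm]
    rw [← h3] at h1
    simp only [fieldOp, sum_minorVec_mul, pderiv_mul] at h1
    simp only [fieldOp, sum_minorVec_mul, map_sub, pderiv_mul]
    rw [pderiv_comm (Sum.inl q), pderiv_comm (Sum.inl p)]
    refine mul_left_cancel₀ (mul_ne_zero hs hs) ?_
    generalize pairForm lam k l = s at *
    linear_combination h1
  have hQ' : ∀ p q m, linA lam p * pderiv (Sum.inl q) (pderiv (Sum.inr m) e - h * linB lam m) =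
      linA lam q * pderiv (Sum.inl p) (pderiv (Sum.inr m) e - h * linB lam m) := by
    intro p q m
    have h1 := hQ p q m
    rw [fieldOp, sum_minorVec_mul] at h1
    linear_combination h1
  refine exists_substQ_add lam hn (h := h) (fun j => ?_) fun k => ?_
  · have h1 : pderiv (Sum.inl j) e - h * linA lam j =
        conjHom n (pderiv (Sum.inr j) e - h * linB lam j) := by
      have h2 := pderiv_conjHom (Sum.inl j) e
      rw [hconj, Sum.swap_inl] at h2
      rw [map_sub, map_mul, hσ, conjHom_linB, ← h2]
    rw [h1]
    intro p q
    rw [pderiv_conjHom, pderiv_conjHom, ← conjHom_linA lam p, ← conjHom_linA lam q, ← map_mul,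
      ← map_mul, Sum.swap_inr, Sum.swap_inr, mul_comm, hQ', mul_comm]
  · intro p q
    rw [pderiv_swapHom, pderiv_swapHom, ← swapHom_linA lam p, ← swapHom_linA lam q, ← map_mul,
      ← map_mul, Sum.swap_inr, Sum.swap_inr, mul_comm, hQ', mul_comm]

/-- The weights: `z_i` has weight one and `w` has weight two. -/
def weightZW {n : ℕ} : Option (Fin n) → ℕ := fun o => o.elim 2 fun _ => 1

lemma substQ_monomial_isHomogeneous (d : Option (Fin n) →₀ ℕ) (c : ℂ) :
    (substQ lam (monomial d c)).IsHomogeneous (Finsupp.weight weightZW d) := by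
  rw [substQ, aeval_monomial, Finsupp.weight_apply, Finsupp.sum, Finsupp.prod, algebraMap_eq]
  refine IsHomogeneous.C_mul (IsHomogeneous.prod _ _ _ fun o _ => ?_) _
  rw [smul_eq_mul, mul_comm]
  rcases o with _ | i
  · exact (quadPoly_isHomogeneous lam).pow _
  · exact (isHomogeneous_X _ _).pow _

lemma conjHom_substQ (f : MvPolynomial (Option (Fin n)) ℂ) :
    conjHom n (substQ lam f) = swapHom n (substQ lam (map (starRingEnd ℂ) f)) := by
  have hq : map (starRingEnd ℂ) (quadPoly lam) = quadPoly lam := by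
    simp [quadPoly]
  rw [conjHom_apply]
  congr 1
  induction f using MvPolynomial.induction_on with
  | C a => simp [substQ, algebraMap_eq]
  | add p q hp hq => simp only [map_add, hp, hq]
  | mul_X p o hp =>
    rw [map_mul, map_mul, hp, map_mul, map_mul]
    rcases o with _ | i <;> simp [substQ, hq]

/-- A real solution of the linearized equations is the real part of a weighted homogeneous
polynomial in `z` and `w = q`. -/
theorem LinearizedNonMinimal.exists_substQ_add_conj {e : Poly n} (he : LinearizedNonMinimal lam e)
    (hn : 2 ≤ n) (h0 : ∀ i, 0 ≤ lam i) {m : ℕ} (hm : e.IsHomogeneous (m + 2))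
    (hconj : conjHom n e = e) (hlam : ∃ i, lam i ≠ 1 / 2) :
    ∃ b : MvPolynomial (Option (Fin n)) ℂ, b.IsWeightedHomogeneous weightZW (m + 2) ∧
      e = substQ lam b + conjHom n (substQ lam b) := by
  obtain ⟨f, g, hfg⟩ := he.exists_substQ hn h0 hm hconj hlam
  obtain ⟨b, hb⟩ : ∃ b, e = substQ lam b + conjHom n (substQ lam b) := by
    have hg : conjHom n (substQ lam (map (starRingEnd ℂ) g)) = swapHom n (substQ lam g) := by
      rw [conjHom_substQ, MvPolynomial.map_map]
      simp [MvPolynomial.map_id]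
    have hg' : conjHom n (swapHom n (substQ lam g)) = substQ lam (map (starRingEnd ℂ) g) := by
      rw [← hg, conjHom_conjHom]
    have h2 := hconj
    rw [hfg, map_add, hg'] at h2
    have hC : (C (1 / 2) : Poly n) + C (1 / 2) = 1 := by
      rw [← C_add]
      norm_num
    refine ⟨C (1 / 2) * (f + map (starRingEnd ℂ) g), ?_⟩
    have h3 : substQ lam (C (1 / 2)) = C (1 / 2) := by simp [substQ, algebraMap_eq]
    have h4 : conj (1 / 2 : ℂ) = 1 / 2 := by simp [map_ofNat (starRingEnd ℂ) 2]
    rw [map_mul, map_mul, map_add, map_add, hg, h3, conjHom_C, h4]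
    linear_combination hfg - C (1 / 2) * h2 -
      (substQ lam f + swapHom n (substQ lam g)) * hC
  classical
  have hsum : ∀ s : Finset (Option (Fin n) →₀ ℕ),
      substQ lam (∑ d ∈ s, monomial d (coeff d b)) +
        conjHom n (substQ lam (∑ d ∈ s, monomial d (coeff d b))) =
      ∑ d ∈ s, (substQ lam (monomial d (coeff d b)) +
        conjHom n (substQ lam (monomial d (coeff d b)))) := by
    intro s
    rw [map_sum, map_sum, Finset.sum_add_distrib]
  -- Only the part of `b` of weight `m + 2` contributes to the homogeneous polynomial `e`.
  refine ⟨∑ d ∈ b.support with Finsupp.weight weightZW d = m + 2, monomial d (coeff d b), ?_, ?_⟩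
  · refine IsWeightedHomogeneous.sum _ _ _ fun d hd => ?_
    exact isWeightedHomogeneous_monomial _ _ _ (Finset.mem_filter.1 hd).2
  · rw [hsum, Finset.sum_filter, ← homogeneousComponent_eq_self hm]
    nth_rewrite 1 [hb]
    nth_rewrite 1 2 [← support_sum_monomial_coeff b]
    rw [hsum, map_sum]
    refine Finset.sum_congr rfl fun d _ => ?_
    have h1 := substQ_monomial_isHomogeneous (lam := lam) d (coeff d b)
    rw [homogeneousComponent_of_mem (h1.add (conjHom_isHomogeneous h1))]
    simp only [eq_comm]

end linearized

/-! ### Germs of smooth functions and Wirtinger derivatives -/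

section smooth

variable {X Y : Type*} [NormedAddCommGroup X] [NormedSpace ℝ X]
  [NormedAddCommGroup Y] [NormedSpace ℝ Y]

lemma SmoothNear.contDiffAt {f : X → Y} {a : X} (h : SmoothNear f a) : ContDiffAt ℝ ∞ f a :=
  Filter.Eventually.self_of_nhds h

lemma SmoothNear.eventually {f : X → Y} {a : X} (h : SmoothNear f a) :
    ∀ᶠ x in 𝓝 a, SmoothNear f x :=
  eventually_eventually_nhds.2 h

lemma SmoothNear.differentiableAt {f : X → Y} {a : X} (h : SmoothNear f a) :
    DifferentiableAt ℝ f a :=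
  h.contDiffAt.differentiableAt (by simp)

lemma SmoothNear.congr {f g : X → Y} {a : X} (h : SmoothNear f a) (hfg : g =ᶠ[𝓝 a] f) :
    SmoothNear g a := by
  filter_upwards [h, eventually_eventually_nhds.2 hfg] with x hx hx'
  exact hx.congr_of_eventuallyEq hx'

lemma smoothNear_of_contDiff {f : X → Y} (h : ContDiff ℝ ∞ f) (a : X) : SmoothNear f a :=
  Filter.Eventually.of_forall fun _ => h.contDiffAt

lemma SmoothNear.add {f g : X → Y} {a : X} (hf : SmoothNear f a) (hg : SmoothNear g a) :
    SmoothNear (f + g) a := by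
  filter_upwards [hf, hg] with x h1 h2 using h1.add h2

lemma SmoothNear.sub {f g : X → Y} {a : X} (hf : SmoothNear f a) (hg : SmoothNear g a) :
    SmoothNear (f - g) a := by
  filter_upwards [hf, hg] with x h1 h2 using h1.sub h2

lemma SmoothNear.mul {f g : X → ℂ} {a : X} (hf : SmoothNear f a) (hg : SmoothNear g a) :
    SmoothNear (f * g) a := by
  filter_upwards [hf, hg] with x h1 h2 using h1.mul h2

lemma smoothNear_const (c : Y) (a : X) : SmoothNear (fun _ => c : X → Y) a :=
  smoothNear_of_contDiff contDiff_const a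

lemma SmoothNear.sum {ι : Type*} {s : Finset ι} {f : ι → X → Y} {a : X}
    (h : ∀ i ∈ s, SmoothNear (f i) a) : SmoothNear (∑ i ∈ s, f i) a := by
  classical
  induction s using Finset.induction_on with
  | empty => exact smoothNear_const 0 a
  | insert i s hi ih =>
    rw [Finset.sum_insert hi]
    exact (h i (Finset.mem_insert_self i s)).add
      (ih fun j hj => h j (Finset.mem_insert_of_mem hj))

/-- The complex conjugate of a function. -/
def conjFun {X : Type*} (f : X → ℂ) : X → ℂ := fun x => conj (f x)

lemma SmoothNear.conjFun {f : X → ℂ} {a : X} (hf : SmoothNear f a) : SmoothNear (conjFun f) a := by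
  filter_upwards [hf] with x h1
  exact Complex.conjCLE.contDiff.contDiffAt.comp x h1

end smooth

section wirtinger

variable {n : ℕ}

/-- The first direction entering the Wirtinger derivatives in the variable `z_j`. -/
def dirOne : Fin n ⊕ Fin n → (Fin n → ℂ) := Sum.elim (fun j => Pi.single j 1) fun j => Pi.single j 1

/-- The second direction entering the Wirtinger derivatives in the variable `z_j`. -/
noncomputable def dirI : Fin n ⊕ Fin n → (Fin n → ℂ) :=
  Sum.elim (fun j => Pi.single j Complex.I) fun j => Pi.single j Complex.I

/-- The coefficient `∓ i` in `∂/∂z = (∂/∂x - i ∂/∂y) / 2` and `∂/∂z̄ = (∂/∂x + i ∂/∂y) / 2`. -/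
noncomputable def wirtSign : Fin n ⊕ Fin n → ℂ :=
  Sum.elim (fun _ => -Complex.I) fun _ => Complex.I

/-- The Wirtinger derivatives `∂f/∂z_j` (index `Sum.inl j`) and `∂f/∂z̄_j` (index `Sum.inr j`). -/
noncomputable def wirt (i : Fin n ⊕ Fin n) (f : (Fin n → ℂ) → ℂ) (x : Fin n → ℂ) : ℂ :=
  (fderiv ℝ f x (dirOne i) + wirtSign i * fderiv ℝ f x (dirI i)) / 2

variable {f g : (Fin n → ℂ) → ℂ} {a x : Fin n → ℂ}

lemma wirt_congr (h : f =ᶠ[𝓝 a] g) (i : Fin n ⊕ Fin n) : wirt i f =ᶠ[𝓝 a] wirt i g := by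
  filter_upwards [h.fderiv (𝕜 := ℝ)] with x hx
  rw [wirt, wirt, hx]

lemma SmoothNear.fderiv_apply (hf : SmoothNear f a) (v : Fin n → ℂ) :
    SmoothNear (fun x => fderiv ℝ f x v) a := by
  filter_upwards [hf] with x hx
  exact (hx.fderiv_right (m := ∞) (by simp)).clm_apply contDiffAt_const

lemma SmoothNear.wirt (hf : SmoothNear f a) (i : Fin n ⊕ Fin n) : SmoothNear (wirt i f) a := by
  have h1 := hf.fderiv_apply (dirOne i)
  have h2 := (smoothNear_const (wirtSign i) a).mul (hf.fderiv_apply (dirI i))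
  refine ((smoothNear_const (1 / 2 : ℂ) a).mul (h1.add h2)).congr (.of_forall fun x => ?_)
  simp only [CRFlat.wirt, Pi.mul_apply, Pi.add_apply]
  ring

lemma wirt_add_apply (hf : DifferentiableAt ℝ f x) (hg : DifferentiableAt ℝ g x)
    (i : Fin n ⊕ Fin n) : wirt i (f + g) x = wirt i f x + wirt i g x := by
  rw [wirt, fderiv_add hf hg, wirt, wirt]
  simp only [add_apply]
  ring

lemma wirt_sub_apply (hf : DifferentiableAt ℝ f x) (hg : DifferentiableAt ℝ g x)
    (i : Fin n ⊕ Fin n) : wirt i (f - g) x = wirt i f x - wirt i g x := by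
  rw [wirt, fderiv_sub hf hg, wirt, wirt]
  simp only [sub_apply]
  ring

lemma wirt_mul_apply (hf : DifferentiableAt ℝ f x) (hg : DifferentiableAt ℝ g x)
    (i : Fin n ⊕ Fin n) : wirt i (f * g) x = wirt i f x * g x + f x * wirt i g x := by
  rw [wirt, fderiv_mul hf hg, wirt, wirt]
  simp only [add_apply, smul_apply, smul_eq_mul]
  ring

lemma wirt_const (c : ℂ) (i : Fin n ⊕ Fin n) : wirt i (fun _ => c) = 0 := by
  ext x
  simp [wirt]

lemma wirt_zero (i : Fin n ⊕ Fin n) : wirt i 0 = 0 := wirt_const 0 i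

lemma wirt_add (hf : SmoothNear f a) (hg : SmoothNear g a) (i : Fin n ⊕ Fin n) :
    wirt i (f + g) =ᶠ[𝓝 a] wirt i f + wirt i g := by
  filter_upwards [hf.eventually, hg.eventually] with x h1 h2
  exact wirt_add_apply h1.differentiableAt h2.differentiableAt i

lemma wirt_sub (hf : SmoothNear f a) (hg : SmoothNear g a) (i : Fin n ⊕ Fin n) :
    wirt i (f - g) =ᶠ[𝓝 a] wirt i f - wirt i g := by
  filter_upwards [hf.eventually, hg.eventually] with x h1 h2
  exact wirt_sub_apply h1.differentiableAt h2.differentiableAt i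

lemma wirt_mul (hf : SmoothNear f a) (hg : SmoothNear g a) (i : Fin n ⊕ Fin n) :
    wirt i (f * g) =ᶠ[𝓝 a] wirt i f * g + f * wirt i g := by
  filter_upwards [hf.eventually, hg.eventually] with x h1 h2
  exact wirt_mul_apply h1.differentiableAt h2.differentiableAt i

lemma wirt_comm (hf : SmoothNear f x) (i j : Fin n ⊕ Fin n) :
    wirt i (wirt j f) x = wirt j (wirt i f) x := by
  have hd : DifferentiableAt ℝ (fderiv ℝ f) x :=
    (hf.contDiffAt.fderiv_right (m := ∞) (by simp)).differentiableAt (by simp)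
  have hsymm : ∀ u v, fderiv ℝ (fderiv ℝ f) x u v = fderiv ℝ (fderiv ℝ f) x v u :=
    fun u v => (hf.contDiffAt.isSymmSndFDerivAt
      (by simpa using WithTop.coe_le_coe.2 (le_top : (2 : ℕ∞) ≤ ⊤))).eq u v
  have key : ∀ (i : Fin n ⊕ Fin n) (w : Fin n → ℂ), fderiv ℝ (wirt i f) x w =
      (fderiv ℝ (fderiv ℝ f) x w (dirOne i) +
        wirtSign i * fderiv ℝ (fderiv ℝ f) x w (dirI i)) / 2 := by
    intro i w
    have h1 : ∀ v, HasFDerivAt (fun y => fderiv ℝ f y v)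
        ((fderiv ℝ (fderiv ℝ f) x).flip v) x := fun v => by
      simpa using hd.hasFDerivAt.clm_apply (hasFDerivAt_const v x)
    have h2 := ((h1 (dirOne i)).add ((h1 (dirI i)).const_mul (wirtSign i))).mul_const (1 / 2)
    have h3 : HasFDerivAt (wirt i f) _ x := h2.congr_of_eventuallyEq
      (.of_forall fun y => by simp only [wirt, Pi.add_apply]; ring)
    rw [h3.fderiv]
    simp
    ring
  rw [wirt, wirt, key, key, key, key, hsymm (dirOne i) (dirOne j), hsymm (dirOne i) (dirI j),
    hsymm (dirI i) (dirOne j), hsymm (dirI i) (dirI j)]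
  ring

lemma fderiv_conjFun (hf : DifferentiableAt ℝ f x) (v : Fin n → ℂ) :
    fderiv ℝ (conjFun f) x v = conj (fderiv ℝ f x v) := by
  have h := (Complex.conjCLE : ℂ ≃L[ℝ] ℂ).toContinuousLinearMap.hasFDerivAt.comp x hf.hasFDerivAt
  have h' : HasFDerivAt (conjFun f) _ x := h
  rw [h'.fderiv]
  simp

lemma wirt_conjFun (hf : DifferentiableAt ℝ f x) (i : Fin n ⊕ Fin n) :
    wirt i (conjFun f) x = conj (wirt i.swap f x) := by
  rw [wirt, wirt, fderiv_conjFun hf, fderiv_conjFun hf]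
  rcases i with i | i <;> simp [wirtSign, dirOne, dirI, map_ofNat (starRingEnd ℂ) 2]

/-- The differential in terms of the Wirtinger derivatives. -/
lemma fderiv_eq_sum_wirt (f : (Fin n → ℂ) → ℂ) (x v : Fin n → ℂ) :
    fderiv ℝ f x v = ∑ j, (v j * wirt (Sum.inl j) f x + conj (v j) * wirt (Sum.inr j) f x) := by
  have hv : v = ∑ j, ((v j).re • (Pi.single j 1 : Fin n → ℂ) +
      (v j).im • (Pi.single j Complex.I : Fin n → ℂ)) := by
    ext k
    simp [Finset.sum_apply, Pi.single_apply, Finset.sum_add_distrib, Complex.re_add_im]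
  nth_rewrite 1 [hv]
  rw [map_sum]
  refine Finset.sum_congr rfl fun j _ => ?_
  rw [map_add, map_smul, map_smul]
  simp only [wirt, dirOne, dirI, wirtSign, Sum.elim_inl, Sum.elim_inr, Complex.real_smul]
  have h2 : conj (v j) = (v j).re - (v j).im * Complex.I := by
    apply Complex.ext <;> simp
  nth_rewrite 3 [← Complex.re_add_im (v j)]
  rw [h2]
  linear_combination ((v j).im * fderiv ℝ f x (Pi.single j Complex.I)) * Complex.I_mul_I

end wirtinger

/-! ### Orders of vanishing and leading homogeneous parts -/

section flat

variable {n : ℕ}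

/-- `f` is smooth near `0` and all its derivatives of order less than `k` vanish at `0`. -/
def FlatTo : ℕ → ((Fin n → ℂ) → ℂ) → Prop
  | 0, f => SmoothNear f 0
  | k + 1, f => SmoothNear f 0 ∧ f 0 = 0 ∧ ∀ i, FlatTo k (wirt i f)

variable {f g : (Fin n → ℂ) → ℂ} {k l : ℕ}

lemma FlatTo.smoothNear (h : FlatTo k f) : SmoothNear f 0 := by
  cases k with
  | zero => exact h
  | succ k => exact h.1

lemma FlatTo.congr (h : FlatTo k f) (hfg : g =ᶠ[𝓝 0] f) : FlatTo k g := by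
  induction k generalizing f g with
  | zero => exact SmoothNear.congr h hfg
  | succ k ih =>
    exact ⟨h.1.congr hfg, by rw [hfg.self_of_nhds, h.2.1], fun i => ih (h.2.2 i) (wirt_congr hfg i)⟩

lemma FlatTo.of_succ (h : FlatTo (k + 1) f) : FlatTo k f := by
  induction k generalizing f with
  | zero => exact h.1
  | succ k ih => exact ⟨h.1, h.2.1, fun i => ih (h.2.2 i)⟩

lemma FlatTo.mono (h : FlatTo k f) (hl : l ≤ k) : FlatTo l f := by
  induction hl with
  | refl => exact h
  | step _ ih => exact ih h.of_succ

lemma FlatTo.add (hf : FlatTo k f) (hg : FlatTo k g) : FlatTo k (f + g) := by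
  induction k generalizing f g with
  | zero => exact SmoothNear.add hf hg
  | succ k ih =>
    exact ⟨hf.1.add hg.1, by simp [hf.2.1, hg.2.1], fun i =>
      (ih (hf.2.2 i) (hg.2.2 i)).congr (wirt_add hf.1 hg.1 i)⟩

lemma FlatTo.sub (hf : FlatTo k f) (hg : FlatTo k g) : FlatTo k (f - g) := by
  induction k generalizing f g with
  | zero => exact SmoothNear.sub hf hg
  | succ k ih =>
    exact ⟨hf.1.sub hg.1, by simp [hf.2.1, hg.2.1], fun i =>
      (ih (hf.2.2 i) (hg.2.2 i)).congr (wirt_sub hf.1 hg.1 i)⟩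

lemma FlatTo.mul (hf : FlatTo k f) (hg : FlatTo l g) : FlatTo (k + l) (f * g) := by
  induction hN : k + l generalizing k l f g with
  | zero => exact hf.smoothNear.mul hg.smoothNear
  | succ N ih =>
    refine ⟨hf.smoothNear.mul hg.smoothNear, ?_, fun i => ?_⟩
    · rcases k with _ | k
      · obtain ⟨l, rfl⟩ : ∃ l', l = l' + 1 := ⟨N, by omega⟩
        simp [hg.2.1]
      · simp [hf.2.1]
    · refine FlatTo.congr ?_ (wirt_mul hf.smoothNear hg.smoothNear i)
      have h1 : FlatTo N (wirt i f * g) := by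
        rcases k with _ | k
        · exact ih (k := 0) (l := N) (hf.smoothNear.wirt i) (hg.mono (by omega)) (by omega)
        · exact ih (hf.2.2 i) hg (by omega)
      have h2 : FlatTo N (f * wirt i g) := by
        rcases l with _ | l
        · exact ih (k := N) (l := 0) (hf.mono (by omega)) (hg.smoothNear.wirt i) (by omega)
        · exact ih hf (hg.2.2 i) (by omega)
      exact h1.add h2

lemma FlatTo.conjFun (hf : FlatTo k f) : FlatTo k (conjFun f) := by
  induction k generalizing f with
  | zero => exact SmoothNear.conjFun hf
  | succ k ih =>
    refine ⟨hf.1.conjFun, by simp [CRFlat.conjFun, hf.2.1], fun i => ?_⟩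
    refine (ih (hf.2.2 i.swap)).congr ?_
    filter_upwards [hf.1.eventually] with x hx
    exact wirt_conjFun hx.differentiableAt i

lemma flatTo_zero : FlatTo k (0 : (Fin n → ℂ) → ℂ) := by
  induction k with
  | zero => exact smoothNear_const 0 0
  | succ k ih => exact ⟨smoothNear_const 0 0, rfl, fun i => by rw [wirt_zero]; exact ih⟩

/-- The function `z ↦ p(z, z̄)`. -/
noncomputable def evalFun (p : Poly n) : (Fin n → ℂ) → ℂ :=
  fun x => eval (Sum.elim x fun j => conj (x j)) p

lemma contDiff_coord (i : Fin n ⊕ Fin n) :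
    ContDiff ℝ ∞ fun x : Fin n → ℂ => Sum.elim x (fun j => conj (x j)) i := by
  rcases i with i | i
  · exact contDiff_apply ℝ ℂ i
  · exact Complex.conjCLE.contDiff.comp (contDiff_apply ℝ ℂ i)

lemma contDiff_evalFun (p : Poly n) : ContDiff ℝ ∞ (evalFun p) := by
  unfold evalFun
  induction p using MvPolynomial.induction_on with
  | C a => simpa using contDiff_const (c := a)
  | add p q hp hq => simpa using hp.add hq
  | mul_X p i hp => simpa using hp.mul (contDiff_coord i)

lemma evalFun_add (p q : Poly n) : evalFun (p + q) = evalFun p + evalFun q := by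
  ext; simp [evalFun]

lemma evalFun_sub (p q : Poly n) : evalFun (p - q) = evalFun p - evalFun q := by
  ext; simp [evalFun]

lemma evalFun_mul (p q : Poly n) : evalFun (p * q) = evalFun p * evalFun q := by
  ext; simp [evalFun]

lemma evalFun_zero : evalFun (0 : Poly n) = 0 := by
  ext; simp [evalFun]

lemma evalFun_conjHom (p : Poly n) : evalFun (conjHom n p) = conjFun (evalFun p) := by
  induction p using MvPolynomial.induction_on with
  | C a => ext; simp [evalFun, conjFun]
  | add p q hp hq =>
    rw [map_add, evalFun_add, hp, hq, evalFun_add]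
    ext; simp [conjFun]
  | mul_X p i hp =>
    rw [map_mul, evalFun_mul, hp, evalFun_mul, conjHom_X]
    ext x
    rcases i with i | i <;> simp [conjFun, evalFun]

lemma wirt_evalFun_X (i j : Fin n ⊕ Fin n) :
    wirt i (evalFun (X j)) = evalFun (if i = j then 1 else 0) := by
  have h1 : ∀ (j : Fin n) (x v : Fin n → ℂ), fderiv ℝ (evalFun (X (Sum.inl j))) x v = v j := by
    intro j x v
    have h : evalFun (X (Sum.inl j)) =
        ⇑(ContinuousLinearMap.proj (R := ℝ) (φ := fun _ => ℂ) j) := by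
      ext; simp [evalFun]
    rw [h, ContinuousLinearMap.fderiv]
    rfl
  have h2 : ∀ (j : Fin n) (x v : Fin n → ℂ),
      fderiv ℝ (evalFun (X (Sum.inr j))) x v = conj (v j) := by
    intro j x v
    have h : evalFun (X (Sum.inr j)) = conjFun (evalFun (X (Sum.inl j))) := by
      ext; simp [evalFun, conjFun]
    rw [h, fderiv_conjFun ((contDiff_evalFun _).differentiable (by simp) x), h1]
  ext x
  rcases i with i | i <;> rcases j with j | j <;> by_cases hij : i = j <;>
    simp [wirt, h1, h2, dirOne, dirI, wirtSign, hij, evalFun, Ne.symm]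

lemma wirt_evalFun (i : Fin n ⊕ Fin n) (p : Poly n) :
    wirt i (evalFun p) = evalFun (pderiv i p) := by
  have hd : ∀ (p : Poly n) x, DifferentiableAt ℝ (evalFun p) x := fun p x =>
    (contDiff_evalFun p).differentiable (by simp) x
  induction p using MvPolynomial.induction_on with
  | C a =>
    have : evalFun (C a : Poly n) = fun _ => a := by ext; simp [evalFun]
    rw [this, wirt_const, pderiv_C, evalFun_zero]
  | add p q hp hq =>
    ext x
    rw [evalFun_add, wirt_add_apply (hd p x) (hd q x), hp, hq, map_add, evalFun_add]
    rfl
  | mul_X p j hp =>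
    classical
    ext x
    rw [evalFun_mul, wirt_mul_apply (hd p x) (hd _ x), hp, wirt_evalFun_X, pderiv_mul, pderiv_X,
      evalFun_add, evalFun_mul, evalFun_mul]
    simp [Pi.single_apply, eq_comm]

end flat

section lead

variable {n : ℕ} {f g : (Fin n → ℂ) → ℂ} {k l : ℕ} {p q : Poly n}

/-- `p` is the homogeneous part of degree `k` of the Taylor expansion of `f` at `0`, and `f`
vanishes to order `k`. -/
def HasLead (k : ℕ) (f : (Fin n → ℂ) → ℂ) (p : Poly n) : Prop :=
  p.IsHomogeneous k ∧ FlatTo (k + 1) (f - evalFun p)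

lemma smoothNear_evalFun (p : Poly n) (a : Fin n → ℂ) : SmoothNear (evalFun p) a :=
  smoothNear_of_contDiff (contDiff_evalFun p) a

lemma evalFun_apply_zero (hp : p.IsHomogeneous (k + 1)) : evalFun p 0 = 0 := by
  have h : (Sum.elim (0 : Fin n → ℂ) fun j => conj ((0 : Fin n → ℂ) j)) = fun _ => 0 := by
    ext i
    rcases i with i | i <;> simp
  rw [evalFun, h]
  have h1 : constantCoeff p = 0 := by
    rw [constantCoeff_eq]
    exact hp.coeff_eq_zero (by simp)
  rwa [← eval_zero] at h1

lemma flatTo_evalFun (hp : p.IsHomogeneous k) : FlatTo k (evalFun p) := by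
  induction k generalizing p with
  | zero => exact smoothNear_evalFun p 0
  | succ k ih =>
    exact ⟨smoothNear_evalFun p 0, evalFun_apply_zero hp, fun i => by
      rw [wirt_evalFun]
      exact ih hp.pderiv⟩

lemma hasLead_evalFun (hp : p.IsHomogeneous k) : HasLead k (evalFun p) p :=
  ⟨hp, by rw [sub_self]; exact flatTo_zero⟩

lemma HasLead.flatTo (h : HasLead k f p) : FlatTo k f := by
  have h1 := h.2.of_succ.add (flatTo_evalFun h.1)
  rwa [sub_add_cancel] at h1

lemma HasLead.smoothNear (h : HasLead k f p) : SmoothNear f 0 := h.flatTo.smoothNear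

lemma HasLead.congr (h : HasLead k f p) (hfg : g =ᶠ[𝓝 0] f) : HasLead k g p :=
  ⟨h.1, h.2.congr (hfg.sub (EventuallyEq.refl _ _))⟩

lemma hasLead_zero_of_flatTo (h : FlatTo (k + 1) f) : HasLead k f 0 :=
  ⟨isHomogeneous_zero _ _ _, by rwa [evalFun_zero, sub_zero]⟩

lemma HasLead.flatTo_succ (h : HasLead k f 0) : FlatTo (k + 1) f := by
  have h1 := h.2
  rwa [evalFun_zero, sub_zero] at h1

lemma HasLead.add (hf : HasLead k f p) (hg : HasLead k g q) : HasLead k (f + g) (p + q) := by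
  refine ⟨hf.1.add hg.1, (hf.2.add hg.2).congr (.of_eq ?_)⟩
  rw [evalFun_add]
  ring

lemma HasLead.sub (hf : HasLead k f p) (hg : HasLead k g q) : HasLead k (f - g) (p - q) := by
  refine ⟨hf.1.sub hg.1, (hf.2.sub hg.2).congr (.of_eq ?_)⟩
  rw [evalFun_sub]
  ring

lemma HasLead.mul (hf : HasLead k f p) (hg : HasLead l g q) : HasLead (k + l) (f * g) (p * q) := by
  refine ⟨hf.1.mul hg.1, ?_⟩
  have h1 : FlatTo (k + l + 1) ((f - evalFun p) * g) := by
    convert hf.2.mul hg.flatTo using 1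
    omega
  have h2 : FlatTo (k + l + 1) (evalFun p * (g - evalFun q)) := (flatTo_evalFun hf.1).mul hg.2
  refine (h1.add h2).congr (.of_eq ?_)
  rw [evalFun_mul]
  ring

lemma HasLead.const_mul (hf : HasLead k f p) (c : ℂ) : HasLead k (fun x => c * f x) (C c * p) := by
  have h := (hasLead_evalFun (isHomogeneous_C (Fin n ⊕ Fin n) c)).mul hf
  rw [zero_add] at h
  exact h.congr (.of_eq (by ext; simp [evalFun]))

lemma HasLead.wirt (hf : HasLead (k + 1) f p) (i : Fin n ⊕ Fin n) :
    HasLead k (wirt i f) (pderiv i p) := by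
  refine ⟨hf.1.pderiv, (hf.2.2.2 i).congr ?_⟩
  rw [← wirt_evalFun]
  exact (wirt_sub hf.smoothNear (smoothNear_evalFun p 0) i).symm

lemma HasLead.conjFun (hf : HasLead k f p) : HasLead k (conjFun f) (conjHom n p) := by
  refine ⟨conjHom_isHomogeneous hf.1, hf.2.conjFun.congr (.of_eq ?_)⟩
  rw [evalFun_conjHom]
  ext x
  simp [CRFlat.conjFun]

lemma HasLead.sum {ι : Type*} {s : Finset ι} {F : ι → (Fin n → ℂ) → ℂ} {P : ι → Poly n}
    (h : ∀ i ∈ s, HasLead k (F i) (P i)) : HasLead k (∑ i ∈ s, F i) (∑ i ∈ s, P i) := by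
  classical
  induction s using Finset.induction_on with
  | empty => exact hasLead_zero_of_flatTo flatTo_zero
  | insert i s hi ih =>
    rw [Finset.sum_insert hi, Finset.sum_insert hi]
    exact (h i (Finset.mem_insert_self i s)).add
      (ih fun j hj => h j (Finset.mem_insert_of_mem hj))

lemma eq_zero_of_flatTo_evalFun (hp : p.IsHomogeneous k) (h : FlatTo (k + 1) (evalFun p)) :
    p = 0 := by
  induction k generalizing p with
  | zero =>
    have hC := totalDegree_eq_zero_iff_eq_C.1 (Nat.le_zero.1 hp.totalDegree_le)
    have h0 := h.2.1
    rw [hC] at h0 ⊢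
    simp only [evalFun, eval_C] at h0
    rw [h0, C_0]
  | succ k ih =>
    have h1 : ∀ i, pderiv i p = 0 := fun i =>
      ih hp.pderiv (by rw [← wirt_evalFun]; exact h.2.2 i)
    have h2 := hp.sum_X_mul_pderiv
    simp only [h1, mul_zero, Finset.sum_const_zero] at h2
    exact (smul_eq_zero.1 h2.symm).resolve_left (Nat.succ_ne_zero k)

/-- The leading part is unique. -/
lemma HasLead.unique (hf : HasLead k f p) (hg : HasLead k g q) (h : f =ᶠ[𝓝 0] g) : p = q := by
  refine sub_eq_zero.1 (eq_zero_of_flatTo_evalFun (hf.1.sub hg.1)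
    ((hg.2.sub hf.2).congr ?_))
  filter_upwards [h] with x hx
  rw [evalFun_sub]
  simp only [Pi.sub_apply, hx]
  ring

/-- Taylor's formula: the coefficients of the leading part are found by integrating those of the
first derivatives with the help of Euler's identity. -/
lemma FlatTo.exists_hasLead (h : FlatTo k f) : ∃ p, HasLead k f p := by
  induction k generalizing f with
  | zero =>
    refine ⟨C (f 0), isHomogeneous_C _ _, SmoothNear.sub h (smoothNear_evalFun _ 0), ?_,
      fun i => (SmoothNear.sub h (smoothNear_evalFun _ 0)).wirt i⟩
    simp [evalFun]
  | succ k ih =>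
    choose P hP using fun i => ih (h.2.2 i)
    have hcomm : ∀ i l, pderiv l (P i) = pderiv i (P l) := by
      intro i l
      rcases k with _ | k
      · have hz : ∀ i l, pderiv l (P i) = 0 := fun i l => by
          rw [totalDegree_eq_zero_iff_eq_C.1 (Nat.le_zero.1 (hP i).1.totalDegree_le), pderiv_C]
        rw [hz, hz]
      · refine ((hP i).wirt l).unique ((hP l).wirt i) ?_
        filter_upwards [h.smoothNear.eventually] with x hx using wirt_comm hx l i
    have hder : ∀ l, pderiv l (C (1 / ((k : ℂ) + 1)) * ∑ i, X i * P i) = P l := by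
      classical
      intro l
      have h1 : ∀ i, pderiv l (X i * P i) = (if i = l then P i else 0) + X i * pderiv i (P l) := by
        intro i
        rw [pderiv_mul, pderiv_X, hcomm]
        simp [Pi.single_apply, eq_comm]
      rw [pderiv_C_mul, map_sum]
      simp only [h1, Finset.sum_add_distrib]
      rw [(hP l).1.sum_X_mul_pderiv]
      have hk : (k : ℂ) + 1 ≠ 0 := Nat.cast_add_one_ne_zero k
      have h2 : (C (1 / ((k : ℂ) + 1)) : Poly n) * (k + 1) = 1 := by
        have h3 : ((k : Poly n) + 1) = C ((k : ℂ) + 1) := by simp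
        rw [h3, ← C_mul, one_div_mul_cancel hk, C_1]
      simp only [Finset.sum_ite_eq', Finset.mem_univ, if_true, nsmul_eq_mul]
      linear_combination P l * h2
    have hhom : (C (1 / ((k : ℂ) + 1)) * ∑ i, X i * P i : Poly n).IsHomogeneous (k + 1) := by
      refine IsHomogeneous.C_mul (IsHomogeneous.sum _ _ _ fun i _ => ?_) _
      rw [add_comm]
      exact (isHomogeneous_X _ _).mul (hP i).1
    refine ⟨_, hhom, h.1.sub (smoothNear_evalFun _ 0), ?_, fun l => ?_⟩
    · rw [Pi.sub_apply, h.2.1, evalFun_apply_zero hhom, sub_zero]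
    · refine (hP l).2.congr ?_
      filter_upwards [wirt_sub h.1 (smoothNear_evalFun _ 0) l] with x hx
      rw [hx, wirt_evalFun, hder]

lemma norm_fderiv_le_sum_wirt (f : (Fin n → ℂ) → ℂ) (x : Fin n → ℂ) :
    ‖fderiv ℝ f x‖ ≤ ∑ j, (‖wirt (Sum.inl j) f x‖ + ‖wirt (Sum.inr j) f x‖) := by
  refine ContinuousLinearMap.opNorm_le_bound _ (Finset.sum_nonneg fun j _ => by positivity)
    fun v => ?_
  rw [fderiv_eq_sum_wirt, Finset.sum_mul]
  refine (norm_sum_le _ _).trans (Finset.sum_le_sum fun j _ => (norm_add_le _ _).trans ?_)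
  rw [norm_mul, norm_mul, RCLike.norm_conj]
  have := norm_le_pi_norm v j
  nlinarith [norm_nonneg (wirt (Sum.inl j) f x), norm_nonneg (wirt (Sum.inr j) f x)]

/-- A function that vanishes to order `k` in the sense of derivatives is `O(|z|^k)`. -/
lemma FlatTo.isBigO (h : FlatTo k f) : f =O[𝓝 0] fun z => ‖z‖ ^ k := by
  induction k generalizing f with
  | zero =>
    simpa using h.smoothNear.contDiffAt.continuousAt.isBigO_one (F := ℝ)
  | succ k ih =>
    have h1 : (fun x => ∑ j, (‖CRFlat.wirt (Sum.inl j) f x‖ +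
        ‖CRFlat.wirt (Sum.inr j) f x‖)) =O[𝓝 0] fun z => ‖z‖ ^ k :=
      IsBigO.fun_sum fun j _ => (ih (h.2.2 _)).norm_left.add (ih (h.2.2 _)).norm_left
    obtain ⟨c, hc⟩ := h1.bound
    obtain ⟨ε, hε, hball⟩ := Metric.eventually_nhds_iff_ball.1 (hc.and h.smoothNear.eventually)
    refine IsBigO.of_bound |c| ?_
    filter_upwards [Metric.ball_mem_nhds 0 hε] with z hz
    have hsub : Metric.closedBall (0 : Fin n → ℂ) ‖z‖ ⊆ Metric.ball 0 ε := fun y hy => by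
      rw [mem_closedBall_zero_iff] at hy
      rw [mem_ball_zero_iff] at hz ⊢
      exact hy.trans_lt hz
    have hz0 := (hball z hz).1
    have hnn : ∀ x, 0 ≤ ∑ j, (‖CRFlat.wirt (Sum.inl j) f x‖ + ‖CRFlat.wirt (Sum.inr j) f x‖) :=
      fun x => Finset.sum_nonneg fun j _ => by positivity
    have hb : ∀ y ∈ Metric.closedBall (0 : Fin n → ℂ) ‖z‖, ‖fderiv ℝ f y‖ ≤ |c| * ‖z‖ ^ k := by
      intro y hy
      have hy' := (hball y (hsub hy)).1
      rw [Real.norm_of_nonneg (hnn y), Real.norm_of_nonneg (by positivity)] at hy'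
      refine (norm_fderiv_le_sum_wirt f y).trans (hy'.trans ?_)
      refine mul_le_mul (le_abs_self c) ?_ (by positivity) (abs_nonneg c)
      exact pow_le_pow_left₀ (norm_nonneg y) (by simpa using hy) k
    have hmv := (convex_closedBall (0 : Fin n → ℂ) ‖z‖).norm_image_sub_le_of_norm_fderiv_le
      (𝕜 := ℝ) (f := f) (fun y hy => (hball y (hsub hy)).2.differentiableAt) hb
      (Metric.mem_closedBall_self (norm_nonneg z)) (show z ∈ _ by simp)
    rw [h.2.1, sub_zero, sub_zero] at hmv
    rwa [Real.norm_of_nonneg (by positivity), pow_succ, ← mul_assoc]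

lemma evalFun_smul (hp : p.IsHomogeneous k) (t : ℝ) (z : Fin n → ℂ) :
    evalFun p (t • z) = (t : ℂ) ^ k * evalFun p z := by
  rw [evalFun, evalFun, eval_eq, eval_eq, Finset.mul_sum]
  refine Finset.sum_congr rfl fun d hd => ?_
  have h1 : ∀ i, Sum.elim (t • z) (fun j => conj ((t • z) j)) i =
      t * Sum.elim z (fun j => conj (z j)) i := by
    rintro (i | i) <;> simp
  simp only [h1, mul_pow, Finset.prod_mul_distrib, Finset.prod_pow_eq_pow_sum]
  have h2 : ∑ i ∈ d.support, d i = k := by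
    have h3 := hp (mem_support_iff.1 hd)
    simpa only [Finsupp.weight_apply, Finsupp.sum, Pi.one_apply, smul_eq_mul, mul_one] using h3
  rw [h2]
  ring

/-- A function which vanishes to order `k` and is `o(|z|^k)` vanishes to order `k + 1`. -/
lemma FlatTo.succ_of_isLittleO (h : FlatTo k f) (ho : f =o[𝓝 0] fun z => ‖z‖ ^ k) :
    FlatTo (k + 1) f := by
  obtain ⟨p, hp⟩ := h.exists_hasLead
  suffices hz : evalFun p = 0 by
    have := hp.2
    rwa [hz, sub_zero] at this
  have hpo : evalFun p =o[𝓝 0] fun z => ‖z‖ ^ k := by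
    have h1 : (f - evalFun p) =o[𝓝 0] fun z => ‖z‖ ^ k := by
      refine hp.2.isBigO.trans_isLittleO ?_
      exact (isLittleO_pow_pow (Nat.lt_succ_self k)).comp_tendsto tendsto_norm_zero
    simpa using ho.sub h1
  ext z
  by_contra hne
  have hne' : 0 < ‖evalFun p z‖ := norm_pos_iff.2 hne
  have htend : Tendsto (fun t : ℝ => t • z) (𝓝[>] 0) (𝓝 0) := by
    have : Tendsto (fun t : ℝ => t • z) (𝓝 0) (𝓝 ((0 : ℝ) • z)) :=
      (continuous_id.smul continuous_const).tendsto 0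
    rw [zero_smul] at this
    exact this.mono_left nhdsWithin_le_nhds
  have hb := (hpo.comp_tendsto htend).def
    (show 0 < ‖evalFun p z‖ / (2 * (‖z‖ ^ k + 1)) by positivity)
  obtain ⟨t, ht, ht0⟩ := (hb.and self_mem_nhdsWithin).exists
  have ht0' : 0 < t := ht0
  simp only [Function.comp_apply, evalFun_smul hp.1, norm_mul, norm_pow, norm_smul, norm_norm,
    Complex.norm_real, Real.norm_of_nonneg ht0'.le, mul_pow] at ht
  have h2 : ‖evalFun p z‖ ≤ ‖evalFun p z‖ / (2 * (‖z‖ ^ k + 1)) * ‖z‖ ^ k :=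
    le_of_mul_le_mul_left (by linarith) (pow_pos ht0' k)
  have h3 : ‖evalFun p z‖ / (2 * (‖z‖ ^ k + 1)) * ‖z‖ ^ k < ‖evalFun p z‖ := by
    rw [div_mul_eq_mul_div, div_lt_iff₀ (by positivity)]
    have : 0 ≤ ‖z‖ ^ k := by positivity
    nlinarith
  exact absurd h2 (not_le.2 h3)

lemma flatTo_of_isBigO (h : SmoothNear f 0) (hO : f =O[𝓝 0] fun z => ‖z‖ ^ k) : FlatTo k f := by
  have key : ∀ j ≤ k, FlatTo j f := by
    intro j
    induction j with
    | zero => exact fun _ => h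
    | succ j ih =>
      intro hj
      refine (ih (by omega)).succ_of_isLittleO (hO.trans_isLittleO ?_)
      exact (isLittleO_pow_pow (by omega : j < k)).comp_tendsto tendsto_norm_zero
  exact key k le_rfl

end lead

/-! ### Brackets of tangential fields -/

section brackets

variable {n : ℕ} {A : Type*} [CommRing A] (D : Fin n ⊕ Fin n → Derivation ℤ A A)

/-- The derivation with coefficients `Z_i` in the frame `D_i`. -/
def field (Z : Fin n ⊕ Fin n → A) : Derivation ℤ A A := ∑ i, Z i • D i

lemma field_apply (Z : Fin n ⊕ Fin n → A) (a : A) : field D Z a = ∑ i, Z i * D i a := by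
  have h : ∀ s : Finset (Fin n ⊕ Fin n), (∑ i ∈ s, Z i • D i) a = ∑ i ∈ s, Z i * D i a := by
    classical
    intro s
    induction s using Finset.induction_on with
    | empty => simp
    | insert i s hi ih => rw [Finset.sum_insert hi, Finset.sum_insert hi, Derivation.add_apply, ih,
        Derivation.smul_apply, smul_eq_mul]
  exact h Finset.univ

variable {D}

lemma lie_field (hD : ∀ i j a, D i (D j a) = D j (D i a)) (Y Z : Fin n ⊕ Fin n → A) :
    ⁅field D Y, field D Z⁆ = field D fun i => field D Y (Z i) - field D Z (Y i) := by
  ext a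
  have h : ∀ U V : Fin n ⊕ Fin n → A, field D U (field D V a) =
      ∑ i, field D U (V i) * D i a + ∑ i, ∑ j, U i * V j * D i (D j a) := by
    intro U V
    rw [field_apply D V, map_sum, Finset.sum_comm, ← Finset.sum_add_distrib]
    refine Finset.sum_congr rfl fun i _ => ?_
    rw [Derivation.leibniz, smul_eq_mul, smul_eq_mul, field_apply, field_apply, Finset.mul_sum,
      add_comm, mul_comm]
    congr 1
    exact Finset.sum_congr rfl fun j _ => by ring
  rw [Derivation.commutator_apply, h, h, field_apply]
  have h2 : ∑ i, ∑ j, Y i * Z j * D i (D j a) = ∑ i, ∑ j, Z i * Y j * D i (D j a) := by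
    rw [Finset.sum_comm]
    refine Finset.sum_congr rfl fun i _ => Finset.sum_congr rfl fun j _ => ?_
    rw [hD]
    ring
  rw [h2]
  simp only [sub_mul, Finset.sum_sub_distrib]
  ring

/-- A field of type `(1,0)`. -/
def holField (M : Fin n → A) : Fin n ⊕ Fin n → A := Sum.elim M 0

/-- A field of type `(0,1)`. -/
def antiField (N : Fin n → A) : Fin n ⊕ Fin n → A := Sum.elim 0 N

lemma field_holField (M : Fin n → A) (a : A) :
    field D (holField M) a = fieldOp (fun i => D i) M a := by
  rw [field_apply, fieldOp, Fintype.sum_sum_type]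
  simp [holField]

lemma field_antiField (N : Fin n → A) (a : A) :
    field D (antiField N) a = ∑ k, N k * D (Sum.inr k) a := by
  rw [field_apply, Fintype.sum_sum_type]
  simp [antiField]

/-- The coefficients of the bracket of a `(1,0)` and a `(0,1)` field. -/
def bracketField (D : Fin n ⊕ Fin n → Derivation ℤ A A) (M N : Fin n → A) : Fin n ⊕ Fin n → A :=
  Sum.elim (fun j => -field D (antiField N) (M j)) fun k => field D (holField M) (N k)

lemma lie_holField_antiField (hD : ∀ i j a, D i (D j a) = D j (D i a)) (M N : Fin n → A) :
    ⁅field D (holField M), field D (antiField N)⁆ = field D (bracketField D M N) := by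
  rw [lie_field hD]
  congr 1
  ext i
  rcases i with i | i <;> simp [holField, antiField, bracketField]

/-- The value of `∂f` on `[M, N]` when `∂f (M) = 0`. -/
lemma sum_bracketField_inl {M N : Fin n → A} {f : A}
    (hM : ∑ j, M j * D (Sum.inl j) f = 0) :
    ∑ j, bracketField D M N (Sum.inl j) * D (Sum.inl j) f = leviOp (fun i => D i) M N f := by
  have h := congrArg (field D (antiField N)) hM
  rw [map_sum, map_zero] at h
  simp only [Derivation.leibniz, smul_eq_mul, Finset.sum_add_distrib] at h
  have h2 : ∑ j, M j * field D (antiField N) (D (Sum.inl j) f) =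
      leviOp (fun i => D i) M N f := by
    refine Finset.sum_congr rfl fun j _ => ?_
    rw [field_antiField, Finset.mul_sum]
    exact Finset.sum_congr rfl fun k _ => by ring
  rw [h2] at h
  simp only [bracketField, Sum.elim_inl, neg_mul, Finset.sum_neg_distrib]
  rw [neg_eq_iff_add_eq_zero, ← h, add_comm]
  congr 1
  exact Finset.sum_congr rfl fun j _ => mul_comm _ _

/-- The value of `∂̄f` on `[M, N]` when `∂̄f (N) = 0`. -/
lemma sum_bracketField_inr (hD : ∀ i j a, D i (D j a) = D j (D i a)) {M N : Fin n → A} {f : A}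
    (hN : ∑ k, N k * D (Sum.inr k) f = 0) :
    ∑ k, bracketField D M N (Sum.inr k) * D (Sum.inr k) f = -leviOp (fun i => D i) M N f := by
  have h := congrArg (field D (holField M)) hN
  rw [map_sum, map_zero] at h
  simp only [Derivation.leibniz, smul_eq_mul, Finset.sum_add_distrib] at h
  have h2 : ∑ k, N k * field D (holField M) (D (Sum.inr k) f) =
      leviOp (fun i => D i) M N f := by
    rw [leviOp, Finset.sum_comm]
    refine Finset.sum_congr rfl fun k _ => ?_
    rw [field_holField, fieldOp, Finset.mul_sum]
    refine Finset.sum_congr rfl fun j _ => ?_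
    rw [hD]
    ring
  rw [h2] at h
  simp only [bracketField, Sum.elim_inr]
  rw [eq_neg_iff_add_eq_zero, ← h, add_comm]
  congr 1
  exact Finset.sum_congr rfl fun j _ => mul_comm _ _

/-- The coefficients of the iterated bracket `[L, [M, N]]`. -/
def tripleField (D : Fin n ⊕ Fin n → Derivation ℤ A A) (L M N : Fin n → A) : Fin n ⊕ Fin n → A :=
  fun i => field D (holField L) (bracketField D M N i) -
    field D (bracketField D M N) (holField L i)

/-- The value of `∂̄f` on `[L, [M, N]]` when `∂̄f (N) = 0`. -/
lemma sum_tripleField_inr (hD : ∀ i j a, D i (D j a) = D j (D i a)) {L M N : Fin n → A} {f : A}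
    (hN : ∑ k, N k * D (Sum.inr k) f = 0) :
    ∑ k, tripleField D L M N (Sum.inr k) * D (Sum.inr k) f = -thirdOp (fun i => D i) L M N f := by
  have h := congrArg (field D (holField L)) (sum_bracketField_inr (M := M) hD hN)
  rw [map_sum, map_neg] at h
  simp only [Derivation.leibniz, smul_eq_mul, Finset.sum_add_distrib] at h
  have h2 : ∑ k, bracketField D M N (Sum.inr k) * field D (holField L) (D (Sum.inr k) f) =
      ∑ j, ∑ k, D (Sum.inr k) (D (Sum.inl j) f) * L j * fieldOp (fun i => D i) M (N k) := by
    rw [Finset.sum_comm]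
    refine Finset.sum_congr rfl fun k _ => ?_
    rw [field_holField, fieldOp, Finset.mul_sum]
    refine Finset.sum_congr rfl fun j _ => ?_
    rw [hD, bracketField, Sum.elim_inr, field_holField]
    ring
  rw [h2, field_holField] at h
  have h3 : ∑ k, tripleField D L M N (Sum.inr k) * D (Sum.inr k) f =
      ∑ k, D (Sum.inr k) f * field D (holField L) (bracketField D M N (Sum.inr k)) := by
    refine Finset.sum_congr rfl fun k _ => ?_
    simp [tripleField, holField]
    ring
  rw [h3, thirdOp]
  linear_combination h

/-- The value of `∂f` on `[L, [M, N]]` when `∂f (L) = ∂f (M) = 0`. -/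
lemma sum_tripleField_inl (hD : ∀ i j a, D i (D j a) = D j (D i a)) {L M N : Fin n → A} {f : A}
    (hL : ∑ j, L j * D (Sum.inl j) f = 0) (hM : ∑ j, M j * D (Sum.inl j) f = 0) :
    ∑ j, tripleField D L M N (Sum.inl j) * D (Sum.inl j) f = thirdOp (fun i => D i) L M N f := by
  have h := congrArg (field D (holField L)) (sum_bracketField_inl (N := N) hM)
  have h' := congrArg (field D (bracketField D M N)) hL
  rw [map_sum] at h h'
  rw [map_zero] at h'
  simp only [Derivation.leibniz, smul_eq_mul, Finset.sum_add_distrib] at h h'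
  have h2 : ∑ j, L j * field D (bracketField D M N) (D (Sum.inl j) f) =
      (∑ j, bracketField D M N (Sum.inl j) * field D (holField L) (D (Sum.inl j) f)) +
      ∑ j, ∑ k, D (Sum.inr k) (D (Sum.inl j) f) * L j * fieldOp (fun i => D i) M (N k) := by
    have h5 : ∑ j, bracketField D M N (Sum.inl j) * field D (holField L) (D (Sum.inl j) f) =
        ∑ j, ∑ i, L j * bracketField D M N (Sum.inl i) * D (Sum.inl i) (D (Sum.inl j) f) := by
      rw [Finset.sum_comm]
      refine Finset.sum_congr rfl fun j _ => ?_
      rw [field_holField, fieldOp, Finset.mul_sum]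
      refine Finset.sum_congr rfl fun i _ => ?_
      rw [hD]
      ring
    rw [h5, ← Finset.sum_add_distrib]
    refine Finset.sum_congr rfl fun j _ => ?_
    rw [field_apply, Fintype.sum_sum_type, mul_add, Finset.mul_sum, Finset.mul_sum]
    congr 1
    · exact Finset.sum_congr rfl fun i _ => by ring
    · refine Finset.sum_congr rfl fun i _ => ?_
      rw [bracketField, Sum.elim_inr, field_holField]
      ring
  rw [h2] at h'
  rw [field_holField] at h
  have h3 : ∑ j, tripleField D L M N (Sum.inl j) * D (Sum.inl j) f =
      (∑ j, D (Sum.inl j) f * field D (holField L) (bracketField D M N (Sum.inl j))) -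
        ∑ j, D (Sum.inl j) f * field D (bracketField D M N) (L j) := by
    rw [← Finset.sum_sub_distrib]
    refine Finset.sum_congr rfl fun k _ => ?_
    simp [tripleField, holField]
    ring
  rw [h3, thirdOp]
  linear_combination h - h'

/-- Algebraic form of the obstruction: functions vanishing on `S` form the additive subgroup `I`,
`ev` is evaluation at a point of `S`, and the fields of type `(1,0)` and `(0,1)` which annihilate
`G` (the conjugate of `F`) and `F` are tangent to `S`. If some `Φ ∈ I` has differential
`c ∂G + c' ∂̄F` at the point, this differential vanishes on all iterated brackets. -/
lemma proportional_of_tangent (hD : ∀ i j a, D i (D j a) = D j (D i a)) (I : AddSubgroup A)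
    (ev : A →+* ℂ) (hI : ∀ a ∈ I, ev a = 0) {F G Φ : A} (hΦ : Φ ∈ I)
    (hhol : ∀ M : Fin n → A, ∑ j, M j * D (Sum.inl j) G = 0 →
      ∀ a ∈ I, field D (holField M) a ∈ I)
    (hanti : ∀ N : Fin n → A, ∑ k, N k * D (Sum.inr k) F = 0 →
      ∀ a ∈ I, field D (antiField N) a ∈ I)
    {c c' : ℂ} (hc : ∀ j, ev (D (Sum.inl j) Φ) = c * ev (D (Sum.inl j) G))
    (hc' : ∀ j, ev (D (Sum.inr j) Φ) = c' * ev (D (Sum.inr j) F))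
    {L M N : Fin n → A} (hL : ∑ j, L j * D (Sum.inl j) G = 0)
    (hM : ∑ j, M j * D (Sum.inl j) G = 0) (hN : ∑ k, N k * D (Sum.inr k) F = 0) :
    c * ev (leviOp (fun i => D i) M N G) = c' * ev (leviOp (fun i => D i) M N F) ∧
      c * ev (thirdOp (fun i => D i) L M N G) = c' * ev (thirdOp (fun i => D i) L M N F) := by
  have hlie : ∀ δ ε : Derivation ℤ A A, (∀ a ∈ I, δ a ∈ I) → (∀ a ∈ I, ε a ∈ I) →
      ∀ a ∈ I, ⁅δ, ε⁆ a ∈ I := by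
    intro δ ε hδ hε a ha
    rw [Derivation.commutator_apply]
    exact I.sub_mem (hδ _ (hε _ ha)) (hε _ (hδ _ ha))
  have hval : ∀ Z : Fin n ⊕ Fin n → A, ev (field D Z Φ) =
      c * ev (∑ j, Z (Sum.inl j) * D (Sum.inl j) G) +
        c' * ev (∑ k, Z (Sum.inr k) * D (Sum.inr k) F) := by
    intro Z
    rw [field_apply, Fintype.sum_sum_type]
    simp only [map_add, map_sum, map_mul, hc, hc', Finset.mul_sum]
    congr 1 <;> exact Finset.sum_congr rfl fun j _ => by ring
  have h1 : ∀ a ∈ I, field D (bracketField D M N) a ∈ I := by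
    rw [← lie_holField_antiField hD]
    exact hlie _ _ (hhol M hM) (hanti N hN)
  have h2 : ∀ a ∈ I, field D (tripleField D L M N) a ∈ I := by
    have h3 := hlie _ _ (hhol L hL) h1
    rwa [lie_field hD] at h3
  have e1 := hI _ (h1 Φ hΦ)
  have e2 := hI _ (h2 Φ hΦ)
  rw [hval, sum_bracketField_inl hM, sum_bracketField_inr hD hN, map_neg] at e1
  rw [hval, sum_tripleField_inl hD hL hM, sum_tripleField_inr hD hN, map_neg] at e2
  exact ⟨by linear_combination e1, by linear_combination e2⟩

end brackets

/-! ### The ring of germs of smooth functions -/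

section germs

variable {n : ℕ}

/-- The ring of germs at `z` of smooth complex valued functions. -/
noncomputable def smoothGerms (z : Fin n → ℂ) : Subring (Germ (𝓝 z) ℂ) where
  carrier := {g | ∃ f : (Fin n → ℂ) → ℂ, SmoothNear f z ∧ (f : Germ (𝓝 z) ℂ) = g}
  zero_mem' := ⟨0, smoothNear_const 0 z, rfl⟩
  one_mem' := ⟨1, smoothNear_const 1 z, rfl⟩
  add_mem' := by
    rintro _ _ ⟨f, hf, rfl⟩ ⟨g, hg, rfl⟩
    exact ⟨f + g, hf.add hg, rfl⟩
  mul_mem' := by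
    rintro _ _ ⟨f, hf, rfl⟩ ⟨g, hg, rfl⟩
    exact ⟨f * g, hf.mul hg, rfl⟩
  neg_mem' := by
    rintro _ ⟨f, hf, rfl⟩
    exact ⟨-f, ((smoothNear_const 0 z).sub hf).congr (.of_forall fun x => by simp), rfl⟩

variable {z : Fin n → ℂ}

/-- The germ of a smooth function. -/
noncomputable def toGerm (f : (Fin n → ℂ) → ℂ) (hf : SmoothNear f z) : smoothGerms z :=
  ⟨f, f, hf, rfl⟩

/-- A representative of a germ. -/
noncomputable def germRep (g : smoothGerms z) : (Fin n → ℂ) → ℂ := g.2.choose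

lemma smoothNear_germRep (g : smoothGerms z) : SmoothNear (germRep g) z := g.2.choose_spec.1

lemma coe_germRep (g : smoothGerms z) : (germRep g : Germ (𝓝 z) ℂ) = g := g.2.choose_spec.2

lemma toGerm_germRep (g : smoothGerms z) : toGerm (germRep g) (smoothNear_germRep g) = g :=
  Subtype.ext (coe_germRep g)

lemma toGerm_eq_iff {f g : (Fin n → ℂ) → ℂ} {hf : SmoothNear f z} {hg : SmoothNear g z} :
    toGerm f hf = toGerm g hg ↔ f =ᶠ[𝓝 z] g := by
  rw [Subtype.ext_iff]
  exact Germ.coe_eq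

lemma germRep_toGerm (f : (Fin n → ℂ) → ℂ) (hf : SmoothNear f z) :
    germRep (toGerm f hf) =ᶠ[𝓝 z] f :=
  toGerm_eq_iff.1 (toGerm_germRep (toGerm f hf))

lemma toGerm_add {f g : (Fin n → ℂ) → ℂ} (hf : SmoothNear f z) (hg : SmoothNear g z) :
    toGerm f hf + toGerm g hg = toGerm (f + g) (hf.add hg) := rfl

lemma toGerm_mul {f g : (Fin n → ℂ) → ℂ} (hf : SmoothNear f z) (hg : SmoothNear g z) :
    toGerm f hf * toGerm g hg = toGerm (f * g) (hf.mul hg) := rfl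

lemma toGerm_sum {ι : Type*} (s : Finset ι) {F : ι → (Fin n → ℂ) → ℂ}
    (hF : ∀ i, SmoothNear (F i) z) :
    ∑ i ∈ s, toGerm (F i) (hF i) = toGerm (∑ i ∈ s, F i) (SmoothNear.sum fun i _ => hF i) := by
  classical
  induction s using Finset.induction_on with
  | empty => rfl
  | insert i s hi ih =>
    rw [Finset.sum_insert hi, ih, toGerm_add, toGerm_eq_iff, Finset.sum_insert hi]

lemma exists_toGerm (g : smoothGerms z) : ∃ f, ∃ hf : SmoothNear f z, g = toGerm f hf :=
  ⟨germRep g, smoothNear_germRep g, (toGerm_germRep g).symm⟩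

/-- The Wirtinger derivatives of a germ. -/
noncomputable def wirtGermFun (i : Fin n ⊕ Fin n) (g : smoothGerms z) : smoothGerms z :=
  toGerm (wirt i (germRep g)) ((smoothNear_germRep g).wirt i)

lemma wirtGermFun_toGerm (i : Fin n ⊕ Fin n) (f : (Fin n → ℂ) → ℂ) (hf : SmoothNear f z) :
    wirtGermFun i (toGerm f hf) = toGerm (wirt i f) (hf.wirt i) := by
  rw [wirtGermFun, toGerm_eq_iff]
  exact wirt_congr (germRep_toGerm f hf) i

lemma wirtGermFun_add (i : Fin n ⊕ Fin n) (a b : smoothGerms z) :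
    wirtGermFun i (a + b) = wirtGermFun i a + wirtGermFun i b := by
  obtain ⟨f, hf, rfl⟩ := exists_toGerm a
  obtain ⟨g, hg, rfl⟩ := exists_toGerm b
  rw [toGerm_add, wirtGermFun_toGerm, wirtGermFun_toGerm, wirtGermFun_toGerm, toGerm_add,
    toGerm_eq_iff]
  exact wirt_add hf hg i

lemma wirtGermFun_mul (i : Fin n ⊕ Fin n) (a b : smoothGerms z) :
    wirtGermFun i (a * b) = a * wirtGermFun i b + b * wirtGermFun i a := by
  obtain ⟨f, hf, rfl⟩ := exists_toGerm a
  obtain ⟨g, hg, rfl⟩ := exists_toGerm b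
  rw [toGerm_mul, wirtGermFun_toGerm, wirtGermFun_toGerm, wirtGermFun_toGerm, toGerm_mul,
    toGerm_mul, toGerm_add, toGerm_eq_iff]
  filter_upwards [wirt_mul hf hg i] with x hx
  rw [hx]
  simp only [Pi.add_apply, Pi.mul_apply]
  ring

/-- The Wirtinger derivatives as derivations of the ring of germs. -/
noncomputable def wirtGerm (z : Fin n → ℂ) (i : Fin n ⊕ Fin n) :
    Derivation ℤ (smoothGerms z) (smoothGerms z) :=
  Derivation.mk' (AddMonoidHom.toIntLinearMap (AddMonoidHom.mk' (wirtGermFun i)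
    (wirtGermFun_add i))) (wirtGermFun_mul i)

lemma wirtGerm_toGerm (i : Fin n ⊕ Fin n) (f : (Fin n → ℂ) → ℂ) (hf : SmoothNear f z) :
    wirtGerm z i (toGerm f hf) = toGerm (wirt i f) (hf.wirt i) :=
  wirtGermFun_toGerm i f hf

lemma wirtGerm_comm (i j : Fin n ⊕ Fin n) (a : smoothGerms z) :
    wirtGerm z i (wirtGerm z j a) = wirtGerm z j (wirtGerm z i a) := by
  rw [← toGerm_germRep a]
  simp only [wirtGerm_toGerm]
  rw [toGerm_eq_iff]
  filter_upwards [(smoothNear_germRep a).eventually] with x hx using wirt_comm hx i j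

/-- Evaluation of germs at the base point. -/
noncomputable def evalGerm (z : Fin n → ℂ) : smoothGerms z →+* ℂ :=
  (Germ.valueRingHom (x := z) (E := ℂ)).comp (smoothGerms z).subtype

lemma evalGerm_toGerm (f : (Fin n → ℂ) → ℂ) (hf : SmoothNear f z) :
    evalGerm z (toGerm f hf) = f z := rfl

lemma fieldOp_toGerm {M : Fin n → (Fin n → ℂ) → ℂ} (hM : ∀ j, SmoothNear (M j) z)
    {f : (Fin n → ℂ) → ℂ} (hf : SmoothNear f z) :
    ∃ h : SmoothNear (fieldOp wirt M f) z,
      fieldOp (fun i => wirtGerm z i) (fun j => toGerm (M j) (hM j)) (toGerm f hf) =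
        toGerm (fieldOp wirt M f) h := by
  refine ⟨SmoothNear.sum fun j _ => (hM j).mul (hf.wirt _), ?_⟩
  simp only [fieldOp, wirtGerm_toGerm, toGerm_mul]
  exact toGerm_sum _ _

lemma leviOp_toGerm {M N : Fin n → (Fin n → ℂ) → ℂ} (hM : ∀ j, SmoothNear (M j) z)
    (hN : ∀ j, SmoothNear (N j) z) {f : (Fin n → ℂ) → ℂ} (hf : SmoothNear f z) :
    ∃ h : SmoothNear (leviOp wirt M N f) z,
      leviOp (fun i => wirtGerm z i) (fun j => toGerm (M j) (hM j))
        (fun j => toGerm (N j) (hN j)) (toGerm f hf) = toGerm (leviOp wirt M N f) h := by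
  have hs : ∀ j k, SmoothNear (wirt (Sum.inr k) (wirt (Sum.inl j) f) * M j * N k) z :=
    fun j k => (((hf.wirt _).wirt _).mul (hM j)).mul (hN k)
  refine ⟨SmoothNear.sum fun j _ => SmoothNear.sum fun k _ => hs j k, ?_⟩
  simp only [leviOp, wirtGerm_toGerm, toGerm_mul]
  simp only [toGerm_sum _ (hs _)]
  exact toGerm_sum _ _

lemma thirdOp_toGerm {L M N : Fin n → (Fin n → ℂ) → ℂ} (hL : ∀ j, SmoothNear (L j) z)
    (hM : ∀ j, SmoothNear (M j) z) (hN : ∀ j, SmoothNear (N j) z) {f : (Fin n → ℂ) → ℂ}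
    (hf : SmoothNear f z) :
    ∃ h : SmoothNear (thirdOp wirt L M N f) z,
      thirdOp (fun i => wirtGerm z i) (fun j => toGerm (L j) (hL j))
        (fun j => toGerm (M j) (hM j)) (fun j => toGerm (N j) (hN j)) (toGerm f hf) =
          toGerm (thirdOp wirt L M N f) h := by
  obtain ⟨h1, h1'⟩ := leviOp_toGerm hM hN hf
  obtain ⟨h2, h2'⟩ := fieldOp_toGerm hL h1
  choose h3 h3' using fun k => fieldOp_toGerm hM (hN k)
  have hs : ∀ j k, SmoothNear (wirt (Sum.inr k) (wirt (Sum.inl j) f) * L j *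
      fieldOp wirt M (N k)) z :=
    fun j k => (((hf.wirt _).wirt _).mul (hL j)).mul (h3 k)
  have hs' := SmoothNear.sum (s := Finset.univ) fun j _ =>
    SmoothNear.sum (s := Finset.univ) fun k _ => hs j k
  refine ⟨h2.add hs', ?_⟩
  rw [thirdOp, h1', h2']
  simp only [h3', wirtGerm_toGerm, toGerm_mul]
  simp only [toGerm_sum _ (hs _)]
  rw [toGerm_sum]
  rfl

end germs

/-! ### Non-minimality of a graph and the resulting differential equations -/

section nonminimal

variable {n : ℕ}

/-- The vector `v` at `z` belongs to the complex tangent space of the graph `w = F(z)`, projected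
to `ℂⁿ`: the differential of `F` at `z` is complex linear along `v`. -/
def IsComplexTangent (F : (Fin n → ℂ) → ℂ) (z v : Fin n → ℂ) : Prop :=
  fderiv ℝ F z (Complex.I • v) = Complex.I * fderiv ℝ F z v

/-- Non-minimality of the graph `w = F(z)` at the points near `0` where it is CR, expressed in the
`z`-space: through such a point passes a set `S`, contained in the zero set of a real function with
non-zero differential, to which all complex tangent vectors are tangent. -/
def NonMinimalGraph (F : (Fin n → ℂ) → ℂ) : Prop :=
  ∀ᶠ z in 𝓝 (0 : Fin n → ℂ), (∃ v, ¬ IsComplexTangent F z v) →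
    ∃ (S : Set (Fin n → ℂ)) (φ : (Fin n → ℂ) → ℝ), z ∈ S ∧ SmoothNear φ z ∧
      (∀ᶠ y in 𝓝[S] z, φ y = 0) ∧ fderiv ℝ φ z ≠ 0 ∧
      ∀ᶠ y in 𝓝[S] z, ∀ ψ : (Fin n → ℂ) → ℂ, DifferentiableAt ℝ ψ y →
        (∀ᶠ y' in 𝓝[S] y, ψ y' = 0) → ∀ v, IsComplexTangent F y v → fderiv ℝ ψ y v = 0

lemma fderiv_I_smul (F : (Fin n → ℂ) → ℂ) (z v : Fin n → ℂ) :
    fderiv ℝ F z (Complex.I • v) = Complex.I * fderiv ℝ F z v -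
      2 * Complex.I * ∑ j, conj (v j) * wirt (Sum.inr j) F z := by
  rw [fderiv_eq_sum_wirt, fderiv_eq_sum_wirt, Finset.mul_sum, Finset.mul_sum,
    ← Finset.sum_sub_distrib]
  refine Finset.sum_congr rfl fun j _ => ?_
  simp only [Pi.smul_apply, smul_eq_mul, map_mul, Complex.conj_I]
  ring

lemma isComplexTangent_iff {F : (Fin n → ℂ) → ℂ} {z v : Fin n → ℂ} :
    IsComplexTangent F z v ↔ ∑ j, conj (v j) * wirt (Sum.inr j) F z = 0 := by
  rw [IsComplexTangent, fderiv_I_smul, sub_eq_self]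
  simp

lemma sum_mul_wirt_inl (ψ : (Fin n → ℂ) → ℂ) (z v : Fin n → ℂ) :
    ∑ j, v j * wirt (Sum.inl j) ψ z =
      (fderiv ℝ ψ z v - Complex.I * fderiv ℝ ψ z (Complex.I • v)) / 2 := by
  have h := fderiv_eq_sum_wirt ψ z v
  rw [Finset.sum_add_distrib] at h
  rw [fderiv_I_smul, h]
  linear_combination (-(∑ j, conj (v j) * wirt (Sum.inr j) ψ z) +
    (∑ x, v x * wirt (Sum.inl x) ψ z) / 2 +
    (∑ x, conj (v x) * wirt (Sum.inr x) ψ z) / 2) * Complex.I_mul_I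

lemma sum_mul_wirt_inr (ψ : (Fin n → ℂ) → ℂ) (z v : Fin n → ℂ) :
    ∑ j, conj (v j) * wirt (Sum.inr j) ψ z =
      (fderiv ℝ ψ z v + Complex.I * fderiv ℝ ψ z (Complex.I • v)) / 2 := by
  rw [fderiv_I_smul]
  linear_combination (∑ j, conj (v j) * wirt (Sum.inr j) ψ z -
    fderiv ℝ ψ z v / 2) * Complex.I_mul_I

lemma IsComplexTangent.I_smul {F : (Fin n → ℂ) → ℂ} {z v : Fin n → ℂ}
    (h : IsComplexTangent F z v) : IsComplexTangent F z (Complex.I • v) := by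
  rw [isComplexTangent_iff] at h ⊢
  simp only [Pi.smul_apply, smul_eq_mul, map_mul, mul_assoc]
  rw [← Finset.mul_sum, h, mul_zero]

/-- The coefficients of the field `F̄_{z_p} ∂/∂z_q - F̄_{z_q} ∂/∂z_p`. -/
noncomputable def holCoeff (F : (Fin n → ℂ) → ℂ) (p q : Fin n) : Fin n → (Fin n → ℂ) → ℂ :=
  minorVec (fun j => wirt (Sum.inl j) (conjFun F)) p q

/-- The coefficients of the field `F_{z̄_p} ∂/∂z̄_q - F_{z̄_q} ∂/∂z̄_p`. -/
noncomputable def antiCoeff (F : (Fin n → ℂ) → ℂ) (p q : Fin n) : Fin n → (Fin n → ℂ) → ℂ :=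
  minorVec (fun j => wirt (Sum.inr j) F) p q

lemma smoothNear_minorVec {v : Fin n → (Fin n → ℂ) → ℂ} {a : Fin n → ℂ}
    (hv : ∀ j, SmoothNear (v j) a) (p q j : Fin n) : SmoothNear (minorVec v p q j) a := by
  refine SmoothNear.sub ?_ ?_
  · split_ifs
    exacts [hv p, smoothNear_const 0 a]
  · split_ifs
    exacts [hv q, smoothNear_const 0 a]

lemma SmoothNear.holCoeff {F : (Fin n → ℂ) → ℂ} {a : Fin n → ℂ} (hF : SmoothNear F a)
    (p q j : Fin n) : SmoothNear (holCoeff F p q j) a :=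
  smoothNear_minorVec (fun _ => hF.conjFun.wirt _) p q j

lemma SmoothNear.antiCoeff {F : (Fin n → ℂ) → ℂ} {a : Fin n → ℂ} (hF : SmoothNear F a)
    (p q j : Fin n) : SmoothNear (antiCoeff F p q j) a :=
  smoothNear_minorVec (fun _ => hF.wirt _) p q j

section pointwise

variable {F : (Fin n → ℂ) → ℂ} {z : Fin n → ℂ}

lemma wirt_conjFun_inl (hF : SmoothNear F z) (j : Fin n) :
    wirt (Sum.inl j) (conjFun F) z = conj (wirt (Sum.inr j) F z) :=
  wirt_conjFun hF.differentiableAt _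

lemma leviOp_eq_zero {f : (Fin n → ℂ) → ℂ} {M N : Fin n → (Fin n → ℂ) → ℂ}
    (hN : ∀ k, N k z = 0) : leviOp wirt M N f z = 0 := by
  simp [leviOp, Finset.sum_apply, hN]

lemma antiCoeff_eq_zero (h : ∀ v, IsComplexTangent F z v) (r s k : Fin n) :
    antiCoeff F r s k z = 0 := by
  classical
  have h0 : ∀ k, wirt (Sum.inr k) F z = 0 := fun k => by
    have := isComplexTangent_iff.1 (h (Pi.single k 1))
    simpa [Pi.single_apply, apply_ite] using this
  rw [antiCoeff, minorVec]
  split_ifs <;> simp [h0]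

lemma toGerm_sum_mul_eq_zero {ι : Type*} [Fintype ι] {M f : ι → (Fin n → ℂ) → ℂ}
    (hM : ∀ j, SmoothNear (M j) z) (hf : ∀ j, SmoothNear (f j) z) :
    ∑ j, toGerm (M j) (hM j) * toGerm (f j) (hf j) = 0 ↔
      ∀ᶠ y in 𝓝 z, ∑ j, M j y * f j y = 0 := by
  simp only [toGerm_mul]
  rw [toGerm_sum, ← show toGerm 0 (smoothNear_const 0 z) = (0 : smoothGerms z) from rfl,
    toGerm_eq_iff]
  simp [EventuallyEq, Finset.sum_apply]

/-- At a non-minimal CR point, the differential of the real function `φ` is `c ∂F̄ + c̄ ∂̄F`, and it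
vanishes on iterated brackets of complex tangential fields; since `c ≠ 0` this forces the values of
the second and third order operators on `F̄` to be proportional to those on `F`. -/
lemma exists_proportional (hF : SmoothNear F z) (hCR : ∃ v, ¬ IsComplexTangent F z v)
    {S : Set (Fin n → ℂ)} {φ : (Fin n → ℂ) → ℝ} (hzS : z ∈ S) (hφ : SmoothNear φ z)
    (hφS : ∀ᶠ y in 𝓝[S] z, φ y = 0) (hdφ : fderiv ℝ φ z ≠ 0)
    (htan : ∀ᶠ y in 𝓝[S] z, ∀ ψ : (Fin n → ℂ) → ℂ, DifferentiableAt ℝ ψ y →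
        (∀ᶠ y' in 𝓝[S] y, ψ y' = 0) → ∀ v, IsComplexTangent F y v → fderiv ℝ ψ y v = 0) :
    ∃ c c' : ℂ, c ≠ 0 ∧ ∀ i j p q r s,
      c * leviOp wirt (holCoeff F p q) (antiCoeff F r s) (conjFun F) z =
        c' * leviOp wirt (holCoeff F p q) (antiCoeff F r s) F z ∧
      c * thirdOp wirt (holCoeff F i j) (holCoeff F p q) (antiCoeff F r s) (conjFun F) z =
        c' * thirdOp wirt (holCoeff F i j) (holCoeff F p q) (antiCoeff F r s) F z := by
  set Φ : (Fin n → ℂ) → ℂ := fun x => (φ x : ℂ) with hΦdef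
  have hΦ : SmoothNear Φ z := by
    filter_upwards [hφ] with x hx using Complex.ofRealCLM.contDiff.contDiffAt.comp x hx
  have hΦconj : conjFun Φ = Φ := by
    ext x
    simp [conjFun, hΦdef]
  -- The germs at `z` of the functions vanishing on `S`.
  let I : AddSubgroup (smoothGerms z) :=
    { carrier := {a | ∃ f, ∃ hf : SmoothNear f z, a = toGerm f hf ∧ ∀ᶠ y in 𝓝[S] z, f y = 0}
      zero_mem' := ⟨0, smoothNear_const 0 z, rfl, .of_forall fun _ => rfl⟩
      add_mem' := by
        rintro _ _ ⟨f, hf, rfl, hf'⟩ ⟨g, hg, rfl, hg'⟩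
        refine ⟨f + g, hf.add hg, toGerm_add hf hg, ?_⟩
        filter_upwards [hf', hg'] with y h2 h3
        rw [Pi.add_apply, h2, h3, add_zero]
      neg_mem' := by
        rintro _ ⟨f, hf, rfl, hf'⟩
        refine ⟨-f, ((smoothNear_const 0 z).sub hf).congr (.of_forall fun x => by simp), rfl, ?_⟩
        filter_upwards [hf'] with y h2
        rw [Pi.neg_apply, h2, neg_zero] }
  have hmemI : ∀ f (hf : SmoothNear f z), toGerm f hf ∈ I ↔ ∀ᶠ y in 𝓝[S] z, f y = 0 := by
    intro f hf
    refine ⟨?_, fun h => ⟨f, hf, rfl, h⟩⟩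
    rintro ⟨g, hg, hfg, hg'⟩
    filter_upwards [(toGerm_eq_iff.1 hfg).filter_mono nhdsWithin_le_nhds, hg'] with y h1 h2
    rw [h1, h2]
  have hI : ∀ a ∈ I, evalGerm z a = 0 := by
    intro a ha
    obtain ⟨f, hf, rfl⟩ := exists_toGerm a
    exact ((hmemI f hf).1 ha).self_of_nhdsWithin hzS
  have hsm : ∀ᶠ y in 𝓝[S] z, SmoothNear F y := hF.eventually.filter_mono nhdsWithin_le_nhds
  have hhol : ∀ M : Fin n → smoothGerms z,
      ∑ j, M j * wirtGerm z (Sum.inl j) (toGerm (conjFun F) hF.conjFun) = 0 →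
      ∀ a ∈ I, field (wirtGerm z) (holField M) a ∈ I := by
    intro M hM a ha
    choose m hm hM' using fun j => exists_toGerm (M j)
    obtain rfl : M = fun j => toGerm (m j) (hm j) := funext hM'
    obtain ⟨f, hf, rfl⟩ := exists_toGerm a
    obtain ⟨h1, h2⟩ := fieldOp_toGerm hm hf
    simp only [wirtGerm_toGerm] at hM
    rw [toGerm_sum_mul_eq_zero hm fun j => hF.conjFun.wirt _] at hM
    rw [field_holField, h2, hmemI]
    have hf0 := eventually_eventually_nhdsWithin.2 ((hmemI f hf).1 ha)
    filter_upwards [htan, hf0, hM.filter_mono nhdsWithin_le_nhds, hsm,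
      hf.eventually.filter_mono nhdsWithin_le_nhds] with y h3 h4 h5 h6 h7
    have h8 : IsComplexTangent F y fun j => m j y := by
      rw [isComplexTangent_iff]
      have := congrArg conj h5
      simpa [wirt_conjFun_inl h6] using this
    have h9 := sum_mul_wirt_inl f y fun j => m j y
    rw [h3 f h7.differentiableAt h4 _ h8, h3 f h7.differentiableAt h4 _ h8.I_smul] at h9
    simpa [fieldOp, Finset.sum_apply] using h9
  have hanti : ∀ N : Fin n → smoothGerms z,
      ∑ k, N k * wirtGerm z (Sum.inr k) (toGerm F hF) = 0 →
      ∀ a ∈ I, field (wirtGerm z) (antiField N) a ∈ I := by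
    intro N hN a ha
    choose m hm hN' using fun j => exists_toGerm (N j)
    obtain rfl : N = fun j => toGerm (m j) (hm j) := funext hN'
    obtain ⟨f, hf, rfl⟩ := exists_toGerm a
    simp only [wirtGerm_toGerm] at hN
    rw [toGerm_sum_mul_eq_zero hm fun j => hF.wirt _] at hN
    rw [field_antiField]
    simp only [wirtGerm_toGerm, toGerm_mul]
    rw [toGerm_sum, hmemI]
    have hf0 := eventually_eventually_nhdsWithin.2 ((hmemI f hf).1 ha)
    filter_upwards [htan, hf0, hN.filter_mono nhdsWithin_le_nhds,
      hf.eventually.filter_mono nhdsWithin_le_nhds] with y h3 h4 h5 h7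
    have h8 : IsComplexTangent F y fun j => conj (m j y) := by
      rw [isComplexTangent_iff]
      simpa using h5
    have h9 := sum_mul_wirt_inr f y fun j => conj (m j y)
    rw [h3 f h7.differentiableAt h4 _ h8, h3 f h7.differentiableAt h4 _ h8.I_smul] at h9
    simpa [Finset.sum_apply] using h9
  have hΦI : toGerm Φ hΦ ∈ I := (hmemI Φ hΦ).2 (by
    filter_upwards [hφS] with y hy
    simp [hΦdef, hy])
  -- The fields with the coefficients `holCoeff` annihilate `F̄`.
  have hcoeff : ∀ p q, ∑ j, toGerm (holCoeff F p q j) (hF.holCoeff p q j) *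
        wirtGerm z (Sum.inl j) (toGerm (conjFun F) hF.conjFun) = 0 := by
    intro p q
    simp only [wirtGerm_toGerm]
    refine (toGerm_sum_mul_eq_zero (hF.holCoeff p q) fun j => hF.conjFun.wirt _).2 ?_
    refine .of_forall fun y => ?_
    have h := congrFun (sum_minorVec_mul (fun j => wirt (Sum.inl j) (conjFun F))
      (fun j => wirt (Sum.inl j) (conjFun F)) p q) y
    simp only [Finset.sum_apply, Pi.mul_apply, Pi.sub_apply] at h
    rw [holCoeff, h]
    ring
  have hcoeff' : ∀ p q, ∑ j, toGerm (antiCoeff F p q j) (hF.antiCoeff p q j) *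
        wirtGerm z (Sum.inr j) (toGerm F hF) = 0 := by
    intro p q
    simp only [wirtGerm_toGerm]
    refine (toGerm_sum_mul_eq_zero (hF.antiCoeff p q) fun j => hF.wirt _).2 ?_
    refine .of_forall fun y => ?_
    have h := congrFun (sum_minorVec_mul (fun j => wirt (Sum.inr j) F)
      (fun j => wirt (Sum.inr j) F) p q) y
    simp only [Finset.sum_apply, Pi.mul_apply, Pi.sub_apply] at h
    rw [antiCoeff, h]
    ring
  obtain ⟨p, hp⟩ : ∃ p, wirt (Sum.inl p) (conjFun F) z ≠ 0 := by
    by_contra! hcon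
    obtain ⟨v, hv⟩ := hCR
    refine hv (isComplexTangent_iff.2 (Finset.sum_eq_zero fun j _ => ?_))
    have := hcon j
    rw [wirt_conjFun_inl hF, map_eq_zero] at this
    rw [this, mul_zero]
  have hprop : ∀ q, wirt (Sum.inl p) (conjFun F) z * wirt (Sum.inl q) Φ z =
      wirt (Sum.inl q) (conjFun F) z * wirt (Sum.inl p) Φ z := by
    intro q
    have h1 := hI _ (hhol _ (hcoeff p q) _ hΦI)
    obtain ⟨h2, h3⟩ := fieldOp_toGerm (hF.holCoeff p q) hΦ
    have h4 : evalGerm z (fieldOp (fun i => wirtGerm z i) (fun j => toGerm (holCoeff F p q j)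
      (hF.holCoeff p q j)) (toGerm Φ hΦ)) = 0 := by
      rw [← field_holField]
      exact h1
    rw [show fieldOp (fun i => wirtGerm z i) (fun j => toGerm (holCoeff F p q j)
      (hF.holCoeff p q j)) (toGerm Φ hΦ) = _ from h3,
      evalGerm_toGerm] at h4
    have h5 := congrFun (sum_minorVec_mul (fun j => wirt (Sum.inl j) Φ)
      (fun j => wirt (Sum.inl j) (conjFun F)) p q) z
    have h4 := h5.symm.trans h4
    exact sub_eq_zero.1 h4
  -- `∂φ` vanishes on the complex tangent space, the kernel of `∂F̄`, hence is a multiple of `∂F̄`.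
  set c : ℂ := wirt (Sum.inl p) Φ z / wirt (Sum.inl p) (conjFun F) z with hc
  have hcj : ∀ j, wirt (Sum.inl j) Φ z = c * wirt (Sum.inl j) (conjFun F) z := by
    intro j
    rw [hc, div_mul_eq_mul_div, eq_div_iff hp]
    linear_combination hprop j
  have hcj' : ∀ j, wirt (Sum.inr j) Φ z = conj c * wirt (Sum.inr j) F z := by
    intro j
    have h1 := wirt_conjFun_inl hΦ j
    rw [hΦconj, hcj, wirt_conjFun_inl hF] at h1
    have h2 := congrArg conj h1
    simpa using h2.symm
  have hc0 : c ≠ 0 := by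
    intro h0
    apply hdφ
    ext v
    have h1 : fderiv ℝ Φ z v = 0 := by
      rw [fderiv_eq_sum_wirt]
      simp [hcj, hcj', h0]
    have h2 : HasFDerivAt Φ (Complex.ofRealCLM.comp (fderiv ℝ φ z)) z :=
      Complex.ofRealCLM.hasFDerivAt.comp z hφ.differentiableAt.hasFDerivAt
    rw [h2.fderiv] at h1
    simpa using h1
  refine ⟨c, conj c, hc0, fun i j p q r s => ?_⟩
  have key := proportional_of_tangent (D := wirtGerm z) (fun i j a => wirtGerm_comm i j a) I
    (evalGerm z) hI hΦI hhol hanti (c := c) (c' := conj c)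
    (fun j => by simpa only [wirtGerm_toGerm, evalGerm_toGerm] using hcj j)
    (fun j => by simpa only [wirtGerm_toGerm, evalGerm_toGerm] using hcj' j)
    (hcoeff i j) (hcoeff p q) (hcoeff' r s)
  obtain ⟨_, e1⟩ := leviOp_toGerm (hF.holCoeff p q) (hF.antiCoeff r s) hF.conjFun
  obtain ⟨_, e2⟩ := leviOp_toGerm (hF.holCoeff p q) (hF.antiCoeff r s) hF
  obtain ⟨_, e3⟩ := thirdOp_toGerm (hF.holCoeff i j) (hF.holCoeff p q) (hF.antiCoeff r s) hF.conjFun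
  obtain ⟨_, e4⟩ := thirdOp_toGerm (hF.holCoeff i j) (hF.holCoeff p q) (hF.antiCoeff r s) hF
  rw [e1, e2, e3, e4] at key
  exact key

end pointwise

end nonminimal

/-! ### Linearization at the quadric -/

section linearization

variable {n : ℕ}

lemma SmoothNear.leviOp {a : Fin n → ℂ} {M N : Fin n → (Fin n → ℂ) → ℂ}
    {f : (Fin n → ℂ) → ℂ} (hf : SmoothNear f a) (hM : ∀ j, SmoothNear (M j) a)
    (hN : ∀ j, SmoothNear (N j) a) : SmoothNear (leviOp CRFlat.wirt M N f) a :=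
  (leviOp_toGerm hM hN hf).1

lemma leviOp_sub {a : Fin n → ℂ} {M N : Fin n → (Fin n → ℂ) → ℂ} {f g : (Fin n → ℂ) → ℂ}
    (hf : SmoothNear f a) (hg : SmoothNear g a) :
    leviOp wirt M N (f - g) =ᶠ[𝓝 a] leviOp wirt M N f - leviOp wirt M N g := by
  have h : ∀ i j, ∀ᶠ y in 𝓝 a, wirt i (wirt j (f - g)) y =
      wirt i (wirt j f) y - wirt i (wirt j g) y := fun i j =>
    ((wirt_congr (wirt_sub hf hg j) i).trans (wirt_sub (hf.wirt j) (hg.wirt j) i))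
  filter_upwards [eventually_all.2 fun i => eventually_all.2 (h i)] with y hy
  simp only [CRFlat.leviOp, Finset.sum_apply, Pi.mul_apply, Pi.sub_apply, hy, sub_mul,
    Finset.sum_sub_distrib]

lemma thirdOp_sub {a : Fin n → ℂ} {L M N : Fin n → (Fin n → ℂ) → ℂ} {f g : (Fin n → ℂ) → ℂ}
    (hM : ∀ j, SmoothNear (M j) a) (hN : ∀ j, SmoothNear (N j) a)
    (hf : SmoothNear f a) (hg : SmoothNear g a) :
    thirdOp wirt L M N (f - g) =ᶠ[𝓝 a] thirdOp wirt L M N f - thirdOp wirt L M N g := by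
  have h : ∀ i j, ∀ᶠ y in 𝓝 a, wirt i (wirt j (f - g)) y =
      wirt i (wirt j f) y - wirt i (wirt j g) y := fun i j =>
    ((wirt_congr (wirt_sub hf hg j) i).trans (wirt_sub (hf.wirt j) (hg.wirt j) i))
  have h' : ∀ i, ∀ᶠ y in 𝓝 a, wirt i (leviOp wirt M N (f - g)) y =
      wirt i (leviOp wirt M N f) y - wirt i (leviOp wirt M N g) y := fun i =>
    ((wirt_congr (leviOp_sub hf hg) i).trans (wirt_sub (hf.leviOp hM hN) (hg.leviOp hM hN) i))
  filter_upwards [eventually_all.2 fun i => eventually_all.2 (h i), eventually_all.2 h']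
    with y hy hy'
  simp only [thirdOp, fieldOp, Finset.sum_apply, Pi.mul_apply, Pi.sub_apply, Pi.add_apply, hy, hy',
    sub_mul, mul_sub, Finset.sum_sub_distrib]
  ring

/-- At non-CR points the operators vanish, so that the proportionality holds near the origin. -/
lemma NonMinimalGraph.eventually_eq {F : (Fin n → ℂ) → ℂ} (h : NonMinimalGraph F)
    (hF : SmoothNear F 0) : ∀ᶠ z in 𝓝 (0 : Fin n → ℂ), ∀ i j p q r s p' q' r' s',
      leviOp wirt (holCoeff F p q) (antiCoeff F r s) F z *
          leviOp wirt (holCoeff F p' q') (antiCoeff F r' s') (conjFun F) z =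
        leviOp wirt (holCoeff F p' q') (antiCoeff F r' s') F z *
          leviOp wirt (holCoeff F p q) (antiCoeff F r s) (conjFun F) z ∧
      leviOp wirt (holCoeff F p q) (antiCoeff F r s) F z *
          thirdOp wirt (holCoeff F i j) (holCoeff F p' q') (antiCoeff F r' s') (conjFun F) z =
        thirdOp wirt (holCoeff F i j) (holCoeff F p' q') (antiCoeff F r' s') F z *
          leviOp wirt (holCoeff F p q) (antiCoeff F r s) (conjFun F) z := by
  filter_upwards [h, hF.eventually] with z hz hFz i j p q r s p' q' r' s'
  by_cases hCR : ∃ v, ¬ IsComplexTangent F z v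
  · obtain ⟨S, φ, hzS, hφ, hφS, hdφ, htan⟩ := hz hCR
    obtain ⟨c, c', hc, hcc⟩ := exists_proportional hFz hCR hzS hφ hφS hdφ htan
    have h1 := (hcc i j p q r s).1
    obtain ⟨h2, h3⟩ := hcc i j p' q' r' s'
    constructor <;> refine mul_left_cancel₀ hc ?_
    · linear_combination leviOp wirt (holCoeff F p q) (antiCoeff F r s) F z * h2 -
        leviOp wirt (holCoeff F p' q') (antiCoeff F r' s') F z * h1
    · linear_combination leviOp wirt (holCoeff F p q) (antiCoeff F r s) F z * h3 -
        thirdOp wirt (holCoeff F i j) (holCoeff F p' q') (antiCoeff F r' s') F z * h1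
  · push Not at hCR
    have h0 := antiCoeff_eq_zero hCR
    simp [leviOp_eq_zero (h0 _ _)]

variable {k : ℕ} {f : (Fin n → ℂ) → ℂ} {e : Poly n}
  {L M N : Fin n → (Fin n → ℂ) → ℂ} {l μ ν : Fin n → Poly n}

lemma HasLead.minorVec {v : Fin n → (Fin n → ℂ) → ℂ} (h : ∀ j, HasLead 1 (v j) (μ j))
    (p q j : Fin n) : HasLead 1 (minorVec v p q j) (minorVec μ p q j) := by
  refine HasLead.sub ?_ ?_
  · split_ifs
    exacts [h p, hasLead_zero_of_flatTo flatTo_zero]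
  · split_ifs
    exacts [h q, hasLead_zero_of_flatTo flatTo_zero]

lemma HasLead.fieldOp (hf : HasLead (k + 1) f e) (hM : ∀ j, HasLead 1 (M j) (μ j)) :
    HasLead (k + 1) (fieldOp CRFlat.wirt M f) (fieldOp (fun i => pderiv i) μ e) := by
  refine HasLead.sum fun j _ => ?_
  have h := (hM j).mul (hf.wirt (Sum.inl j))
  rwa [add_comm 1 k] at h

lemma HasLead.leviOp (hf : HasLead (k + 2) f e) (hM : ∀ j, HasLead 1 (M j) (μ j))
    (hN : ∀ j, HasLead 1 (N j) (ν j)) :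
    HasLead (k + 2) (leviOp CRFlat.wirt M N f) (leviOp (fun i => pderiv i) μ ν e) :=
  HasLead.sum fun j _ => HasLead.sum fun i _ =>
    (((hf.wirt (Sum.inl j)).wirt (Sum.inr i)).mul (hM j)).mul (hN i)

lemma HasLead.thirdOp (hf : HasLead (k + 2) f e) (hL : ∀ j, HasLead 1 (L j) (l j))
    (hM : ∀ j, HasLead 1 (M j) (μ j)) (hN : ∀ j, HasLead 1 (N j) (ν j)) :
    HasLead (k + 2) (thirdOp CRFlat.wirt L M N f) (thirdOp (fun i => pderiv i) l μ ν e) :=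
  ((hf.leviOp hM hN).fieldOp hL).add <| HasLead.sum fun j _ => HasLead.sum fun i _ =>
    (((hf.wirt (Sum.inl j)).wirt (Sum.inr i)).mul (hL j)).mul ((hN i).fieldOp hM)

lemma LinearizedNonMinimal.C_mul {lam : Fin n → ℝ} (h : LinearizedNonMinimal lam e) (c : ℂ) :
    LinearizedNonMinimal lam (C c * e) := by
  have h1 : ∀ μ ν : Fin n → Poly n, CRFlat.leviOp (fun i => pderiv i) μ ν (C c * e) =
      C c * CRFlat.leviOp (fun i => pderiv i) μ ν e := fun μ ν => by
    simp only [CRFlat.leviOp, pderiv_C_mul, Finset.mul_sum, mul_assoc]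
  have h2 : ∀ l μ ν : Fin n → Poly n, CRFlat.thirdOp (fun i => pderiv i) l μ ν (C c * e) =
      C c * CRFlat.thirdOp (fun i => pderiv i) l μ ν e := fun l μ ν => by
    simp only [CRFlat.thirdOp, h1, CRFlat.fieldOp, pderiv_C_mul, mul_add, Finset.mul_sum, mul_assoc,
      mul_left_comm (C c)]
  refine ⟨fun p q r s p' q' r' s' => ?_, fun p q r s i j p' q' r' s' => ?_⟩
  · rw [h1, h1]
    linear_combination C c * h.1 p q r s p' q' r' s'
  · rw [h1, h2]
    linear_combination C c * h.2 p q r s i j p' q' r' s'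

lemma conjHom_quadPoly (lam : Fin n → ℝ) : conjHom n (quadPoly lam) = quadPoly lam := by
  simp only [quadPoly, conjHom_apply, map_sum, map_add, map_mul, map_pow, map_X, map_C, swapHom,
    rename_X, rename_C, Sum.swap_inl, Sum.swap_inr, Complex.conj_ofReal]
  exact Finset.sum_congr rfl fun i _ => by ring

/-- The leading part of the imaginary part of a non-minimal graph solves the linearized
equations. -/
theorem NonMinimalGraph.linearized {F : (Fin n → ℂ) → ℂ} {lam : Fin n → ℝ}
    (h : NonMinimalGraph F) (hF : HasLead 2 F (quadPoly lam))
    (he : HasLead (k + 2) (fun z => ((F z).im : ℂ)) e) : LinearizedNonMinimal lam e := by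
  set g := conjFun F - F with hg
  have hge : HasLead (k + 2) g (C (-2 * Complex.I) * e) := by
    refine (he.const_mul (-2 * Complex.I)).congr (.of_eq ?_)
    ext x
    apply Complex.ext <;> simp [hg, CRFlat.conjFun]
    ring
  have hsF := hF.smoothNear
  have hsc := hsF.conjFun
  have hcF := hF.conjFun
  rw [conjHom_quadPoly] at hcF
  have hM : ∀ p q j, HasLead 1 (holCoeff F p q j) (CRFlat.minorVec (linA lam) p q j) := fun p q j =>
    HasLead.minorVec (fun j => by simpa using hcF.wirt (Sum.inl j)) p q j
  have hN : ∀ p q j, HasLead 1 (antiCoeff F p q j) (CRFlat.minorVec (linB lam) p q j) :=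
    fun p q j => HasLead.minorVec (fun j => by simpa using hF.wirt (Sum.inr j)) p q j
  have hF' : HasLead (0 + 2) F (quadPoly lam) := hF
  have hmain : LinearizedNonMinimal lam (C (-2 * Complex.I) * e) := by
    refine ⟨fun p q r s p' q' r' s' => ?_, fun p q r s i j p' q' r' s' => ?_⟩
    · refine ((hF'.leviOp (hM p q) (hN r s)).mul (hge.leviOp (hM p' q') (hN r' s'))).unique
        ((hF'.leviOp (hM p' q') (hN r' s')).mul (hge.leviOp (hM p q) (hN r s))) ?_
      filter_upwards [h.eventually_eq hsF, leviOp_sub (M := holCoeff F p q)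
        (N := antiCoeff F r s) hsc hsF, leviOp_sub (M := holCoeff F p' q')
        (N := antiCoeff F r' s') hsc hsF] with z hz h1 h2
      simp only [Pi.mul_apply, hg, h1, h2, Pi.sub_apply]
      linear_combination (hz p p p q r s p' q' r' s').1
    · refine ((hF'.leviOp (hM p q) (hN r s)).mul (hge.thirdOp (hM i j) (hM p' q')
        (hN r' s'))).unique ((hF'.thirdOp (hM i j) (hM p' q') (hN r' s')).mul
          (hge.leviOp (hM p q) (hN r s))) ?_
      filter_upwards [h.eventually_eq hsF, leviOp_sub (M := holCoeff F p q)
        (N := antiCoeff F r s) hsc hsF, thirdOp_sub (L := holCoeff F i j)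
        (fun j => (hM p' q' j).smoothNear) (fun j => (hN r' s' j).smoothNear) hsc hsF]
        with z hz h1 h2
      simp only [Pi.mul_apply, hg, h1, h2, Pi.sub_apply]
      linear_combination (hz i j p q r s p' q' r' s').2
  have hfin := hmain.C_mul (Complex.I / 2)
  rw [← mul_assoc, ← C_mul] at hfin
  have hc : Complex.I / 2 * (-2 * Complex.I) = 1 := by
    linear_combination -Complex.I_mul_I
  rwa [hc, C_1, one_mul] at hfin

end linearization

/-! ### Normalization of the imaginary part, order by order -/

section normalization

variable {n : ℕ}

/-- The polynomial function on `ℂⁿ⁺¹` given by a polynomial in `w` (index `none`) and `z`. -/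
noncomputable def evalZW (b : MvPolynomial (Option (Fin n)) ℂ) (x : Cn1 n) : ℂ :=
  eval (fun o : Option (Fin n) => o.elim x.2 x.1) b

lemma contDiff_evalZW (b : MvPolynomial (Option (Fin n)) ℂ) : ContDiff ℂ ∞ (evalZW b) := by
  unfold evalZW
  induction b using MvPolynomial.induction_on with
  | C a => simpa using contDiff_const (c := a)
  | add p q hp hq => simpa using hp.add hq
  | mul_X p o hp =>
    simp only [map_mul, eval_X]
    refine hp.mul ?_
    rcases o with _ | i
    · exact contDiff_snd
    · exact (contDiff_apply ℂ ℂ i).comp contDiff_fst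

variable {f g : (Fin n → ℂ) → ℂ} {k l : ℕ} {p q : Poly n}

lemma hasLead_one : HasLead 0 (1 : (Fin n → ℂ) → ℂ) 1 :=
  (hasLead_evalFun (isHomogeneous_one _ _)).congr (.of_eq (by ext; simp [evalFun]))

lemma HasLead.pow (hf : HasLead k f p) (d : ℕ) : HasLead (d * k) (f ^ d) (p ^ d) := by
  induction d with
  | zero => simpa using hasLead_one
  | succ d ih =>
    rw [pow_succ, pow_succ, Nat.succ_mul]
    exact ih.mul hf

lemma HasLead.prod {ι : Type*} {s : Finset ι} {F : ι → (Fin n → ℂ) → ℂ} {P : ι → Poly n}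
    {d : ι → ℕ} (h : ∀ i ∈ s, HasLead (d i) (F i) (P i)) :
    HasLead (∑ i ∈ s, d i) (∏ i ∈ s, F i) (∏ i ∈ s, P i) := by
  classical
  induction s using Finset.induction_on with
  | empty => exact hasLead_one
  | insert i s hi ih =>
    rw [Finset.sum_insert hi, Finset.prod_insert hi, Finset.prod_insert hi]
    exact (h i (Finset.mem_insert_self i s)).mul
      (ih fun j hj => h j (Finset.mem_insert_of_mem hj))

lemma evalZW_eq_sum (b : MvPolynomial (Option (Fin n)) ℂ) (x : Cn1 n) :
    evalZW b x = ∑ d ∈ b.support, coeff d b * ∏ o ∈ d.support, (o.elim x.2 x.1) ^ d o :=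
  eval_eq _ _

lemma weightZW_eq_sum (d : Option (Fin n) →₀ ℕ) :
    Finsupp.weight weightZW d = ∑ o ∈ d.support, d o * weightZW o := by
  simp [Finsupp.weight_apply, Finsupp.sum]

/-- The leading part along the graph of `F` of a weighted homogeneous polynomial. -/
lemma hasLead_evalZW {F : (Fin n → ℂ) → ℂ} {lam : Fin n → ℝ} (hF : HasLead 2 F (quadPoly lam))
    {b : MvPolynomial (Option (Fin n)) ℂ} (hb : b.IsWeightedHomogeneous weightZW k) :
    HasLead k (fun z => evalZW b (z, F z)) (substQ lam b) := by
  have h1 : ∀ o : Option (Fin n), HasLead (weightZW o) (fun z => o.elim (F z) z)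
      (o.elim (quadPoly lam) fun i => X (Sum.inl i)) := by
    rintro (_ | i)
    · exact hF
    · exact (hasLead_evalFun (isHomogeneous_X _ (Sum.inl i))).congr
        (.of_eq (by ext; simp [evalFun]))
  have h2 : HasLead k (∑ d ∈ b.support, fun z => coeff d b *
      (∏ o ∈ d.support, (fun z => o.elim (F z) z) ^ d o : (Fin n → ℂ) → ℂ) z)
      (∑ d ∈ b.support, C (coeff d b) *
        ∏ o ∈ d.support, (o.elim (quadPoly lam) fun i => X (Sum.inl i)) ^ d o) := by
    refine HasLead.sum fun d hd => HasLead.const_mul ?_ _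
    rw [← hb (mem_support_iff.1 hd), weightZW_eq_sum]
    exact HasLead.prod fun o _ => (h1 o).pow (d o)
  have h3 : substQ lam b = ∑ d ∈ b.support, C (coeff d b) *
      ∏ o ∈ d.support, (o.elim (quadPoly lam) fun i => X (Sum.inl i)) ^ d o := by
    rw [substQ, aeval_eq_eval₂Hom, coe_eval₂Hom, eval₂_eq, algebraMap_eq]
  rw [h3]
  refine h2.congr (.of_eq ?_)
  ext z
  simp [evalZW_eq_sum, Finset.sum_apply, Finset.prod_apply]

lemma tendsto_gauge : Tendsto (fun x : Cn1 n => ‖x.1‖ ^ 2 + ‖x.2‖) (𝓝 0) (𝓝 0) := by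
  have h : Continuous fun x : Cn1 n => ‖x.1‖ ^ 2 + ‖x.2‖ := by fun_prop
  simpa using h.tendsto 0

/-- A monomial of weight `j` is bounded by the `j`-th power of `(‖z‖² + ‖w‖)^{1/2}`. -/
lemma evalZW_isLittleO {b : MvPolynomial (Option (Fin n)) ℂ}
    (hb : b.IsWeightedHomogeneous weightZW (k + 3)) :
    evalZW b =o[𝓝 0] fun x : Cn1 n => ‖x.1‖ ^ 2 + ‖x.2‖ := by
  set ρ : Cn1 n → ℝ := fun x => √(‖x.1‖ ^ 2 + ‖x.2‖) with hρ
  have hsq : ∀ x, ρ x ^ 2 = ‖x.1‖ ^ 2 + ‖x.2‖ := fun x => Real.sq_sqrt (by positivity)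
  have hρ0 : Tendsto ρ (𝓝 0) (𝓝 0) := by
    have := (Real.continuous_sqrt.tendsto 0).comp (tendsto_gauge (n := n))
    simpa [hρ, Function.comp_def] using this
  have hO : evalZW b =O[𝓝 0] fun x => ρ x ^ (k + 3) := by
    have h1 : ∀ d ∈ b.support, (fun x : Cn1 n => coeff d b *
        ∏ o ∈ d.support, (o.elim x.2 x.1) ^ d o) =O[𝓝 0] fun x => ρ x ^ (k + 3) := by
      intro d hd
      refine IsBigO.const_mul_left (IsBigO.of_bound 1 (.of_forall fun x => ?_)) _
      have hnn : 0 ≤ ρ x := Real.sqrt_nonneg _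
      rw [← hb (mem_support_iff.1 hd), weightZW_eq_sum, ← Finset.prod_pow_eq_pow_sum, norm_prod,
        one_mul, norm_prod]
      refine Finset.prod_le_prod (fun _ _ => norm_nonneg _) fun o _ => ?_
      rw [norm_pow, norm_pow, Real.norm_of_nonneg hnn, mul_comm, pow_mul]
      refine pow_le_pow_left₀ (norm_nonneg _) ?_ _
      rcases o with _ | i
      · change ‖x.2‖ ≤ ρ x ^ 2
        rw [hsq]
        nlinarith [norm_nonneg x.1]
      · change ‖x.1 i‖ ≤ ρ x ^ 1
        rw [pow_one]
        refine (norm_le_pi_norm x.1 i).trans (Real.le_sqrt_of_sq_le ?_)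
        linarith [norm_nonneg x.2]
    exact (IsBigO.fun_sum h1).congr_left fun x => (evalZW_eq_sum b x).symm
  refine hO.trans_isLittleO ?_
  have h2 := (isLittleO_pow_pow (𝕜 := ℝ) (by omega : 2 < k + 3)).comp_tendsto hρ0
  exact h2.congr_right hsq

lemma hasFDerivAt_zero_of_isLittleO {B : Cn1 n → ℂ}
    (h : B =o[𝓝 0] fun x : Cn1 n => ‖x.1‖ ^ 2 + ‖x.2‖) : HasFDerivAt B (0 : Cn1 n →L[ℂ] ℂ) 0 := by
  have h0 : B 0 = 0 := by
    have h1 := h.def one_pos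
    simpa using h1.self_of_nhds
  rw [hasFDerivAt_iff_isLittleO_nhds_zero]
  simp only [zero_add, h0, sub_zero, zero_apply]
  refine h.trans_isBigO (IsBigO.of_bound 2 ?_)
  filter_upwards [Metric.ball_mem_nhds (0 : Cn1 n) one_pos] with x hx
  rw [mem_ball_zero_iff] at hx
  have h1 := norm_fst_le x
  have h2 := norm_snd_le x
  rw [Real.norm_of_nonneg (by positivity)]
  nlinarith [norm_nonneg x.1]

/-- A shear in the variable `w` does not change the complex tangent spaces of a graph, nor,
therefore, non-minimality. -/
lemma NonMinimalGraph.shear {F : (Fin n → ℂ) → ℂ} (h : NonMinimalGraph F) (hF : SmoothNear F 0)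
    (hF0 : F 0 = 0) {B : Cn1 n → ℂ} (hB : ContDiff ℂ ∞ B)
    (hBo : B =o[𝓝 0] fun x : Cn1 n => ‖x.1‖ ^ 2 + ‖x.2‖) :
    NonMinimalGraph fun z => F z + B (z, F z) := by
  have hd : Tendsto (fun z => 1 + fderiv ℂ B (z, F z) (0, 1)) (𝓝 0) (𝓝 1) := by
    have h1 : ContinuousAt (fun z => (z, F z)) 0 :=
      continuousAt_id.prodMk hF.contDiffAt.continuousAt
    have h2 : Continuous fun x => 1 + fderiv ℂ B x (0, 1) :=
      continuous_const.add ((hB.continuous_fderiv (by simp)).clm_apply continuous_const)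
    have h3 := (h2.continuousAt (x := (0, F 0))).comp_of_eq h1 rfl
    have h4 : fderiv ℂ B (0, F 0) = 0 := by
      rw [hF0]
      exact (hasFDerivAt_zero_of_isLittleO hBo).fderiv
    have h5 := h3.tendsto
    simpa [Function.comp_def, h4] using h5
  have hiff : ∀ᶠ z in 𝓝 (0 : Fin n → ℂ), ∀ v,
      IsComplexTangent (fun z => F z + B (z, F z)) z v ↔ IsComplexTangent F z v := by
    filter_upwards [hd.eventually_ne one_ne_zero, hF.eventually] with z hz hFz v
    have hd1 := hFz.differentiableAt.hasFDerivAt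
    have hd2 : HasFDerivAt B ((fderiv ℂ B (z, F z)).restrictScalars ℝ) (z, F z) :=
      ((hB.differentiable (by simp)) _).hasFDerivAt.restrictScalars ℝ
    have hd3 := hd1.add (hd2.comp z ((hasFDerivAt_id z).prodMk hd1))
    have hd4 : fderiv ℝ (fun z => F z + B (z, F z)) z = _ := hd3.fderiv
    have key : ∀ u, fderiv ℝ (fun z => F z + B (z, F z)) z u =
        fderiv ℝ F z u + fderiv ℂ B (z, F z) (u, fderiv ℝ F z u) := fun u => by
      rw [hd4]
      rfl
    rw [IsComplexTangent, IsComplexTangent, key, key, ← sub_eq_zero,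
      ← sub_eq_zero (a := fderiv ℝ F z (Complex.I • v))]
    have h6 : fderiv ℂ B (z, F z) (Complex.I • v, fderiv ℝ F z (Complex.I • v)) -
        Complex.I * fderiv ℂ B (z, F z) (v, fderiv ℝ F z v) =
        (fderiv ℝ F z (Complex.I • v) - Complex.I * fderiv ℝ F z v) *
          fderiv ℂ B (z, F z) (0, 1) := by
      rw [← smul_eq_mul, ← map_smul, ← map_sub, ← smul_eq_mul, ← map_smul]
      congr 1
      ext <;> simp
    rw [← mul_eq_zero_iff_left hz (b := fderiv ℝ F z (Complex.I • v) - _)]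
    refine Eq.congr ?_ rfl
    linear_combination h6
  filter_upwards [h, hiff.eventually_nhds] with z hz hiffz hCR
  obtain ⟨S, φ, hzS, hφ, hφS, hdφ, htan⟩ := hz (by
    obtain ⟨v, hv⟩ := hCR
    exact ⟨v, fun h' => hv ((hiffz.self_of_nhds v).2 h')⟩)
  refine ⟨S, φ, hzS, hφ, hφS, hdφ, ?_⟩
  filter_upwards [htan, hiffz.filter_mono nhdsWithin_le_nhds] with y hy hy' ψ hψ hψ0 v hv
  exact hy ψ hψ hψ0 v ((hy' v).1 hv)

lemma im_eq (w : ℂ) : (w.im : ℂ) = Complex.I / 2 * (conj w - w) := by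
  apply Complex.ext <;> simp
  ring

lemma HasLead.im (hf : HasLead k f p) :
    HasLead k (fun z => ((f z).im : ℂ)) (C (Complex.I / 2) * (conjHom n p - p)) :=
  ((hf.conjFun.sub hf).const_mul _).congr (.of_eq (by
    ext z
    exact im_eq (f z)))

/-- Flattening to order `m`: each step solves the linearized equations for the leading part of the
imaginary part, and removes this part by adding a holomorphic polynomial in `z` and `w`. -/
theorem NonMinimalGraph.exists_flattening (hn : 2 ≤ n) {lam : Fin n → ℝ} (h0 : ∀ i, 0 ≤ lam i)
    (hlam : ∃ i, lam i ≠ 1 / 2) {F : (Fin n → ℂ) → ℂ} (h : NonMinimalGraph F)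
    (hF : HasLead 2 F (quadPoly lam)) (m : ℕ) :
    ∃ B : Cn1 n → ℂ, ContDiff ℂ ∞ B ∧ (B =o[𝓝 0] fun x : Cn1 n => ‖x.1‖ ^ 2 + ‖x.2‖) ∧
      HasLead 2 (fun z => F z + B (z, F z)) (quadPoly lam) ∧
      FlatTo (m + 3) (fun z => ((F z + B (z, F z)).im : ℂ)) := by
  induction m with
  | zero =>
    refine ⟨0, contDiff_const, isLittleO_zero _ _, ?_, ?_⟩
    · simpa using hF
    · have := hF.im
      rw [conjHom_quadPoly, sub_self, mul_zero] at this
      simpa using this.flatTo_succ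
  | succ m ih =>
    obtain ⟨B, hB, hBo, hG, hflat⟩ := ih
    set G : (Fin n → ℂ) → ℂ := fun z => F z + B (z, F z) with hGdef
    have hNM : NonMinimalGraph G := h.shear hF.smoothNear hF.flatTo.2.1 hB hBo
    obtain ⟨e, he⟩ := hflat.exists_hasLead
    have he' : HasLead (m + 1 + 2) (fun z => ((G z).im : ℂ)) e := he
    have hconj : conjHom n e = e := he'.conjFun.unique he' (.of_eq (by
      ext z
      exact Complex.conj_ofReal _))
    obtain ⟨b, hb, heb⟩ :=
      (hNM.linearized hG he').exists_substQ_add_conj hn h0 he'.1 hconj hlam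
    have hb3 : b.IsWeightedHomogeneous weightZW (m + 3) := hb
    have hlead := (hasLead_evalZW hG hb3).const_mul (-2 * Complex.I)
    have hT : Tendsto (fun x : Cn1 n => (x.1, x.2 + B x)) (𝓝 0) (𝓝 0) := by
      have hc : Continuous fun x : Cn1 n => (x.1, x.2 + B x) :=
        continuous_fst.prodMk (continuous_snd.add hB.continuous)
      have hB0 : B 0 = 0 := by simpa using (hBo.def one_pos).self_of_nhds
      have := hc.tendsto 0
      simp only [Prod.fst_zero, Prod.snd_zero, hB0, add_zero] at this
      exact this
    -- Along the graph, `Im (-2i b)` has the leading part `-(b + b̄) = -e`.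
    refine ⟨fun x => B x + -2 * Complex.I * evalZW b (x.1, x.2 + B x), ?_, ?_, ?_, ?_⟩
    · exact hB.add (contDiff_const.mul ((contDiff_evalZW b).comp
        (contDiff_fst.prodMk (contDiff_snd.add hB))))
    · refine hBo.add (IsLittleO.const_mul_left ?_ _)
      refine ((evalZW_isLittleO hb3).comp_tendsto hT).trans_isBigO ?_
      have h1 : (fun x : Cn1 n => ‖x.1‖ ^ 2 + ‖x.2‖ + ‖B x‖) =O[𝓝 0]
          fun x : Cn1 n => ‖x.1‖ ^ 2 + ‖x.2‖ := (isBigO_refl _ _).add hBo.isBigO.norm_left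
      refine IsBigO.trans (IsBigO.of_bound 1 (.of_forall fun x => ?_)) h1
      have h2 := norm_add_le x.2 (B x)
      simp only [Function.comp_apply]
      rw [Real.norm_of_nonneg (by positivity), Real.norm_of_nonneg (by positivity)]
      linarith
    · have hl := hlead.flatTo
      have h2 : HasLead 2 (fun z => -2 * Complex.I * evalZW b (z, G z)) 0 :=
        hasLead_zero_of_flatTo (hl.mono (by omega))
      have h3 := hG.add h2
      rw [add_zero] at h3
      refine h3.congr (.of_eq ?_)
      ext z
      simp only [hGdef, Pi.add_apply]
      ring
    · have h1 := he.add hlead.im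
      have h2 : e + C (Complex.I / 2) * (conjHom n (C (-2 * Complex.I) * substQ lam b) -
          C (-2 * Complex.I) * substQ lam b) = 0 := by
        have hc : (C (Complex.I / 2) : Poly n) * C (2 * Complex.I) = -1 := by
          rw [← C_mul, show Complex.I / 2 * (2 * Complex.I) = -1 by
            linear_combination Complex.I_mul_I, C_neg, C_1]
        have hc1 : conjHom n (C (-2 * Complex.I)) = C (2 * Complex.I) := by
          simp [conjHom_apply, swapHom, map_ofNat (starRingEnd ℂ) 2]
        have hc2 : (C (-2 * Complex.I) : Poly n) = -C (2 * Complex.I) := by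
          rw [← C_neg, neg_mul]
        rw [map_mul, hc1, hc2]
        nth_rewrite 1 [heb]
        linear_combination (conjHom n (substQ lam b) + substQ lam b) * hc
      rw [h2] at h1
      refine h1.flatTo_succ.congr (.of_eq ?_)
      ext z
      simp only [hGdef, Pi.add_apply, ← Complex.ofReal_add, ← Complex.add_im]
      ring_nf

end normalization

/-! ### Holomorphic maps of several variables are smooth -/

section holomorphic

variable {E F : Type*} [NormedAddCommGroup E] [NormedSpace ℂ E] [FiniteDimensional ℂ E]
  [NormedAddCommGroup F] [NormedSpace ℂ F] [FiniteDimensional ℂ F]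

/-- A directional derivative of a holomorphic map is holomorphic: differentiate Cauchy's integral
formula on a disc in this direction with respect to the centre. -/
lemma differentiableOn_fderiv_apply {f : E → F} {U : Set E} (hU : IsOpen U)
    (hf : DifferentiableOn ℂ f U) (v : E) : DifferentiableOn ℂ (fun x => fderiv ℂ f x v) U := by
  have : ProperSpace E := FiniteDimensional.proper ℂ E
  have : CompleteSpace F := FiniteDimensional.complete ℂ F
  let : MeasurableSpace E := borel E
  have : BorelSpace E := ⟨rfl⟩
  intro x₀ hx₀
  refine DifferentiableAt.differentiableWithinAt ?_
  obtain ⟨ε, hε, hεU⟩ := Metric.nhds_basis_closedBall.mem_iff.1 (hU.mem_nhds hx₀)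
  -- Discs of radius `r` in the direction `v` centred in the ball of radius `R` about `x₀` stay in
  -- the ball of radius `2R`; there the derivative of `f` is bounded since `f` is, on radius `3R`.
  set R := ε / 3 with hR
  have hR0 : 0 < R := by positivity
  obtain ⟨C, hC⟩ := (isCompact_closedBall x₀ ε).exists_bound_of_continuousOn
    (hf.continuousOn.mono hεU)
  set r := R / (‖v‖ + 1) with hr
  have hr0 : 0 < r := by positivity
  have hrv : r * ‖v‖ ≤ R := by
    rw [hr, div_mul_eq_mul_div, div_le_iff₀ (by positivity)]
    nlinarith [norm_nonneg v]
  have hmem : ∀ x ∈ Metric.ball x₀ R, ∀ ζ ∈ Metric.closedBall (0 : ℂ) r,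
      x + ζ • v ∈ Metric.ball x₀ (2 * R) := by
    intro x hx ζ hζ
    rw [mem_ball_iff_norm] at hx ⊢
    rw [mem_closedBall_zero_iff] at hζ
    calc ‖x + ζ • v - x₀‖ = ‖(x - x₀) + ζ • v‖ := by congr 1; abel
      _ ≤ ‖x - x₀‖ + ‖ζ‖ * ‖v‖ := (norm_add_le _ _).trans (by rw [norm_smul])
      _ < 2 * R := by nlinarith [norm_nonneg v]
  have hsub : Metric.ball x₀ (2 * R) ⊆ U := fun y hy =>
    hεU (Metric.ball_subset_closedBall (Metric.ball_subset_ball (by linarith) hy))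
  have hcirc : ∀ θ, circleMap 0 r θ ∈ Metric.closedBall (0 : ℂ) r := fun θ =>
    Metric.sphere_subset_closedBall (circleMap_mem_sphere 0 hr0.le θ)
  set c : ℝ → ℂ := fun θ => deriv (circleMap 0 r) θ * (1 / (circleMap 0 r θ - 0) ^ 2) with hc
  have hcc : Continuous c := by
    simp only [hc, deriv_circleMap, sub_zero]
    refine ((continuous_circleMap 0 r).mul continuous_const).mul
      (continuous_const.div ((continuous_circleMap 0 r).pow 2) fun θ => ?_)
    exact pow_ne_zero 2 (circleMap_ne_center hr0.ne')
  have hline : ∀ x, Continuous fun θ : ℝ => x + circleMap 0 r θ • v := fun x =>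
    continuous_const.add ((continuous_circleMap 0 r).smul continuous_const)
  have hcont : ∀ x ∈ Metric.ball x₀ R, Continuous fun θ => c θ • f (x + circleMap 0 r θ • v) :=
    fun x hx => hcc.smul (hf.continuousOn.comp_continuous (hline x)
      fun θ => hsub (hmem x hx _ (hcirc θ)))
  have hcauchy : ∀ x ∈ Metric.ball x₀ R, (2 * Real.pi * Complex.I : ℂ) • fderiv ℂ f x v =
      ∫ θ in (0)..(2 * Real.pi), c θ • f (x + circleMap 0 r θ • v) := by
    intro x hx
    have hlin : ∀ ζ : ℂ, HasDerivAt (fun ζ : ℂ => x + ζ • v) v ζ := fun ζ => by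
      simpa using ((hasDerivAt_id ζ).smul_const v).const_add x
    have hd : ∀ ζ ∈ Metric.closedBall (0 : ℂ) r, HasDerivAt (fun ζ : ℂ => f (x + ζ • v))
        (fderiv ℂ f (x + ζ • v) v) ζ := fun ζ hζ =>
      ((hf.differentiableAt (hU.mem_nhds (hsub (hmem x hx ζ hζ)))).hasFDerivAt).comp_hasDerivAt ζ
        (hlin ζ)
    have h1 := DifferentiableOn.deriv_eq_smul_circleIntegral (f := fun ζ : ℂ => f (x + ζ • v))
      (c := 0) hr0 fun ζ hζ => (hd ζ hζ).differentiableAt.differentiableWithinAt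
    rw [(hd 0 (Metric.mem_closedBall_self hr0.le)).deriv, zero_smul, add_zero] at h1
    rw [← h1, circleIntegral]
    simp only [hc, mul_smul]
  have hbound : ∀ x ∈ Metric.ball x₀ R, ∀ θ, ‖c θ • fderiv ℂ f (x + circleMap 0 r θ • v)‖ ≤
      ‖c θ‖ * (2 * C / R) := by
    intro x hx θ
    rw [norm_smul]
    refine mul_le_mul_of_nonneg_left ?_ (norm_nonneg _)
    set p := x + circleMap 0 r θ • v with hp
    have hpb : p ∈ Metric.ball x₀ (2 * R) := hmem x hx _ (hcirc θ)
    have hball : Metric.ball p R ⊆ Metric.closedBall x₀ ε := fun y hy => by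
      rw [Metric.mem_closedBall]
      rw [Metric.mem_ball] at hy hpb
      linarith [dist_triangle y p x₀]
    refine Complex.norm_fderiv_le_div_of_mapsTo_ball (hf.mono (hball.trans hεU)) ?_ hR0
    intro y hy
    rw [mem_closedBall_iff_norm]
    have h1 := hC y (hball hy)
    have h2 := hC p (hball (Metric.mem_ball_self hR0))
    linarith [norm_sub_le (f y) (f p)]
  have hmain := intervalIntegral.hasFDerivAt_integral_of_dominated_of_fderiv_le (𝕜 := ℂ)
    (μ := MeasureTheory.volume) (a := 0) (b := 2 * Real.pi) (x₀ := x₀)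
    (s := Metric.ball x₀ R) (F := fun x θ => c θ • f (x + circleMap 0 r θ • v))
    (F' := fun x θ => c θ • fderiv ℂ f (x + circleMap 0 r θ • v))
    (bound := fun θ => ‖c θ‖ * (2 * C / R)) (Metric.ball_mem_nhds x₀ hR0)
    (by
      filter_upwards [Metric.ball_mem_nhds x₀ hR0] with x hx
      exact (hcont x hx).aestronglyMeasurable)
    ((hcont x₀ (Metric.mem_ball_self hR0)).intervalIntegrable _ _)
    (by
      refine hcc.aestronglyMeasurable.smul ?_
      exact ((measurable_fderiv ℂ f).comp (hline x₀).measurable).aestronglyMeasurable)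
    (.of_forall fun θ _ x hx => hbound x hx θ)
    ((hcc.norm.mul continuous_const).intervalIntegrable _ _)
    (.of_forall fun θ _ x hx => by
      have h1 := (hf.differentiableAt
        (hU.mem_nhds (hsub (hmem x hx _ (hcirc θ))))).hasFDerivAt
      have h2 := h1.comp x ((hasFDerivAt_id x).add_const (circleMap 0 r θ • v))
      exact h2.const_smul (c θ))
  have h2 := hmain.differentiableAt.const_smul (2 * Real.pi * Complex.I : ℂ)⁻¹
  refine h2.congr_of_eventuallyEq ?_
  filter_upwards [Metric.ball_mem_nhds x₀ hR0] with x hx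
  rw [Pi.smul_apply, ← hcauchy x hx, smul_smul, inv_mul_cancel₀ Complex.two_pi_I_ne_zero, one_smul]

/-- Holomorphic maps between open sets of finite dimensional spaces are smooth. -/
lemma contDiffOn_of_differentiableOn {f : E → F} {U : Set E} (hU : IsOpen U)
    (hf : DifferentiableOn ℂ f U) : ContDiffOn ℂ ∞ f U := by
  refine contDiffOn_infty.2 fun m => ?_
  induction m generalizing f with
  | zero => exact contDiffOn_zero.2 hf.continuousOn
  | succ m ih =>
    push_cast
    refine (contDiffOn_succ_iff_fderiv_of_isOpen hU).2 ⟨hf, by simp, ?_⟩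
    exact contDiffOn_clm_apply.2 fun v => ih (differentiableOn_fderiv_apply hU hf v)

end holomorphic

/-! ### Tangent spaces of submanifolds that are graphs in a holomorphic chart -/

section geometry

variable {n : ℕ}

lemma tangentSpace_mono {S M : Set (Cn1 n)} (h : S ⊆ M) (x : Cn1 n) :
    tangentSpace S x ≤ tangentSpace M x := by
  refine Submodule.span_mono ?_
  rintro v ⟨γ, h0, hγ, hS⟩
  exact ⟨γ, h0, hγ, hS.mono fun t ht => h ht⟩

lemma holTangentSpace_mono {S M : Set (Cn1 n)} (h : S ⊆ M) (x : Cn1 n) :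
    holTangentSpace S x ≤ holTangentSpace M x :=
  fun _ hv => ⟨tangentSpace_mono h x hv.1, tangentSpace_mono h x hv.2⟩

/-- The differential of a function vanishing on `S` vanishes on the tangent space. -/
lemma HasFDerivAt.apply_eq_zero_of_mem_tangentSpace {S : Set (Cn1 n)} {x v : Cn1 n}
    {ψ : Cn1 n → ℂ} {ψ' : Cn1 n →L[ℝ] ℂ} (hψ : HasFDerivAt ψ ψ' x)
    (h0 : ∀ᶠ y in 𝓝[S] x, ψ y = 0) (hv : v ∈ tangentSpace S x) : ψ' v = 0 := by
  have hle : tangentSpace S x ≤ LinearMap.ker (ψ' : Cn1 n →ₗ[ℝ] ℂ) := by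
    refine Submodule.span_le.2 ?_
    rintro u ⟨γ, rfl, hγ, hS⟩
    have h1 : HasDerivAt (ψ ∘ γ) (ψ' u) 0 := hψ.comp_hasDerivAt 0 hγ
    have h2 : Tendsto γ (𝓝 0) (𝓝[S] γ 0) :=
      tendsto_nhdsWithin_iff.2 ⟨hγ.continuousAt.tendsto, hS⟩
    have h3 : ψ ∘ γ =ᶠ[𝓝 0] fun _ => (0 : ℂ) := h2.eventually h0
    exact h1.unique ((hasDerivAt_const (0 : ℝ) (0 : ℂ)).congr_of_eventuallyEq h3)
  exact hle hv

/-- In the holomorphic chart `Ψ` the set `M` is, near the point over `z`, the graph of `f`, and `f`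
is smooth near `z`. -/
def IsGraphAt (Ψ : OpenPartialHomeomorph (Cn1 n) (Cn1 n)) (M : Set (Cn1 n))
    (f : (Fin n → ℂ) → ℂ) (z : Fin n → ℂ) : Prop :=
  SmoothNear f z ∧ ∀ᶠ x in 𝓝 (z, f z), x ∈ Ψ.target ∧ (Ψ.symm x ∈ M ↔ x.2 = f x.1)

variable {Ψ : OpenPartialHomeomorph (Cn1 n) (Cn1 n)} {M : Set (Cn1 n)} {f : (Fin n → ℂ) → ℂ}
  {z : Fin n → ℂ}

lemma IsGraphAt.tendsto_graph (h : IsGraphAt Ψ M f z) :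
    Tendsto (fun z' => (z', f z')) (𝓝 z) (𝓝 (z, f z)) :=
  (continuousAt_id.prodMk h.1.contDiffAt.continuousAt).tendsto

lemma IsGraphAt.mem_target (h : IsGraphAt Ψ M f z) : (z, f z) ∈ Ψ.target :=
  h.2.self_of_nhds.1

lemma IsGraphAt.symm_mem (h : IsGraphAt Ψ M f z) : Ψ.symm (z, f z) ∈ M :=
  h.2.self_of_nhds.2.2 rfl

lemma IsGraphAt.tendsto_symm (h : IsGraphAt Ψ M f z) :
    Tendsto (fun z' => Ψ.symm (z', f z')) (𝓝 z) (𝓝 (Ψ.symm (z, f z))) :=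
  (Ψ.continuousAt_symm h.mem_target).tendsto.comp h.tendsto_graph

lemma IsGraphAt.eventually (h : IsGraphAt Ψ M f z) : ∀ᶠ z' in 𝓝 z, IsGraphAt Ψ M f z' :=
  h.1.eventually.and (h.tendsto_graph.eventually h.2.eventually_nhds)

/-- A property of the points `z'` near `z` holds for the base points of all points of `M` near the
point over `z`. -/
lemma IsGraphAt.eventually_nhdsWithin (h : IsGraphAt Ψ M f z) {Q : (Fin n → ℂ) → Prop}
    (hQ : ∀ᶠ z' in 𝓝 z, Q z') : ∀ᶠ p in 𝓝[M] (Ψ.symm (z, f z)),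
      p ∈ Ψ.source ∧ (Ψ p).2 = f (Ψ p).1 ∧ Q (Ψ p).1 := by
  have hs := Ψ.map_target h.mem_target
  have ht : Tendsto Ψ (𝓝 (Ψ.symm (z, f z))) (𝓝 (z, f z)) := by
    have := (Ψ.continuousAt hs).tendsto
    rwa [Ψ.right_inv h.mem_target] at this
  have ht1 : Tendsto (fun p => (Ψ p).1) (𝓝 (Ψ.symm (z, f z))) (𝓝 z) :=
    (continuous_fst.tendsto (z, f z)).comp ht
  filter_upwards [nhdsWithin_le_nhds (Ψ.open_source.mem_nhds hs),
    (ht.eventually h.2).filter_mono nhdsWithin_le_nhds,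
    (ht1.eventually hQ).filter_mono nhdsWithin_le_nhds, self_mem_nhdsWithin] with p h1 h2 h3 h4
  refine ⟨h1, h2.2.1 ?_, h3⟩
  rwa [Ψ.left_inv h1]

lemma hasFDerivAt_chart (hΨ : DifferentiableOn ℂ Ψ Ψ.source)
    {x : Cn1 n} (hx : x ∈ Ψ.target) :
    HasFDerivAt Ψ (fderiv ℂ Ψ (Ψ.symm x)) (Ψ.symm x) :=
  (hΨ.differentiableAt (Ψ.open_source.mem_nhds (Ψ.map_target hx))).hasFDerivAt

lemma hasFDerivAt_chart_symm (hΨ' : DifferentiableOn ℂ Ψ.symm Ψ.target)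
    {x : Cn1 n} (hx : x ∈ Ψ.target) :
    HasFDerivAt Ψ.symm (fderiv ℂ Ψ.symm x) x :=
  (hΨ'.differentiableAt (Ψ.open_target.mem_nhds hx)).hasFDerivAt

lemma fderiv_chart_symm_apply (hΨ : DifferentiableOn ℂ Ψ Ψ.source)
    (hΨ' : DifferentiableOn ℂ Ψ.symm Ψ.target)
    {x : Cn1 n} (hx : x ∈ Ψ.target) (u : Cn1 n) :
    fderiv ℂ Ψ (Ψ.symm x) (fderiv ℂ Ψ.symm x u) = u := by
  have h1 := (hasFDerivAt_chart hΨ hx).comp x (hasFDerivAt_chart_symm hΨ' hx)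
  have h2 : Ψ ∘ Ψ.symm =ᶠ[𝓝 x] id := by
    filter_upwards [Ψ.open_target.mem_nhds hx] with y hy using Ψ.right_inv hy
  have h3 := h1.unique ((hasFDerivAt_id x).congr_of_eventuallyEq h2)
  exact congrArg (fun L : Cn1 n →L[ℂ] Cn1 n => L u) h3

lemma fderiv_symm_chart_apply (hΨ : DifferentiableOn ℂ Ψ Ψ.source)
    (hΨ' : DifferentiableOn ℂ Ψ.symm Ψ.target)
    {x : Cn1 n} (hx : x ∈ Ψ.target) (u : Cn1 n) :
    fderiv ℂ Ψ.symm x (fderiv ℂ Ψ (Ψ.symm x) u) = u := by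
  have h0 := hasFDerivAt_chart_symm hΨ' hx
  nth_rewrite 2 [← Ψ.right_inv hx] at h0
  have h1 := h0.comp (Ψ.symm x) (hasFDerivAt_chart hΨ hx)
  have h2 : Ψ.symm ∘ Ψ =ᶠ[𝓝 (Ψ.symm x)] id := by
    filter_upwards [Ψ.open_source.mem_nhds (Ψ.map_target hx)] with y hy using Ψ.left_inv hy
  have h3 := h1.unique ((hasFDerivAt_id (Ψ.symm x)).congr_of_eventuallyEq h2)
  exact congrArg (fun L : Cn1 n →L[ℂ] Cn1 n => L u) h3

lemma IsGraphAt.hasFDerivAt_symm (hΨ' : DifferentiableOn ℂ Ψ.symm Ψ.target)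
    (h : IsGraphAt Ψ M f z) :
    HasFDerivAt (fun z' => Ψ.symm (z', f z')) (((fderiv ℂ Ψ.symm (z, f z)).restrictScalars ℝ).comp
      ((ContinuousLinearMap.id ℝ (Fin n → ℂ)).prod (fderiv ℝ f z))) z :=
  ((hasFDerivAt_chart_symm hΨ' h.mem_target).restrictScalars ℝ).comp z
    ((hasFDerivAt_id z).prodMk h.1.differentiableAt.hasFDerivAt)

/-- In the chart, the tangent space of `M` is the graph of the differential of `f`. -/
lemma IsGraphAt.mem_tangentSpace_iff (hΨ : DifferentiableOn ℂ Ψ Ψ.source)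
    (hΨ' : DifferentiableOn ℂ Ψ.symm Ψ.target)
    (h : IsGraphAt Ψ M f z) {u : Cn1 n} :
    u ∈ tangentSpace M (Ψ.symm (z, f z)) ↔
      (fderiv ℂ Ψ (Ψ.symm (z, f z)) u).2 =
        fderiv ℝ f z (fderiv ℂ Ψ (Ψ.symm (z, f z)) u).1 := by
  set A := fderiv ℂ Ψ (Ψ.symm (z, f z)) with hA
  constructor
  · intro hu
    have hd := (hasFDerivAt_chart hΨ h.mem_target).restrictScalars ℝ
    have hf1 : HasFDerivAt f (fderiv ℝ f z) (Ψ (Ψ.symm (z, f z))).1 := by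
      rw [Ψ.right_inv h.mem_target]
      exact h.1.differentiableAt.hasFDerivAt
    have hψ := hd.snd.sub (HasFDerivAt.comp (f := fun p => (Ψ p).1) _ hf1 hd.fst)
    have h0 := HasFDerivAt.apply_eq_zero_of_mem_tangentSpace hψ (S := M) (by
      filter_upwards [h.eventually_nhdsWithin (Q := fun _ => True) (.of_forall fun _ => trivial)]
        with p hp
      exact sub_eq_zero.2 hp.2.1) hu
    exact sub_eq_zero.1 h0
  · intro hu
    set v := (A u).1 with hv
    refine Submodule.subset_span ⟨fun t => Ψ.symm (z + t • v, f (z + t • v)), by simp, ?_, ?_⟩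
    · have h1 : HasDerivAt (fun t : ℝ => z + t • v) v 0 := by
        simpa using ((hasDerivAt_id (0 : ℝ)).smul_const v).const_add z
      have h2 := (h.hasFDerivAt_symm hΨ').comp_hasDerivAt_of_eq (0 : ℝ) h1 (by simp)
      have h3 : fderiv ℂ Ψ.symm (z, f z) (v, fderiv ℝ f z v) = u := by
        rw [← hu, Prod.mk.eta, hA, fderiv_symm_chart_apply hΨ hΨ' h.mem_target]
      rw [← h3]
      exact h2
    · have h1 : Tendsto (fun t : ℝ => z + t • v) (𝓝 0) (𝓝 z) := by
        have : Continuous fun t : ℝ => z + t • v := by fun_prop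
        simpa using this.tendsto 0
      filter_upwards [h1.eventually h.eventually] with t ht using ht.symm_mem

lemma IsGraphAt.mem_holTangentSpace_iff (hΨ : DifferentiableOn ℂ Ψ Ψ.source)
    (hΨ' : DifferentiableOn ℂ Ψ.symm Ψ.target)
    (h : IsGraphAt Ψ M f z) {u : Cn1 n} :
    u ∈ holTangentSpace M (Ψ.symm (z, f z)) ↔
      (fderiv ℂ Ψ (Ψ.symm (z, f z)) u).2 =
        fderiv ℝ f z (fderiv ℂ Ψ (Ψ.symm (z, f z)) u).1 ∧
      IsComplexTangent f z (fderiv ℂ Ψ (Ψ.symm (z, f z)) u).1 := by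
  change _ ∧ _ ↔ _
  rw [h.mem_tangentSpace_iff hΨ hΨ', h.mem_tangentSpace_iff hΨ hΨ']
  refine and_congr_right fun hu => ?_
  rw [map_smul, Prod.smul_snd, Prod.smul_fst, hu, smul_eq_mul, IsComplexTangent, eq_comm]

/-- The linear form whose kernel consists of the complex tangent vectors. -/
noncomputable def complexTangentForm (f : (Fin n → ℂ) → ℂ) (z : Fin n → ℂ) :
    (Fin n → ℂ) →ₗ[ℂ] ℂ :=
  ∑ j, conj (wirt (Sum.inr j) f z) • LinearMap.proj j

lemma mem_ker_complexTangentForm {v : Fin n → ℂ} :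
    v ∈ LinearMap.ker (complexTangentForm f z) ↔ IsComplexTangent f z v := by
  rw [isComplexTangent_iff, LinearMap.mem_ker, ← map_eq_zero (starRingEnd ℂ), complexTangentForm]
  simp [mul_comm]

/-- At points where `∂̄f ≠ 0` the CR dimension of `M` is `n - 1`. -/
lemma IsGraphAt.crDim_add_one (hΨ : DifferentiableOn ℂ Ψ Ψ.source)
    (hΨ' : DifferentiableOn ℂ Ψ.symm Ψ.target)
    (h : IsGraphAt Ψ M f z) (hCR : ∃ v, ¬ IsComplexTangent f z v) :
    crDim M (Ψ.symm (z, f z)) + 1 = n := by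
  set A := fderiv ℂ Ψ (Ψ.symm (z, f z)) with hA
  set H := holTangentSpace M (Ψ.symm (z, f z)) with hH
  have hmem : ∀ u : H, (A u).2 = fderiv ℝ f z (A u).1 ∧ IsComplexTangent f z (A u).1 := fun u =>
    (h.mem_holTangentSpace_iff hΨ hΨ').1 u.2
  let T : H →ₗ[ℂ] LinearMap.ker (complexTangentForm f z) :=
    (((LinearMap.fst ℂ (Fin n → ℂ) ℂ).comp (A : Cn1 n →ₗ[ℂ] Cn1 n)).domRestrict H).codRestrict _
      fun u => mem_ker_complexTangentForm.2 (hmem u).2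
  have hT : ∀ u : H, (T u : Fin n → ℂ) = (A u).1 := fun u => rfl
  have hinj : Function.Injective T := by
    refine (injective_iff_map_eq_zero T).2 fun u hu => ?_
    have h1 : (A u).1 = 0 := by rw [← hT, hu]; rfl
    have h2 : (A u).2 = 0 := by rw [(hmem u).1, h1, map_zero]
    have h3 : A u = 0 := Prod.ext h1 h2
    have h4 := fderiv_symm_chart_apply hΨ hΨ' h.mem_target (u : Cn1 n)
    rw [← hA, h3, map_zero] at h4
    exact Subtype.ext h4.symm
  have hsurj : Function.Surjective T := by
    rintro ⟨v, hv⟩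
    have h1 := fderiv_chart_symm_apply hΨ hΨ' h.mem_target (v, fderiv ℝ f z v)
    refine ⟨⟨fderiv ℂ Ψ.symm (z, f z) (v, fderiv ℝ f z v), ?_⟩, ?_⟩
    · rw [hH, h.mem_holTangentSpace_iff hΨ hΨ', h1]
      exact ⟨rfl, mem_ker_complexTangentForm.1 hv⟩
    · exact Subtype.ext (congrArg Prod.fst h1)
  have hfin := (LinearEquiv.ofBijective T ⟨hinj, hsurj⟩).finrank_eq
  have hne : complexTangentForm f z ≠ 0 := by
    obtain ⟨v, hv⟩ := hCR
    intro h0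
    exact hv (mem_ker_complexTangentForm.1 (by rw [h0]; rfl))
  have h1 := Module.Dual.finrank_ker_add_one_of_ne_zero hne
  rw [crDim, ← hH, hfin, h1, Module.finrank_fin_fun]

lemma SmoothNear.eventually_exists_not_isComplexTangent (hf : SmoothNear f z)
    (hCR : ∃ v, ¬ IsComplexTangent f z v) :
    ∀ᶠ z' in 𝓝 z, ∃ v, ¬ IsComplexTangent f z' v := by
  obtain ⟨v, hv⟩ := hCR
  rw [IsComplexTangent] at hv
  have h1 : ContinuousAt (fun x => fderiv ℝ f x (Complex.I • v)) z :=
    (hf.fderiv_apply _).contDiffAt.continuousAt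
  have h2 : ContinuousAt (fun x => Complex.I * fderiv ℝ f x v) z :=
    continuousAt_const.mul (hf.fderiv_apply _).contDiffAt.continuousAt
  filter_upwards [(h1.ne_iff_eventually_ne h2).1 hv] with x hx
  exact ⟨v, hx⟩

lemma IsGraphAt.isCRPoint (hΨ : DifferentiableOn ℂ Ψ Ψ.source)
    (hΨ' : DifferentiableOn ℂ Ψ.symm Ψ.target)
    (h : IsGraphAt Ψ M f z) (hCR : ∃ v, ¬ IsComplexTangent f z v) :
    IsCRPoint M (Ψ.symm (z, f z)) := by
  refine ⟨h.symm_mem, ?_⟩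
  filter_upwards [h.eventually_nhdsWithin
    (h.eventually.and (h.1.eventually_exists_not_isComplexTangent hCR))] with p hp
  obtain ⟨hps, hpf, hpg, hpCR⟩ := hp
  have h1 := hpg.crDim_add_one hΨ hΨ' hpCR
  have h2 := h.crDim_add_one hΨ hΨ' hCR
  rw [← hpf, Prod.mk.eta, Ψ.left_inv hps] at h1
  omega

/-- A defining function of a submanifold of codimension `l > 2`, pulled back to the `z`-space, has
a component with non-zero differential. -/
lemma IsGraphAt.exists_fderiv_ne_zero (hΨ : DifferentiableOn ℂ Ψ Ψ.source)
    (hΨ' : DifferentiableOn ℂ Ψ.symm Ψ.target)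
    (h : IsGraphAt Ψ M f z) {l : ℕ} (hl : 2 < l)
    {r : Cn1 n → (Fin l → ℝ)} (hr : DifferentiableAt ℝ r (Ψ.symm (z, f z)))
    (hsurj : Function.Surjective (fderiv ℝ r (Ψ.symm (z, f z)))) :
    ∃ i, fderiv ℝ (fun z' => r (Ψ.symm (z', f z')) i) z ≠ 0 := by
  by_contra! hcon
  set σ' := ((fderiv ℂ Ψ.symm (z, f z)).restrictScalars ℝ).comp
    ((ContinuousLinearMap.id ℝ (Fin n → ℂ)).prod (fderiv ℝ f z)) with hσ'
  have hinj : Function.Injective σ' := by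
    refine (injective_iff_map_eq_zero σ').2 fun v hv => ?_
    have h1 := fderiv_chart_symm_apply hΨ hΨ' h.mem_target (v, fderiv ℝ f z v)
    rw [show fderiv ℂ Ψ.symm (z, f z) (v, fderiv ℝ f z v) = 0 from hv, map_zero] at h1
    exact (congrArg Prod.fst h1).symm
  have hcomp : HasFDerivAt (fun z' => r (Ψ.symm (z', f z')))
      ((fderiv ℝ r (Ψ.symm (z, f z))).comp σ') z :=
    HasFDerivAt.comp z (f := fun z' => Ψ.symm (z', f z')) hr.hasFDerivAt (h.hasFDerivAt_symm hΨ')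
  have hle : LinearMap.range (σ' : (Fin n → ℂ) →ₗ[ℝ] Cn1 n) ≤
      LinearMap.ker (fderiv ℝ r (Ψ.symm (z, f z)) : Cn1 n →ₗ[ℝ] (Fin l → ℝ)) := by
    rintro _ ⟨v, rfl⟩
    refine LinearMap.mem_ker.2 ?_
    ext i
    have h1 := (hasFDerivAt_pi'.1 hcomp i).fderiv
    rw [hcon i] at h1
    exact (congrArg (fun L : (Fin n → ℂ) →L[ℝ] ℝ => L v) h1).symm
  have h1 := Submodule.finrank_mono hle
  have h2 := LinearMap.finrank_range_add_finrank_ker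
    (fderiv ℝ r (Ψ.symm (z, f z)) : Cn1 n →ₗ[ℝ] (Fin l → ℝ))
  rw [LinearMap.range_eq_top.2 hsurj, finrank_top, Module.finrank_fin_fun,
    finrank_real_of_complex, Module.finrank_prod, Module.finrank_fin_fun,
    Module.finrank_self] at h2
  rw [LinearMap.finrank_range_of_inj hinj, finrank_real_of_complex, Module.finrank_fin_fun] at h1
  omega

/-- Non-minimality of a submanifold implies that of its graph in a holomorphic chart. -/
theorem nonMinimalGraph_of_nonMinimalNear (hΨ : DifferentiableOn ℂ Ψ Ψ.source)
    (hΨ' : DifferentiableOn ℂ Ψ.symm Ψ.target)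
    {a : Cn1 n} (ha : a ∈ Ψ.source) (hΨa : Ψ a = 0)
    (hf : SmoothNear f 0) (hf0 : f 0 = 0) (hdef : DefinedNearZeroBy (Ψ '' (M ∩ Ψ.source)) f)
    (hM : NonMinimalNear M a) : NonMinimalGraph f := by
  have h0t : (0 : Cn1 n) ∈ Ψ.target := hΨa ▸ Ψ.map_source ha
  have h0a : Ψ.symm 0 = a := by rw [← hΨa, Ψ.left_inv ha]
  have hgraph0 : IsGraphAt Ψ M f 0 := by
    refine ⟨hf, ?_⟩
    rw [hf0]
    filter_upwards [hdef, Ψ.open_target.mem_nhds h0t] with x hx hxt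
    rw [← hx]
    refine ⟨hxt, fun hxM => ⟨_, ⟨hxM, Ψ.map_target hxt⟩, Ψ.right_inv hxt⟩, ?_⟩
    rintro ⟨p, ⟨hpM, hps⟩, rfl⟩
    rwa [Ψ.left_inv hps]
  have hM' : ∀ᶠ z in 𝓝 (0 : Fin n → ℂ), IsCRPoint M (Ψ.symm (z, f z)) →
      IsNonMinimalPoint 2 M (Ψ.symm (z, f z)) := by
    have h1 := hgraph0.tendsto_symm
    rw [hf0, Prod.mk_zero_zero, h0a] at h1
    exact h1.eventually hM
  filter_upwards [hgraph0.eventually, hM'] with z hz hzM hCR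
  obtain ⟨l, S, hl, hSM, hzS, hS, hSCR, hST⟩ := hzM (hz.isCRPoint hΨ hΨ' hCR)
  obtain ⟨U, r, hU, hzU, hr, hSU, hsurj⟩ := hS _ hzS
  have hrU : ∀ y ∈ U, ContDiffAt ℝ ∞ r y := fun y hy => hr.contDiffAt (hU.mem_nhds hy)
  obtain ⟨i, hi⟩ := hz.exists_fderiv_ne_zero hΨ hΨ' hl
    ((hrU _ hzU).differentiableAt (by simp)) hsurj
  set S' : Set (Fin n → ℂ) := {z' | Ψ.symm (z', f z') ∈ S} with hS'
  have hσS : Tendsto (fun z' => Ψ.symm (z', f z')) (𝓝[S'] z) (𝓝[S] (Ψ.symm (z, f z))) :=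
    tendsto_nhdsWithin_iff.2 ⟨hz.tendsto_symm.mono_left nhdsWithin_le_nhds, self_mem_nhdsWithin⟩
  refine ⟨S', fun z' => r (Ψ.symm (z', f z')) i, hzS, ?_, ?_, hi, ?_⟩
  · filter_upwards [hz.eventually, hz.tendsto_symm.eventually (hU.mem_nhds hzU)] with y hy hyU
    have h1 : ContDiffAt ℝ ∞ Ψ.symm (y, f y) :=
      ((contDiffOn_of_differentiableOn Ψ.open_target hΨ').contDiffAt
        (Ψ.open_target.mem_nhds hy.mem_target)).restrict_scalars ℝ
    have h2 : ContDiffAt ℝ ∞ (fun z' => Ψ.symm (z', f z')) y :=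
      h1.comp y (contDiffAt_id.prodMk hy.1.contDiffAt)
    exact contDiffAt_pi.1 (ContDiffAt.comp y (f := fun z' => Ψ.symm (z', f z')) (hrU _ hyU) h2) i
  · filter_upwards [self_mem_nhdsWithin,
      (hz.tendsto_symm.eventually (hU.mem_nhds hzU)).filter_mono nhdsWithin_le_nhds] with y hy hyU
    have h1 : Ψ.symm (y, f y) ∈ S ∩ U := ⟨hy, hyU⟩
    rw [hSU] at h1
    exact congrFun h1.2 i
  · filter_upwards [self_mem_nhdsWithin, hσS.eventually (hSCR _ hzS).2,
      hz.eventually.filter_mono nhdsWithin_le_nhds,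
      (hz.1.eventually_exists_not_isComplexTangent hCR).filter_mono nhdsWithin_le_nhds]
      with y hyS hyCR hy hyt ψ hψ hψ0 v hv
    -- The complex tangent spaces of `S` and `M` agree near the given point, by constancy of rank.
    have hdim : Module.finrank ℂ (holTangentSpace S (Ψ.symm (y, f y))) =
        Module.finrank ℂ (holTangentSpace M (Ψ.symm (y, f y))) := by
      have h1 := hz.crDim_add_one hΨ hΨ' hCR
      have h2 := hy.crDim_add_one hΨ hΨ' hyt
      have h3 : crDim S (Ψ.symm (z, f z)) = crDim M (Ψ.symm (z, f z)) := by
        rw [crDim, crDim, hST]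
      change crDim S _ = crDim M _
      omega
    have heq := Submodule.eq_of_le_of_finrank_eq (holTangentSpace_mono hSM _) hdim
    have hAu := fderiv_chart_symm_apply hΨ hΨ' hy.mem_target (v, fderiv ℝ f y v)
    set u := fderiv ℂ Ψ.symm (y, f y) (v, fderiv ℝ f y v) with hu
    have huS : u ∈ holTangentSpace S (Ψ.symm (y, f y)) := by
      rw [heq, hy.mem_holTangentSpace_iff hΨ hΨ', hAu]
      exact ⟨rfl, hv⟩
    have hd := (hasFDerivAt_chart hΨ hy.mem_target).restrictScalars ℝ
    have hψ1 : HasFDerivAt ψ (fderiv ℝ ψ y) (Ψ (Ψ.symm (y, f y))).1 := by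
      rw [Ψ.right_inv hy.mem_target]
      exact hψ.hasFDerivAt
    have hcomp := HasFDerivAt.comp (f := fun p => (Ψ p).1) _ hψ1 hd.fst
    have h0 := HasFDerivAt.apply_eq_zero_of_mem_tangentSpace hcomp (S := S) (by
      have h1 := hy.eventually_nhdsWithin (eventually_nhdsWithin_iff.1 hψ0)
      filter_upwards [h1.filter_mono (nhdsWithin_mono _ hSM), self_mem_nhdsWithin] with p hp hpS
      obtain ⟨hps, hpf, hpψ⟩ := hp
      refine hpψ ?_
      change Ψ.symm ((Ψ p).1, f (Ψ p).1) ∈ S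
      rwa [← hpf, Prod.mk.eta, Ψ.left_inv hps]) huS.1
    have h2 : fderiv ℝ ψ y (fderiv ℂ Ψ (Ψ.symm (y, f y)) u).1 = 0 := h0
    rwa [hAu] at h2

end geometry

/-! ### Change of coordinates -/

section coordinates

variable {n : ℕ}

/-- A shear `(z, w) ↦ (z, w + B(z, w))` with `B` of order at least three in the weighted sense is a
holomorphic change of coordinates near `0`. -/
lemma exists_isHolChange_shear {B : Cn1 n → ℂ} (hB : ContDiff ℂ ∞ B)
    (hBo : B =o[𝓝 0] fun x : Cn1 n => ‖x.1‖ ^ 2 + ‖x.2‖) :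
    ∃ Θ : OpenPartialHomeomorph (Cn1 n) (Cn1 n), IsHolChange Θ 0 ∧
      ∀ x ∈ Θ.source, Θ x = (x.1, x.2 + B x) := by
  set G : Cn1 n → Cn1 n := fun x => (x.1, x.2 + B x) with hG
  have hGc : ContDiff ℂ ∞ G := contDiff_fst.prodMk (contDiff_snd.add hB)
  have hB0 : B 0 = 0 := by simpa using (hBo.def one_pos).self_of_nhds
  have hG0 : G 0 = 0 := Prod.ext rfl (by simp [hG, hB0])
  have hd : HasFDerivAt G ((ContinuousLinearEquiv.refl ℂ (Cn1 n) : Cn1 n ≃L[ℂ] Cn1 n) :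
      Cn1 n →L[ℂ] Cn1 n) 0 := by
    refine (hasFDerivAt_fst.prodMk
      (hasFDerivAt_snd.add (hasFDerivAt_zero_of_isLittleO hBo))).congr_fderiv ?_
    ext <;> simp
  set e := hGc.contDiffAt.toOpenPartialHomeomorph G hd (by simp) with he
  have heG : ∀ x, e x = G x := fun x => rfl
  have h0e : (0 : Cn1 n) ∈ e.source :=
    hGc.contDiffAt.mem_toOpenPartialHomeomorph_source hd (by simp)
  have hsymm : ContDiffAt ℂ ∞ e.symm (G 0) := hGc.contDiffAt.to_localInverse hd (by simp)
  have hev : ∀ᶠ y in 𝓝 (G 0), DifferentiableAt ℂ e.symm y := by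
    filter_upwards [(hsymm.of_le (m := 1) (by simp)).eventually (by simp)] with y hy
    exact hy.differentiableAt (by simp)
  obtain ⟨V, hV, hVo, h0V⟩ := eventually_nhds_iff.1 hev
  refine ⟨(e.symm.restrOpen V hVo).symm, ⟨?_, hG0, ?_, ?_⟩, fun x _ => rfl⟩
  · rw [OpenPartialHomeomorph.symm_source]
    have h1 : G 0 ∈ (e.symm.restrOpen V hVo).source := ⟨e.map_source h0e, h0V⟩
    have h2 := (e.symm.restrOpen V hVo).map_source h1
    have h3 : (e.symm.restrOpen V hVo) (G 0) = 0 := e.left_inv h0e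
    rwa [h3] at h2
  · exact (hGc.differentiable (by simp)).differentiableOn
  · exact fun y hy => (hV y hy.2).differentiableWithinAt

lemma IsHolChange.trans {Ψ Θ : OpenPartialHomeomorph (Cn1 n) (Cn1 n)} {a : Cn1 n}
    (hΨ : IsHolChange Ψ a) (hΘ : IsHolChange Θ 0) : IsHolChange (Ψ.trans Θ) a := by
  obtain ⟨h1, h2, h3, h4⟩ := hΨ
  obtain ⟨k1, k2, k3, k4⟩ := hΘ
  refine ⟨?_, ?_, ?_, ?_⟩
  · rw [OpenPartialHomeomorph.trans_source]
    exact ⟨h1, by rwa [Set.mem_preimage, h2]⟩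
  · rw [OpenPartialHomeomorph.trans_apply, h2, k2]
  · rw [OpenPartialHomeomorph.trans_source]
    exact k3.comp (h3.mono Set.inter_subset_left) fun x hx => hx.2
  · rw [OpenPartialHomeomorph.trans_target]
    exact h4.comp (k4.mono Set.inter_subset_left) fun x hx => hx.2

/-- The equation of a graph after a shear. -/
lemma DefinedNearZeroBy.shear {A : Set (Cn1 n)} {f : (Fin n → ℂ) → ℂ} (h : DefinedNearZeroBy A f)
    (hf : ContinuousAt f 0) (hf0 : f 0 = 0) {Θ : OpenPartialHomeomorph (Cn1 n) (Cn1 n)}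
    (hΘ : IsHolChange Θ 0) {B : Cn1 n → ℂ} (hB : ∀ x ∈ Θ.source, Θ x = (x.1, x.2 + B x)) :
    DefinedNearZeroBy (Θ '' (A ∩ Θ.source)) fun z => f z + B (z, f z) := by
  have h0t : (0 : Cn1 n) ∈ Θ.target := hΘ.2.1 ▸ Θ.map_source hΘ.1
  have h00 : Θ.symm 0 = 0 := by
    have := Θ.left_inv hΘ.1
    rwa [hΘ.2.1] at this
  have ht : Tendsto Θ.symm (𝓝 0) (𝓝 0) := by
    have := (Θ.continuousAt_symm h0t).tendsto
    rwa [h00] at this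
  have hg : Tendsto (fun x : Cn1 n => (x.1, f x.1)) (𝓝 0) (𝓝 0) := by
    have h1 : ContinuousAt (fun x : Cn1 n => (x.1, f x.1)) 0 :=
      continuousAt_fst.prodMk (ContinuousAt.comp_of_eq hf continuousAt_fst rfl)
    have h2 := h1.tendsto
    simp only [Prod.fst_zero, hf0] at h2
    exact h2
  filter_upwards [Θ.open_target.mem_nhds h0t, ht.eventually h,
    hg.eventually (Θ.open_source.mem_nhds hΘ.1)] with x hx hA hs
  have hiff : x ∈ Θ '' (A ∩ Θ.source) ↔ Θ.symm x ∈ A := by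
    refine ⟨?_, fun hxA => ⟨_, ⟨hxA, Θ.map_target hx⟩, Θ.right_inv hx⟩⟩
    rintro ⟨p, ⟨hpA, hps⟩, rfl⟩
    rwa [Θ.left_inv hps]
  rw [hiff, hA]
  constructor
  · intro h1
    have h2 := hB _ (Θ.map_target hx)
    rw [Θ.right_inv hx] at h2
    have h3 : (Θ.symm x).1 = x.1 := (congrArg Prod.fst h2).symm
    have h4 : x.2 = (Θ.symm x).2 + B (Θ.symm x) := congrArg Prod.snd h2
    have h5 : Θ.symm x = (x.1, f x.1) := Prod.ext h3 (by rw [h1, h3])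
    rw [h4, h5]
  · intro h1
    have h2 : Θ (x.1, f x.1) = x := by
      rw [hB _ hs]
      exact Prod.ext rfl h1.symm
    have h3 : Θ.symm x = (x.1, f x.1) := by
      rw [← Θ.left_inv hs, h2]
    rw [h3]

lemma image_trans_inter_source (Ψ Θ : OpenPartialHomeomorph (Cn1 n) (Cn1 n)) (M : Set (Cn1 n)) :
    (Ψ.trans Θ) '' (M ∩ (Ψ.trans Θ).source) = Θ '' (Ψ '' (M ∩ Ψ.source) ∩ Θ.source) := by
  ext x
  rw [OpenPartialHomeomorph.trans_source]
  constructor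
  · rintro ⟨p, ⟨hpM, hpΨ, hpΘ⟩, rfl⟩
    exact ⟨Ψ p, ⟨⟨p, ⟨hpM, hpΨ⟩, rfl⟩, hpΘ⟩, rfl⟩
  · rintro ⟨_, ⟨⟨p, ⟨hpM, hpΨ⟩, rfl⟩, hpΘ⟩, rfl⟩
    exact ⟨p, ⟨hpM, hpΨ, hpΘ⟩, rfl⟩

lemma evalFun_quadPoly (lam : Fin n → ℝ) : evalFun (quadPoly lam) = quadric lam := by
  ext z
  simp [evalFun, quadPoly, quadric]

/-- Flattening to order `N` of a non-minimal submanifold which in the chart `Ψ` is a graph over a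
quadric up to terms of higher order. -/
theorem exists_shear_flattening (hn : 2 ≤ n) {M : Set (Cn1 n)} {a : Cn1 n} {lam : Fin n → ℝ}
    (h0 : ∀ i, 0 ≤ lam i) (hlam : ∃ i, lam i ≠ 1 / 2)
    {Ψ : OpenPartialHomeomorph (Cn1 n) (Cn1 n)} (hΨ : IsHolChange Ψ a) {f : (Fin n → ℂ) → ℂ}
    (hf : SmoothNear f 0) (hfo : (fun z => f z - quadric lam z) =o[𝓝 0] fun z => ‖z‖ ^ 2)
    (hdef : DefinedNearZeroBy (Ψ '' (M ∩ Ψ.source)) f) (hM : NonMinimalNear M a) (N : ℕ) :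
    ∃ (Θ : OpenPartialHomeomorph (Cn1 n) (Cn1 n)) (B : Cn1 n → ℂ) (ρ : (Fin n → ℂ) → ℂ),
      IsHolChange Θ 0 ∧ (∀ x ∈ Θ.source, Θ x = (x.1, x.2 + B x)) ∧
      (B =o[𝓝 0] fun x => ‖x.1‖ ^ 2 + ‖x.2‖) ∧ SmoothNear ρ 0 ∧
      DefinedNearZeroBy ((Ψ.trans Θ) '' (M ∩ (Ψ.trans Θ).source)) ρ ∧
      ((fun z => (ρ z).im) =O[𝓝 0] fun z => ‖z‖ ^ N) := by
  have hlead : HasLead 2 f (quadPoly lam) := by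
    have hfo' : (f - evalFun (quadPoly lam)) =o[𝓝 0] fun z => ‖z‖ ^ 2 := by
      rw [evalFun_quadPoly]
      exact hfo
    have h1 : FlatTo 2 (f - evalFun (quadPoly lam)) :=
      flatTo_of_isBigO (hf.sub (smoothNear_evalFun _ 0)) hfo'.isBigO
    exact ⟨quadPoly_isHomogeneous lam, h1.succ_of_isLittleO hfo'⟩
  have hf0 : f 0 = 0 := hlead.flatTo.2.1
  have hNM := nonMinimalGraph_of_nonMinimalNear hΨ.2.2.1 hΨ.2.2.2 hΨ.1 hΨ.2.1 hf hf0 hdef hM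
  obtain ⟨B, hB, hBo, hρ, hflat⟩ := hNM.exists_flattening hn h0 hlam hlead N
  obtain ⟨Θ, hΘ, hΘB⟩ := exists_isHolChange_shear hB hBo
  refine ⟨Θ, B, fun z => f z + B (z, f z), hΘ, hΘB, hBo, hρ.smoothNear, ?_, ?_⟩
  · rw [image_trans_inter_source]
    exact hdef.shear hf.contDiffAt.continuousAt hf0 hΘ hΘB
  · exact Complex.isBigO_ofReal_left.1 (hflat.mono (by omega : N ≤ N + 3)).isBigO

end coordinates

end CRFlat

theorem theorem3p1 (n : ℕ) (hn : 2 ≤ n) :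
    (∀ (M : Set (CRFlat.Cn1 n)) (lam : Fin n → ℝ) (p E : (Fin n → ℂ) → ℝ),
      CRFlat.IsSmoothSubmanifold 2 M →
      (∀ i, 0 ≤ lam i) →
      CRFlat.SmoothNear p 0 → CRFlat.SmoothNear E 0 →
      (p =O[𝓝 0] fun z => ‖z‖ ^ 3) → (E =O[𝓝 0] fun z => ‖z‖ ^ 3) →
      CRFlat.DefinedNearZeroBy M
        (fun z => CRFlat.quadric lam z + (p z : ℂ) + Complex.I * (E z : ℂ)) →
      (∃ i, lam i ≠ 1 / 2) →
      CRFlat.NonMinimalNear M 0 →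
      ∀ N : ℕ, ∃ (Φ : OpenPartialHomeomorph (CRFlat.Cn1 n) (CRFlat.Cn1 n))
        (B : CRFlat.Cn1 n → ℂ) (ρ : (Fin n → ℂ) → ℂ),
        CRFlat.IsHolChange Φ 0 ∧
        (∀ x ∈ Φ.source, Φ x = (x.1, x.2 + B x)) ∧
        (B =o[𝓝 0] fun x => ‖x.1‖ ^ 2 + ‖x.2‖) ∧
        CRFlat.SmoothNear ρ 0 ∧
        CRFlat.DefinedNearZeroBy (Φ '' (M ∩ Φ.source)) ρ ∧
        ((fun z => (ρ z).im) =O[𝓝 0] fun z => ‖z‖ ^ N)) ∧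
    (∀ (M : Set (CRFlat.Cn1 n)) (a : CRFlat.Cn1 n) (lam : Fin n → ℝ),
      CRFlat.IsSmoothSubmanifold 2 M →
      CRFlat.HasBishopInvariants M a lam →
      (∃ i, lam i ≠ 1 / 2) →
      CRFlat.NonMinimalNear M a →
      ∀ N : ℕ, ∃ (Φ : OpenPartialHomeomorph (CRFlat.Cn1 n) (CRFlat.Cn1 n))
        (ρ : (Fin n → ℂ) → ℂ),
        CRFlat.IsHolChange Φ a ∧
        CRFlat.SmoothNear ρ 0 ∧
        CRFlat.DefinedNearZeroBy (Φ '' (M ∩ Φ.source)) ρ ∧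
        ((fun z => (ρ z).im) =O[𝓝 0] fun z => ‖z‖ ^ N)) := by
  refine ⟨?_, ?_⟩
  · intro M lam p E _ h0 hp hE hpO hEO hdef hlam hM N
    have hreal : ∀ u : (Fin n → ℂ) → ℝ, CRFlat.SmoothNear u 0 →
        CRFlat.SmoothNear (fun z => (u z : ℂ)) 0 := fun u hu => by
      filter_upwards [hu] with x hx using Complex.ofRealCLM.contDiff.contDiffAt.comp x hx
    have hq : CRFlat.SmoothNear (CRFlat.quadric lam) 0 := by
      rw [← CRFlat.evalFun_quadPoly]
      exact CRFlat.smoothNear_evalFun _ 0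
    have hf : CRFlat.SmoothNear
        (fun z => CRFlat.quadric lam z + (p z : ℂ) + Complex.I * (E z : ℂ)) 0 :=
      (hq.add (hreal p hp)).add ((CRFlat.smoothNear_const Complex.I 0).mul (hreal E hE))
    have hfo : (fun z => CRFlat.quadric lam z + (p z : ℂ) + Complex.I * (E z : ℂ) -
        CRFlat.quadric lam z) =o[𝓝 0] fun z => ‖z‖ ^ 2 := by
      have h1 : (fun z => (p z : ℂ) + Complex.I * (E z : ℂ)) =O[𝓝 0] fun z => ‖z‖ ^ 3 :=
        (Complex.isBigO_ofReal_left.2 hpO).add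
          ((Complex.isBigO_ofReal_left.2 hEO).const_mul_left _)
      refine (h1.trans_isLittleO ((isLittleO_pow_pow (𝕜 := ℝ)
        (by norm_num : 2 < 3)).comp_tendsto tendsto_norm_zero)).congr_left fun z => ?_
      ring
    have hid : CRFlat.IsHolChange (OpenPartialHomeomorph.refl (CRFlat.Cn1 n)) 0 :=
      ⟨trivial, rfl, differentiableOn_id, differentiableOn_id⟩
    obtain ⟨Θ, B, ρ, hΘ, hB, hBo, hρ, hdef', hO⟩ := CRFlat.exists_shear_flattening hn h0 hlam hid
      hf hfo (by simpa using hdef) hM N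
    rw [OpenPartialHomeomorph.refl_trans] at hdef'
    exact ⟨Θ, B, ρ, hΘ, hB, hBo, hρ, hdef', hO⟩
  · intro M a lam _ hbishop hlam hM N
    obtain ⟨h0, Ψ, f, hΨ, hf, hfo, hdef⟩ := hbishop
    obtain ⟨Θ, B, ρ, hΘ, _, _, hρ, hdef', hO⟩ := CRFlat.exists_shear_flattening hn h0 hlam hΨ
      hf hfo hdef hM N
    exact ⟨Ψ.trans Θ, ρ, hΨ.trans hΘ, hρ, hdef', hO⟩
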